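/- Let $n\ge 3$ and let $(M,d,\mu)$ be a compact metric space with a finite Borel measure. Let $\Omega\subset M$ be an open dense subset which is a smooth $n$-dimensional manifold with a smooth Riemannian metric $g$ whose Riemannian distance on $\Omega$ is $d|_\Omega$, and suppose $d\mu=h^2\,dV_g$ (in particular $\mu(M\setminus\Omega)=0$), where $h$ is strictly positive and continuous on $M$ and smooth on $\Omega$. Let $W^{1,2}(M)$ be the completion of the space $\mathrm{Lip}(M)$ of real Lipschitz functions with respect to the norm $\left(\int_\Omega|df|^2\,d\mu+\int_M|f|^2\,d\mu\right)^{1/2}$. Assume that (i) $C^1_0(\Omega)$ is dense in $W^{1,2}(M)$; (ii) the $n$-dimensional Hausdorff measure is absolutely continuous with respect to $\mu$, and both measures are Ahlfors $n$-regular: for some $C>0$ (for each of the two measures $\nu$), $C^{-1}r^n\le\nu(B(x,r))\le Cr^n$ for all $x\in M$ and $0<r\le\operatorname{diam}(M)$; (iii) the Sobolev inequality holds: there are $A,B>0$ such that $$\|f\|_{L^{2n/(n-2)}(M,\mu)}^2\le A\int_\Omega|df|^2\,d\mu+B\int_M|f|^2\,d\mu$$ for all $f\in\mathrm{Lip}(M)$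 (equivalently, for all $f\in W^{1,2}(M)$). Then for every $p\in(n,\infty)$ the inclusion of $\mathrm{Lip}(M)$ into $L^{2p/(p-2)}(M,\mu)$ extends to an injective compact linear operator $$W^{1,2}(M)\longrightarrow L^{\frac{2p}{p-2}}(M,\mu).$$ Moreover, let $-\Delta$ be the Friedrichs extension in $L^2(M,\mu)$ of the quadratic form $f\mapsto\int_\Omega|\nabla f|^2\,d\mu$ with core $C_0^\infty(\Omega)$. Then $-\Delta$ is self-adjoint and has discrete spectrum, that is, its spectrum consists of isolated eigenvalues of finite multiplicity. -/

import Mathlib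

open scoped Manifold ContDiff ENNReal NNReal Topology
open MeasureTheory Set Filter Bundle TopologicalSpace

-- This instance would otherwise compete with the standard charted space structure of `ℝⁿ`.
attribute [-instance] TopCat.of.chartedSpace

set_option linter.unusedSectionVars false

noncomputable section
namespace AlmostSmooth
section Manifold
variable (n : ℕ) {X : Type*} [TopologicalSpace X] [ChartedSpace (EuclideanSpace ℝ (Fin n)) X]

instance (x : X) : FiniteDimensional ℝ (TangentSpace (𝓡 n) x) :=
  inferInstanceAs (FiniteDimensional ℝ (EuclideanSpace ℝ (Fin n)))

variable  [RiemannianBundle (fun x : X => TangentSpace (𝓡 n) x)]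
instance (x : X) : CompleteSpace (TangentSpace (𝓡 n) x) := FiniteDimensional.complete ℝ _

/-- The Riemannian gradient `∇f(x)`, dual to `df(x)`; it is `0` where `f` is not differentiable. -/
def grad (f : X → ℝ) (x : X) : TangentSpace (𝓡 n) x :=
  (InnerProductSpace.toDual ℝ (TangentSpace (𝓡 n) x)).symm (mvfderiv (𝓡 n) f x)

variable {n}
/-- The coordinate vector field of the chart `e` with constant coordinates `v`, at the point with
coordinates `y`. -/
def coordVector (e : OpenPartialHomeomorph X (EuclideanSpace ℝ (Fin n)))
    (y v : EuclideanSpace ℝ (Fin n)) : TangentSpace (𝓡 n) (e.symm y) :=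
  mfderiv (𝓡 n) (𝓡 n) e.symm y v

/-- The matrix `g_ij(y)` of the metric in the coordinates of the chart `e`. -/
def chartGram (e : OpenPartialHomeomorph X (EuclideanSpace ℝ (Fin n)))
    (y : EuclideanSpace ℝ (Fin n)) : Matrix (Fin n) (Fin n) ℝ :=
  Matrix.of fun i j =>
    inner ℝ (coordVector e y (EuclideanSpace.single i 1))
      (coordVector e y (EuclideanSpace.single j 1))
end Manifold

theorem measurableSet_source_inter_preimage {n : ℕ} {X : Type*} [TopologicalSpace X]
    [MeasurableSpace X] [BorelSpace X]
    (e : OpenPartialHomeomorph X (EuclideanSpace ℝ (Fin n)))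
    {s : Set (EuclideanSpace ℝ (Fin n))} (hs : MeasurableSet s) :
    MeasurableSet (e.source ∩ e ⁻¹' s) := by
  have h1 : Measurable (e.source.domRestrict e) :=
    (continuousOn_iff_continuous_domRestrict.1 e.continuousOn).measurable
  have h4 := e.open_source.measurableSet.subtype_image (h1 hs)
  convert h4 using 1
  ext y
  simp only [mem_inter_iff, mem_image, Subtype.exists]
  exact ⟨fun h => ⟨y, h.1, h.2, rfl⟩, fun ⟨a, ha, hb, hab⟩ => hab ▸ ⟨ha, hb⟩⟩

section Lemmas
variable {n : ℕ} {X : Type*}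

section top
variable [TopologicalSpace X] [ChartedSpace (EuclideanSpace ℝ (Fin n)) X]
  [IsManifold (𝓡 n) ∞ X] {e : OpenPartialHomeomorph X (EuclideanSpace ℝ (Fin n))}

theorem mdifferentiableAt_iff_chart (he : e ∈ atlas (EuclideanSpace ℝ (Fin n)) X) (f : X → ℝ)
    {y : EuclideanSpace ℝ (Fin n)} (hy : y ∈ e.target) :
    MDifferentiableAt (𝓡 n) 𝓘(ℝ, ℝ) f (e.symm y) ↔ DifferentiableAt ℝ (f ∘ e.symm) y := by
  have he1 : MDifferentiableAt (𝓡 n) (𝓡 n) e.symm y := mdifferentiableAt_atlas_symm he hy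
  have he2 : MDifferentiableAt (𝓡 n) (𝓡 n) e (e.symm y) :=
    mdifferentiableAt_atlas he (e.map_target hy)
  rw [← mdifferentiableAt_iff_differentiableAt]
  refine ⟨fun h => h.comp y he1, fun h => ?_⟩
  have h' : MDifferentiableAt (𝓡 n) 𝓘(ℝ, ℝ) ((f ∘ e.symm) ∘ e) (e.symm y) := by
    refine MDifferentiableAt.comp _ ?_ he2
    rwa [e.right_inv hy]
  refine h'.congr_of_eventuallyEq ?_
  filter_upwards [e.open_source.mem_nhds (e.map_target hy)] with z hz
  simp [e.left_inv hz]

theorem mvfderiv_coordVector (he : e ∈ atlas (EuclideanSpace ℝ (Fin n)) X) (f : X → ℝ)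
    {y : EuclideanSpace ℝ (Fin n)} (hy : y ∈ e.target) (v : EuclideanSpace ℝ (Fin n)) :
    mvfderiv (𝓡 n) f (e.symm y) (coordVector e y v) = fderiv ℝ (f ∘ e.symm) y v := by
  by_cases h : MDifferentiableAt (𝓡 n) 𝓘(ℝ, ℝ) f (e.symm y)
  · have := mvfderiv_comp_apply y h (mdifferentiableAt_atlas_symm (I := 𝓡 n) he hy) v
    rw [coordVector, ← this, mvfderiv, mfderiv_eq_fderiv]
    rfl
  · have h' := h
    rw [mdifferentiableAt_iff_chart he f hy] at h'
    rw [fderiv_zero_of_not_differentiableAt h', mvfderiv, mfderiv_zero_of_not_mdifferentiableAt h]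
    simp

theorem coordVector_surjective (he : e ∈ atlas (EuclideanSpace ℝ (Fin n)) X)
    {y : EuclideanSpace ℝ (Fin n)} (hy : y ∈ e.target) :
    Function.Surjective (coordVector e y) :=
  (mdifferentiable_of_mem_atlas (I := 𝓡 n) he).symm.mfderiv_surjective hy

variable [RiemannianBundle (fun x : X => TangentSpace (𝓡 n) x)]
  [IsContMDiffRiemannianBundle (𝓡 n) ∞ (EuclideanSpace ℝ (Fin n))
    (fun x : X => TangentSpace (𝓡 n) x)]

theorem contMDiffOn_coordVector (he : e ∈ atlas (EuclideanSpace ℝ (Fin n)) X)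
    (v : EuclideanSpace ℝ (Fin n)) :
    ContMDiffOn (𝓡 n) (𝓡 n).tangent ∞ (fun y => (⟨e.symm y, coordVector e y v⟩ : TangentBundle (𝓡 n) X)) e.target := by
  have h1 : ContMDiffOn (𝓡 n) (𝓡 n) ∞ e.symm e.target :=
    contMDiffOn_symm_of_mem_maximalAtlas (IsManifold.subset_maximalAtlas he)
  have h2 := h1.contMDiffOn_tangentMapWithin (m := ∞) (by simp) e.open_target.uniqueMDiffOn
  have h3 : ContMDiff (𝓡 n) (𝓡 n).tangent ∞
    (fun y => (⟨y, v⟩ : TangentBundle (𝓡 n) (EuclideanSpace ℝ (Fin n)))) := by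
    rw [← contMDiffOn_univ]
    exact contMDiffOn_vectorSpace_iff_contDiffOn.2 contDiffOn_const
  have h4 := h2.comp (h3.contMDiffOn (s := e.target)) (fun y hy => hy)
  refine h4.congr fun y hy => ?_
  simp only [Function.comp, tangentMapWithin, coordVector]
  rw [mfderivWithin_of_isOpen e.open_target hy]

theorem continuousOn_norm_coordVector (he : e ∈ atlas (EuclideanSpace ℝ (Fin n)) X)
    (v : EuclideanSpace ℝ (Fin n)) :
    ContinuousOn (fun y => ‖coordVector e y v‖) e.target := by
  have h := contMDiffOn_coordVector he v
  have h2 : ContMDiffOn (𝓡 n) 𝓘(ℝ, ℝ) ∞ (fun y => inner ℝ (coordVector e y v) (coordVector e y v)) e.target :=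
    h.inner_bundle h
  simp_rw [norm_eq_sqrt_real_inner]
  exact h2.continuousOn.sqrt

theorem grad_norm_le_iff (he : e ∈ atlas (EuclideanSpace ℝ (Fin n)) X) (f : X → ℝ)
    {y : EuclideanSpace ℝ (Fin n)} (hy : y ∈ e.target) {c : ℝ} (hc : 0 ≤ c) :
    ‖grad n f (e.symm y)‖ ≤ c ↔
      ∀ v, |fderiv ℝ (f ∘ e.symm) y v| ≤ c * ‖coordVector e y v‖ := by
  rw [grad, LinearIsometryEquiv.norm_map, ContinuousLinearMap.opNorm_le_iff hc]
  constructor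
  · intro h v
    rw [← mvfderiv_coordVector he f hy]
    exact h _
  · intro h w
    obtain ⟨v, rfl⟩ := coordVector_surjective he hy w
    rw [mvfderiv_coordVector he f hy]
    exact h v

theorem coordVector_continuous (e : OpenPartialHomeomorph X (EuclideanSpace ℝ (Fin n)))
   (y : EuclideanSpace ℝ (Fin n)) :
    Continuous (coordVector e y) :=
  (mfderiv (𝓡 n) (𝓡 n) e.symm y).continuous

theorem measurable_norm_grad [SecondCountableTopology X] [MeasurableSpace X] [BorelSpace X]
    (f : X → ℝ) : Measurable fun x => ‖grad n f x‖ := by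
  refine measurable_of_Iic fun c => ?_
  rcases lt_or_ge c 0 with hc | hc
  · convert MeasurableSet.empty
    ext x
    simpa using hc.trans_le (norm_nonneg _)
  obtain ⟨s, hs, hsc⟩ := countable_cover_nhds (f := fun x : X => (chartAt (EuclideanSpace ℝ (Fin n)) x).source)
    (fun x => chart_source_mem_nhds _ x)
  let E := EuclideanSpace ℝ (Fin n)
  let T : X → Set E := fun x => (chartAt E x).target ∩ ⋂ k : ℕ,
    {y | |fderiv ℝ (f ∘ (chartAt E x).symm) y (denseSeq E k)| ≤
      c * ‖coordVector (chartAt E x) y (denseSeq E k)‖}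
  have hT : ∀ x, MeasurableSet (T x) := by
    intro x
    have ht : MeasurableSet (chartAt E x).target := (chartAt E x).open_target.measurableSet
    rw [show T x = ⋂ k : ℕ, (chartAt E x).target ∩
      {y | |fderiv ℝ (f ∘ (chartAt E x).symm) y (denseSeq E k)| ≤
      c * ‖coordVector (chartAt E x) y (denseSeq E k)‖} from inter_iInter _ _]
    refine MeasurableSet.iInter fun k => ?_
    have h1 : Measurable fun y => |fderiv ℝ (f ∘ (chartAt E x).symm) y (denseSeq E k)| :=
      (measurable_fderiv_apply_const ℝ _ _).abs
    have h2 : Measurable ((chartAt E x).target.domRestrict fun y =>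
        c * ‖coordVector (chartAt E x) y (denseSeq E k)‖) :=
      (continuousOn_iff_continuous_domRestrict.1 ((continuousOn_norm_coordVector
        (chart_mem_atlas E x) (denseSeq E k)).const_smul c)).measurable
    have h3 := measurableSet_le (h1.comp measurable_subtype_coe) h2
    have h4 := ht.subtype_image h3
    convert h4 using 1
    ext y
    simp only [mem_inter_iff, mem_image, Subtype.exists]
    exact ⟨fun h => ⟨y, h.1, h.2, rfl⟩, fun ⟨a, ha, hb, hab⟩ => hab ▸ ⟨ha, hb⟩⟩
  have hiff : ∀ x, ∀ z ∈ (chartAt E x).source, ‖grad n f z‖ ≤ c ↔ chartAt E x z ∈ T x := by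
    intro x z hz
    have hzt := (chartAt E x).map_source hz
    have := grad_norm_le_iff (chart_mem_atlas E x) f hzt hc
    rw [show ‖grad n f z‖ = ‖grad n f ((chartAt E x).symm (chartAt E x z))‖ by
      rw [(chartAt E x).left_inv hz], this]
    refine ⟨fun h => ⟨hzt, mem_iInter.2 fun k => by rw [mem_ofPred_eq]; exact h (denseSeq E k)⟩, fun h v => ?_⟩
    have hcl : IsClosed {v : E | |fderiv ℝ (f ∘ (chartAt E x).symm) (chartAt E x z) v| ≤
        c * ‖coordVector (chartAt E x) (chartAt E x z) v‖} :=
      isClosed_le (by fun_prop)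
        (continuous_const.mul (coordVector_continuous _ _).norm)
    have hv : v ∈ closure (Set.range (denseSeq E)) := denseRange_denseSeq E v
    have hsub : Set.range (denseSeq E) ⊆ {v : E |
        |fderiv ℝ (f ∘ (chartAt E x).symm) (chartAt E x z) v| ≤
        c * ‖coordVector (chartAt E x) (chartAt E x z) v‖} := by
      rintro _ ⟨k, rfl⟩
      have h'' := mem_iInter.1 h.2 k
      rwa [mem_ofPred_eq] at h'' ⊢
    have h' := hcl.closure_subset_iff.2 hsub hv
    rwa [mem_ofPred_eq] at h'
  have : ((fun x => ‖grad n f x‖) ⁻¹' Iic c) = ⋃ x ∈ s, ((chartAt E x).source ∩ chartAt E x ⁻¹' T x) := by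
    ext z
    simp only [mem_preimage, mem_Iic, mem_iUnion, mem_inter_iff]
    constructor
    · intro h
      have hz : z ∈ ⋃ x ∈ s, (chartAt E x).source := hsc ▸ mem_univ z
      simp only [mem_iUnion] at hz
      obtain ⟨x, hx, hz⟩ := hz
      exact ⟨x, hx, hz, (hiff x z hz).1 h⟩
    · rintro ⟨x, hx, hz, h⟩
      exact (hiff x z hz).2 h
  rw [this]
  refine MeasurableSet.biUnion hs fun x _ => ?_
  exact measurableSet_source_inter_preimage (chartAt E x) (hT x)
end top

section metric
variable [PseudoEMetricSpace X] [ChartedSpace (EuclideanSpace ℝ (Fin n)) X]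
  [IsManifold (𝓡 n) ∞ X] {e : OpenPartialHomeomorph X (EuclideanSpace ℝ (Fin n))}
  [RiemannianBundle (fun x : X => TangentSpace (𝓡 n) x)]
  [IsContMDiffRiemannianBundle (𝓡 n) ∞ (EuclideanSpace ℝ (Fin n))
    (fun x : X => TangentSpace (𝓡 n) x)]
  [IsRiemannianManifold (𝓡 n) X]

theorem edist_symm_le (he : e ∈ atlas (EuclideanSpace ℝ (Fin n)) X)
    {a b : EuclideanSpace ℝ (Fin n)} {c : ℝ≥0∞} (hseg : segment ℝ a b ⊆ e.target)
    (hc : ∀ z ∈ segment ℝ a b, ‖coordVector e z (b - a)‖ₑ ≤ c) :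
    edist (e.symm a) (e.symm b) ≤ c := by
  let η : ℝ →ᴬ[ℝ] EuclideanSpace ℝ (Fin n) := ContinuousAffineMap.lineMap a b
  have hη : MapsTo η (Icc (0:ℝ) 1) (segment ℝ a b) := by
    intro t ht
    rw [segment_eq_image_lineMap]
    exact ⟨t, ht, rfl⟩
  have h1 : ContMDiffOn (𝓡 n) (𝓡 n) 1 e.symm e.target :=
    contMDiffOn_symm_of_mem_maximalAtlas (IsManifold.subset_maximalAtlas he)
  have h2 : ContMDiff 𝓘(ℝ, ℝ) (𝓡 n) 1 η := by
    rw [contMDiff_iff_contDiff]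
    exact η.contDiff
  rw [IsRiemannianManifold.out (I := 𝓡 n) (e.symm a) (e.symm b)]
  refine (Manifold.riemannianEDist_le_pathELength (γ := e.symm ∘ η) (a := 0) (b := 1)
    (h1.comp h2.contMDiffOn (fun t ht => hseg (hη ht))) (by simp [η, ContinuousAffineMap.coe_lineMap_eq]) (by simp [η, ContinuousAffineMap.coe_lineMap_eq])  zero_le_one).trans ?_
  rw [Manifold.pathELength_eq_lintegral_mfderiv_Icc]
  have h3 : ∀ t ∈ Icc (0:ℝ) 1, ‖mfderiv 𝓘(ℝ, ℝ) (𝓡 n) (e.symm ∘ η) t 1‖ₑ ≤ c := by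
    intro t ht
    have h4 : mfderiv 𝓘(ℝ, ℝ) (𝓡 n) (e.symm ∘ η) t 1 = coordVector e (η t) (b - a) := by
      rw [mfderiv_comp_apply t (mdifferentiableAt_atlas_symm he (hseg (hη ht))) (h2.mdifferentiable one_ne_zero t), mfderiv_eq_fderiv, coordVector]
      congr 1
      change fderiv ℝ η t 1 = b - a
      simp [η]
    rw [h4]
    exact hc _ (hη ht)
  refine (setLIntegral_mono' measurableSet_Icc h3).trans ?_
  simp

theorem lipschitzOn_chart (he : e ∈ atlas (EuclideanSpace ℝ (Fin n)) X) {f : X → ℝ} {K : ℝ≥0}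
    (hf : LipschitzWith K f) {y : EuclideanSpace ℝ (Fin n)} (hy : y ∈ e.target) :
    ∃ C : ℝ≥0, ∃ r > 0, LipschitzOnWith C (f ∘ e.symm) (Metric.ball y r) := by
  have h1 : ∀ᶠ z in 𝓝 y, z ∈ e.target ∧ ∀ i : Fin n, ‖coordVector e z (EuclideanSpace.single i 1)‖ <
      ‖coordVector e y (EuclideanSpace.single i 1)‖ + 1 := by
    refine (e.open_target.eventually_mem hy).and (eventually_all.2 fun i => ?_)
    exact ((continuousOn_norm_coordVector he _).continuousAt
      (e.open_target.mem_nhds hy)).eventually_lt_const (lt_add_one _)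
  obtain ⟨r, hr, hball⟩ := Metric.eventually_nhds_iff_ball.1 h1
  let C : ℝ≥0 := ∑ i : Fin n, (‖coordVector e y (EuclideanSpace.single i 1)‖₊ + 1)
  refine ⟨K * C, r, hr, fun a ha b hb => ?_⟩
  refine (hf _ _).trans ?_
  rw [ENNReal.coe_mul, mul_assoc]
  gcongr
  have hseg := (convex_ball y r).segment_subset ha hb
  refine edist_symm_le he (fun z hz => (hball z (hseg hz)).1) fun z hz => ?_
  have h2 := (hball z (hseg hz)).2
  have h3 : ‖coordVector e z (b - a)‖ ≤ C * ‖b - a‖ := by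
    have h4 : coordVector e z (b - a) =
        ∑ i, (b - a) i • coordVector e z (EuclideanSpace.single i 1) := by
      have h5 : b - a = ∑ i, (b - a) i • EuclideanSpace.single i (1:ℝ) := by
        have := (EuclideanSpace.basisFun (Fin n) ℝ).sum_repr (b - a)
        simpa using this.symm
      conv_lhs => rw [h5]
      let L : EuclideanSpace ℝ (Fin n) →ₗ[ℝ] TangentSpace (𝓡 n) (e.symm z) :=
        (mfderiv (𝓡 n) (𝓡 n) e.symm z).toLinearMap
      change L _ = ∑ i, (b - a) i • L _
      simp only [map_sum, map_smul]
    rw [h4]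
    refine (norm_sum_le _ _).trans ?_
    simp only [C, NNReal.coe_sum, Finset.sum_mul]
    refine Finset.sum_le_sum fun i _ => ?_
    rw [norm_smul, mul_comm]
    gcongr
    · exact (h2 i).le
    · exact PiLp.norm_apply_le _ i
  rw [edist_comm, edist_eq_enorm_sub, ← ofReal_norm, ← ofReal_norm]
  rw [← ENNReal.ofReal_coe_nnreal, ← ENNReal.ofReal_mul C.coe_nonneg]
  exact ENNReal.ofReal_le_ofReal h3

theorem ae_differentiableAt_chart (he : e ∈ atlas (EuclideanSpace ℝ (Fin n)) X) {f : X → ℝ} {K : ℝ≥0}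
    (hf : LipschitzWith K f) :
    volume {y | y ∈ e.target ∧ ¬ DifferentiableAt ℝ (f ∘ e.symm) y} = 0 := by
  refine measure_null_of_locally_null _ fun y hy => ?_
  obtain ⟨C, r, hr, hL⟩ := lipschitzOn_chart he hf hy.1
  refine ⟨_, inter_mem_nhdsWithin _ (Metric.ball_mem_nhds y hr), ?_⟩
  have := hL.ae_differentiableWithinAt_of_mem (μ := volume)
  rw [ae_iff] at this
  refine measure_mono_null ?_ this
  rintro z ⟨hz1, hz2⟩
  simp only [Classical.not_imp, mem_ofPred_eq]
  exact ⟨hz2, fun h => hz1.2 (h.differentiableAt (Metric.isOpen_ball.mem_nhds hz2))⟩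

theorem norm_grad_le {f : X → ℝ} {K : ℝ≥0} (hf : LipschitzWith K f) (x : X) :
    ‖grad n f x‖ ≤ K := by
  let e := chartAt (EuclideanSpace ℝ (Fin n)) x
  have he : e ∈ atlas (EuclideanSpace ℝ (Fin n)) X := chart_mem_atlas _ x
  have hy : e x ∈ e.target := e.map_source (mem_chart_source _ x)
  have hx : e.symm (e x) = x := e.left_inv (mem_chart_source _ x)
  have hmain := grad_norm_le_iff he f hy K.coe_nonneg
  rw [show ‖grad n f x‖ = ‖grad n f (e.symm (e x))‖ by rw [hx]]
  refine hmain.2 fun v => ?_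
  by_cases hd : DifferentiableAt ℝ (f ∘ e.symm) (e x)
  swap
  · rw [fderiv_zero_of_not_differentiableAt hd]
    simp only [zero_apply, abs_zero]
    exact mul_nonneg K.coe_nonneg (norm_nonneg _)
  have hder : HasDerivAt (fun t : ℝ => (f ∘ e.symm) (e x + t • v))
      (fderiv ℝ (f ∘ e.symm) (e x) v) 0 := hd.hasFDerivAt.hasLineDerivAt v
  have key : ∀ ε > 0, |fderiv ℝ (f ∘ e.symm) (e x) v| ≤ K * (‖coordVector e (e x) v‖ + ε) := by
    intro ε hε
    refine hder.le_of_lip' (by positivity) ?_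
    have h1 : ∀ᶠ z in 𝓝 (e x), z ∈ e.target ∧
        ‖coordVector e z v‖ < ‖coordVector e (e x) v‖ + ε :=
      (e.open_target.eventually_mem hy).and (((continuousOn_norm_coordVector he _).continuousAt
      (e.open_target.mem_nhds hy)).eventually_lt_const (lt_add_of_pos_right _ hε))
    obtain ⟨r, hr, hball⟩ := Metric.eventually_nhds_iff_ball.1 h1
    have h2 : ∀ᶠ t : ℝ in 𝓝 0, e x + t • v ∈ Metric.ball (e x) r := by
      have : Tendsto (fun t : ℝ => e x + t • v) (𝓝 0) (𝓝 (e x)) := by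
        have : Continuous (fun t : ℝ => e x + t • v) := by fun_prop
        simpa using this.tendsto 0
      exact this.eventually_mem (Metric.ball_mem_nhds _ hr)
    filter_upwards [h2] with t ht
    have hseg := (convex_ball (e x) r).segment_subset (Metric.mem_ball_self hr) ht
    have h3 : edist (e.symm (e x)) (e.symm (e x + t • v)) ≤
        ENNReal.ofReal ((‖coordVector e (e x) v‖ + ε) * |t|) := by
      refine edist_symm_le he (fun z hz => (hball z (hseg hz)).1) fun z hz => ?_
      have h4 := (hball z (hseg hz)).2
      have h5 : coordVector e z (e x + t • v - e x) = t • coordVector e z v := by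
        rw [add_sub_cancel_left]
        exact map_smul (mfderiv (𝓡 n) (𝓡 n) e.symm z) t v
      rw [h5, ← ofReal_norm, norm_smul, mul_comm, Real.norm_eq_abs]
      gcongr
    have h6 := (hf (e.symm (e x)) (e.symm (e x + t • v))).trans (mul_le_mul_right h3 _)
    rw [edist_comm, edist_eq_enorm_sub, ← ofReal_norm, ← ENNReal.ofReal_coe_nnreal,
      ← ENNReal.ofReal_mul K.coe_nonneg, ENNReal.ofReal_le_ofReal_iff (by positivity)] at h6
    simp only [zero_smul, add_zero, sub_zero, Function.comp]
    rw [Real.norm_eq_abs t, mul_assoc]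
    exact h6
  refine le_of_forall_pos_le_add fun δ hδ => ?_
  refine (key (δ / (K + 1)) (by positivity)).trans ?_
  have h7 : (K:ℝ) * (δ / (K + 1)) ≤ δ := by
    have hK : (0:ℝ) ≤ K := K.coe_nonneg
    rw [mul_div_assoc', div_le_iff₀ (by positivity)]
    nlinarith
  rw [mul_add]
  exact add_le_add le_rfl h7
end metric
end Lemmas

section Measure
variable {n : ℕ} {X : Type*} [TopologicalSpace X] [ChartedSpace (EuclideanSpace ℝ (Fin n)) X]
  [RiemannianBundle (fun x : X => TangentSpace (𝓡 n) x)] [MeasurableSpace X]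

variable (n) in
/-- `V` is the Riemannian volume measure `dV_g`: it is `√(det g_ij) dy` in every chart. -/
def IsRiemannianVolume (V : Measure X) : Prop :=
  ∀ e ∈ atlas (EuclideanSpace ℝ (Fin n)) X, ∀ s ⊆ e.source, MeasurableSet s →
    V s = ∫⁻ y in e '' s, ENNReal.ofReal (√(chartGram e y).det)

theorem IsRiemannianVolume.null {V : Measure X} (hV : IsRiemannianVolume n V)
    [SecondCountableTopology X] {s : Set X}
    (h : ∀ e ∈ atlas (EuclideanSpace ℝ (Fin n)) X, MeasurableSet (s ∩ e.source) ∧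
      volume (e '' (s ∩ e.source)) = 0) : V s = 0 := by
  refine measure_null_of_locally_null s fun x hx => ?_
  let e := chartAt (EuclideanSpace ℝ (Fin n)) x
  refine ⟨s ∩ e.source, inter_mem_nhdsWithin _ (chart_source_mem_nhds _ x), ?_⟩
  rw [hV e (chart_mem_atlas _ x) _ inter_subset_right (h e (chart_mem_atlas _ x)).1]
  exact setLIntegral_measure_zero _ _ (h e (chart_mem_atlas _ x)).2
end Measure

section MMSpace
variable (n : ℕ) {M : Type*} [MetricSpace M] [MeasurableSpace M]
  (Ω : Opens M) [ChartedSpace (EuclideanSpace ℝ (Fin n)) Ω]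
  [RiemannianBundle (fun x : Ω => TangentSpace (𝓡 n) x)] (μ : Measure M)

/-- `dμ = h² dV_g` with `h` positive and continuous on `M` and smooth on `Ω`. In particular
`μ (M \ Ω) = 0`. -/
class IsWeightedRiemannianMeasure : Prop where
  exists_density : ∃ (V : Measure Ω) (h : M → ℝ), IsRiemannianVolume n V ∧
    Continuous h ∧ (∀ x, 0 < h x) ∧ ContMDiff (𝓡 n) 𝓘(ℝ, ℝ) ∞ (fun x : Ω => h x) ∧
    μ = (V.withDensity fun x : Ω => ENNReal.ofReal (h x ^ 2)).map Subtype.val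

/-- The gradient on `Ω` of (the restriction to `Ω` of) a function on `M`. -/
def regGrad (f : M → ℝ) (x : Ω) : TangentSpace (𝓡 n) x := grad n (fun y : Ω => f y) x

/-- The form `∫_Ω ⟨∇f, ∇g⟩ dμ`. -/
def dirichletForm (f g : M → ℝ) : ℝ :=
  ∫ x : Ω, inner ℝ (regGrad n Ω f x) (regGrad n Ω g x) ∂(μ.comap Subtype.val)

variable (M) in
/-- `Lip(M)`. -/
def lipschitzFunctions : Submodule ℝ (M → ℝ) where
  carrier := {f | ∃ K : ℝ≥0, LipschitzWith K f}
  add_mem' := fun ⟨K, hf⟩ ⟨L, hg⟩ => ⟨K + L, hf.add hg⟩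
  zero_mem' := ⟨0, LipschitzWith.const 0⟩
  smul_mem' := fun c _ ⟨_, hf⟩ => ⟨_, (lipschitzWith_smul c).comp hf⟩

section core
variable {n Ω μ}
variable [BorelSpace M] [CompactSpace M] [IsManifold (𝓡 n) ∞ Ω]
  [IsContMDiffRiemannianBundle (𝓡 n) ∞ (EuclideanSpace ℝ (Fin n))
    (fun x : Ω => TangentSpace (𝓡 n) x)] [IsRiemannianManifold (𝓡 n) Ω]


theorem ae_mdifferentiable [IsWeightedRiemannianMeasure n Ω μ] {f : M → ℝ}
    (hf : f ∈ lipschitzFunctions M) :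
    ∀ᵐ x : Ω ∂(μ.comap Subtype.val),
      MDifferentiableAt (𝓡 n) 𝓘(ℝ, ℝ) (fun y : Ω => f y) x := by
  obtain ⟨K, hf⟩ := hf
  have hfΩ : LipschitzWith K (fun y : Ω => f y) := fun x y => hf x y
  obtain ⟨V, h, hV, -, -, -, hμ⟩ := IsWeightedRiemannianMeasure.exists_density (n := n) (Ω := Ω) (μ := μ)
  have hemb : MeasurableEmbedding (Subtype.val : Ω → M) :=
    MeasurableEmbedding.subtype_coe Ω.isOpen.measurableSet
  rw [hμ, hemb.comap_map]
  suffices hae : ∀ᵐ x : Ω ∂V, MDifferentiableAt (𝓡 n) 𝓘(ℝ, ℝ) (fun y : Ω => f y) x from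
    (withDensity_absolutelyContinuous V _).ae_le hae
  rw [ae_iff]
  refine hV.null fun e he => ?_
  have hset : {x : Ω | ¬ MDifferentiableAt (𝓡 n) 𝓘(ℝ, ℝ) (fun y : Ω => f y) x} ∩ e.source =
      e.source ∩ e ⁻¹' {y | ¬ DifferentiableAt ℝ ((fun y : Ω => f y) ∘ e.symm) y} := by
    ext x
    simp only [mem_inter_iff, mem_preimage, mem_ofPred_eq, and_comm (b := x ∈ e.source)]
    refine and_congr_right fun hx => ?_
    rw [← mdifferentiableAt_iff_chart he _ (e.map_source hx), e.left_inv hx]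
  rw [hset]
  refine ⟨measurableSet_source_inter_preimage e
    (measurableSet_of_differentiableAt ℝ _).compl, ?_⟩
  refine measure_mono_null ?_ (ae_differentiableAt_chart he hfΩ)
  rintro _ ⟨x, ⟨hx, hx'⟩, rfl⟩
  exact ⟨e.map_source hx, hx'⟩

theorem measurable_norm_regGrad (f : M → ℝ) : Measurable fun x : Ω => ‖regGrad n Ω f x‖ :=
  measurable_norm_grad _

theorem norm_regGrad_le {f : M → ℝ} {K : ℝ≥0} (hf : LipschitzWith K f) (x : Ω) :
    ‖regGrad n Ω f x‖ ≤ K := by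
  refine norm_grad_le (fun x y => ?_) x
  exact hf x y

theorem regGrad_add {f g : M → ℝ} {x : Ω}
    (hf : MDifferentiableAt (𝓡 n) 𝓘(ℝ, ℝ) (fun y : Ω => f y) x)
    (hg : MDifferentiableAt (𝓡 n) 𝓘(ℝ, ℝ) (fun y : Ω => g y) x) :
    regGrad n Ω (f + g) x = regGrad n Ω f x + regGrad n Ω g x := by
  have := mvfderiv_add hf hg
  simp only [regGrad, grad, ← map_add, ← this]
  rfl

theorem regGrad_smul {f : M → ℝ} {x : Ω} (c : ℝ)
    (hf : MDifferentiableAt (𝓡 n) 𝓘(ℝ, ℝ) (fun y : Ω => f y) x) :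
    regGrad n Ω (c • f) x = c • regGrad n Ω f x := by
  have h1 : mvfderiv (𝓡 n) (fun y : Ω => (c • f) y) x =
      c • mvfderiv (𝓡 n) (fun y : Ω => f y) x := by
    have h2 := mvfderiv_fun_smul (a := fun _ : Ω => c) (mdifferentiableAt_const) hf
    simp only [mvfderiv_const] at h2
    simp only [Pi.smul_apply]
    rw [h2]
    ext v
    simp
  simp only [regGrad, grad, h1]
  simp

theorem integrable_inner_regGrad [IsFiniteMeasure μ] [IsWeightedRiemannianMeasure n Ω μ]
    {f g : M → ℝ} (hf : f ∈ lipschitzFunctions M) (hg : g ∈ lipschitzFunctions M) :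
    Integrable (fun x : Ω => inner ℝ (regGrad n Ω f x) (regGrad n Ω g x))
      (μ.comap Subtype.val) := by
  have hmeas : AEStronglyMeasurable
      (fun x : Ω => inner ℝ (regGrad n Ω f x) (regGrad n Ω g x)) (μ.comap Subtype.val) := by
    have h1 : Measurable fun x : Ω => (‖regGrad n Ω (f + g) x‖ ^ 2 - ‖regGrad n Ω f x‖ ^ 2 -
        ‖regGrad n Ω g x‖ ^ 2) / 2 :=
      ((((measurable_norm_regGrad _).pow_const 2).sub
        ((measurable_norm_regGrad _).pow_const 2)).sub
        ((measurable_norm_regGrad _).pow_const 2)).div_const 2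
    refine h1.aestronglyMeasurable.congr ?_
    filter_upwards [ae_mdifferentiable (n := n) (Ω := Ω) hf,
      ae_mdifferentiable (n := n) (Ω := Ω) hg] with x hx hx'
    rw [regGrad_add hx hx', norm_add_sq_real]
    ring
  have : IsFiniteMeasure (μ.comap (Subtype.val : Ω → M)) := by
    refine ⟨?_⟩
    have hemb : MeasurableEmbedding (Subtype.val : Ω → M) :=
      MeasurableEmbedding.subtype_coe Ω.isOpen.measurableSet
    rw [hemb.comap_apply]
    exact measure_lt_top _ _
  obtain ⟨K, hf⟩ := hf
  obtain ⟨L, hg⟩ := hg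
  refine Integrable.of_bound hmeas (K * L) (Eventually.of_forall fun x => ?_)
  exact (norm_inner_le_norm _ _).trans (mul_le_mul (norm_regGrad_le hf x) (norm_regGrad_le hg x)
    (norm_nonneg _) K.coe_nonneg)

theorem integrable_mul [IsFiniteMeasure μ] {f g : M → ℝ}
    (hf : f ∈ lipschitzFunctions M) (hg : g ∈ lipschitzFunctions M) :
    Integrable (fun x => f x * g x) μ := by
  obtain ⟨K, hf⟩ := hf
  obtain ⟨L, hg⟩ := hg
  exact ((hf.continuous.mul hg.continuous).continuousOn.integrableOn_compact isCompact_univ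
    (μ := μ)).integrable_of_forall_notMem_eq_zero (by simp)

end core

/-- A copy of `Lip(M)`, to carry the inner product `∫ f g dμ + ∫ ⟨∇f, ∇g⟩ dμ`. -/
def LipschitzSobolev (_n : ℕ) {M : Type*} [MetricSpace M] [MeasurableSpace M]
  (_Ω : Opens M) (_μ : Measure M) : Type _ := lipschitzFunctions M

instance : AddCommGroup (LipschitzSobolev n Ω μ) := inferInstanceAs (AddCommGroup (lipschitzFunctions M))
instance : Module ℝ (LipschitzSobolev n Ω μ) := inferInstanceAs (Module ℝ (lipschitzFunctions M))
instance : CoeFun (LipschitzSobolev n Ω μ) (fun _ => M → ℝ) := ⟨fun f => f.1⟩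

variable [BorelSpace M] [CompactSpace M] [IsManifold (𝓡 n) ∞ Ω]
  [IsContMDiffRiemannianBundle (𝓡 n) ∞ (EuclideanSpace ℝ (Fin n))
    (fun x : Ω => TangentSpace (𝓡 n) x)] [IsRiemannianManifold (𝓡 n) Ω]
  [IsFiniteMeasure μ] [IsWeightedRiemannianMeasure n Ω μ]

/-- The inner product of `W^{1,2}` on `Lip(M)`. -/
@[reducible] def sobolevCore : PreInnerProductSpace.Core ℝ (LipschitzSobolev n Ω μ) where
  inner f g := ∫ x, f x * g x ∂μ + dirichletForm n Ω μ f g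
  conj_inner_symm f g := by
    simp only [dirichletForm, conj_trivial, real_inner_comm, mul_comm]
  re_inner_nonneg f := by
    refine add_nonneg (integral_nonneg fun x => mul_self_nonneg _)
      (integral_nonneg fun x => real_inner_self_nonneg)
  add_left f g h := by
    have h1 : ∫ x, (f + g) x * h x ∂μ = ∫ x, f x * h x ∂μ + ∫ x, g x * h x ∂μ := by
      rw [← integral_add (integrable_mul f.2 h.2) (integrable_mul g.2 h.2)]
      exact integral_congr_ae (Eventually.of_forall fun x => add_mul _ _ _)
    have h2 : dirichletForm n Ω μ (f + g) h =
        dirichletForm n Ω μ f h + dirichletForm n Ω μ g h := by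
      simp only [dirichletForm]
      rw [← integral_add (integrable_inner_regGrad f.2 h.2) (integrable_inner_regGrad g.2 h.2)]
      refine integral_congr_ae ?_
      filter_upwards [ae_mdifferentiable (n := n) (Ω := Ω) f.2,
        ae_mdifferentiable (n := n) (Ω := Ω) g.2] with x hx hx'
      rw [regGrad_add hx hx', inner_add_left]
    change ∫ x, (f + g) x * h x ∂μ + dirichletForm n Ω μ (f + g) h = _
    rw [h1, h2]
    ring
  smul_left f g c := by
    have h1 : ∫ x, (c • f) x * g x ∂μ = c * ∫ x, f x * g x ∂μ := by
      rw [← integral_const_mul]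
      exact integral_congr_ae (Eventually.of_forall fun x => mul_assoc _ _ _)
    have h2 : dirichletForm n Ω μ (c • f) g = c * dirichletForm n Ω μ f g := by
      simp only [dirichletForm]
      rw [← integral_const_mul]
      refine integral_congr_ae ?_
      filter_upwards [ae_mdifferentiable (n := n) (Ω := Ω) f.2] with x hx
      rw [regGrad_smul c hx, real_inner_smul_left]
    change ∫ x, (c • f) x * g x ∂μ + dirichletForm n Ω μ (c • f) g = _
    rw [h1, h2, conj_trivial]
    ring

instance : SeminormedAddCommGroup (LipschitzSobolev n Ω μ) :=
  InnerProductSpace.Core.toSeminormedAddCommGroup (c := sobolevCore n Ω μ)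

instance : InnerProductSpace ℝ (LipschitzSobolev n Ω μ) :=
  InnerProductSpace.ofCore (sobolevCore n Ω μ)

/-- `W^{1,2}(M; dμ)`: the completion of `Lip(M)` with respect to the norm
`(∫ |df|² dμ + ∫ |f|² dμ)^{1/2}`. -/
abbrev SobolevSpace : Type _ := UniformSpace.Completion (LipschitzSobolev n Ω μ)

/-- `W^{1,2}(M; dμ)` embeds compactly into `L^q(M; dμ)`: the inclusion of `Lip(M)` into `L^q` extends
to an injective compact linear operator. -/
def CompactlyEmbeds (q : ℝ≥0∞) : Prop :=
  ∃ _ : Fact (1 ≤ q), ∃ ι : SobolevSpace n Ω μ →L[ℝ] Lp ℝ q μ,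
    (∀ f : LipschitzSobolev n Ω μ, (ι (f : SobolevSpace n Ω μ) : M → ℝ) =ᵐ[μ] f) ∧
    Function.Injective ι ∧ IsCompactOperator ι

/-- The Sobolev inequality `‖f‖²_{2n/(n-2)} ≤ A ∫ |df|² dμ + B ∫ |f|² dμ`. -/
def SobolevInequality : Prop :=
  ∃ A B : ℝ, 0 < A ∧ 0 < B ∧ ∀ f : LipschitzSobolev n Ω μ,
    eLpNorm f (ENNReal.ofReal (2 * n / (n - 2))) μ ^ 2 ≤
      ENNReal.ofReal (A * dirichletForm n Ω μ f f + B * ∫ x, f x ^ 2 ∂μ)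

/-- Ahlfors `n`-regularity: `C⁻¹ rⁿ ≤ ν(B(p,r)) ≤ C rⁿ` for all `p` and `0 < r ≤ diam M`. -/
def IsAhlforsRegular (n : ℕ) {M : Type*} [MetricSpace M] [MeasurableSpace M]
    (ν : Measure M) : Prop :=
  ∃ C : ℝ, 0 < C ∧ ∀ (p : M) (r : ℝ), 0 < r → r ≤ Metric.diam (univ : Set M) →
    ENNReal.ofReal (C⁻¹ * r ^ n) ≤ ν (Metric.ball p r) ∧
    ν (Metric.ball p r) ≤ ENNReal.ofReal (C * r ^ n)

/-- `φ ∈ C^k_0(Ω)`, extended by zero to `M`. Closed subsets of `M` are compact when `M` is. -/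
def IsTestFunction (n : ℕ) {M : Type*} [MetricSpace M] (Ω : Opens M)
    [ChartedSpace (EuclideanSpace ℝ (Fin n)) Ω] (k : WithTop ℕ∞) (φ : M → ℝ) : Prop :=
  ContMDiff (𝓡 n) 𝓘(ℝ, ℝ) k (fun x : Ω => φ x) ∧ tsupport φ ⊆ (Ω : Set M)

/-- The standing hypotheses on `(M, g, μ)` besides the Sobolev inequality: `Ω` is dense,
`C^1_0(Ω)` is dense in `W^{1,2}(M; dμ)`, the `n`-dimensional Hausdorff measure is absolutely
continuous with respect to `μ`, and both are Ahlfors `n`-regular. -/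
structure IsAlmostSmooth : Prop where
  dense_regular : Dense (Ω : Set M)
  dense_test : Dense {w : SobolevSpace n Ω μ |
    ∃ f : LipschitzSobolev n Ω μ, IsTestFunction n Ω 1 f ∧ w = (f : SobolevSpace n Ω μ)}
  hausdorff_absolutelyContinuous : Measure.hausdorffMeasure (n : ℝ) ≪ μ
  hausdorff_regular : IsAhlforsRegular n (Measure.hausdorffMeasure (n : ℝ) : Measure M)
  measure_regular : IsAhlforsRegular n μ

end MMSpace

section Friedrichs
variable (n : ℕ) {M : Type*} [MetricSpace M] [MeasurableSpace M]
  (Ω : Opens M) [ChartedSpace (EuclideanSpace ℝ (Fin n)) Ω]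
  [RiemannianBundle (fun x : Ω => TangentSpace (𝓡 n) x)] (μ : Measure M)

/-- The graph in `L² × L²` of the Friedrichs extension of the form `∫ ⟨∇f, ∇g⟩ dμ` on
`C^∞_0(Ω)`: the pairs `(w, v)` such that `w` lies in the domain of the closure of the form, that
is `w = lim u_k` in `L²` for a sequence `u_k` in `C^∞_0(Ω)` which is Cauchy for the form, and
the closed form satisfies `lim_k ∫ ⟨∇u_k, ∇φ⟩ dμ = ∫ v φ dμ` for all `φ` in the core. -/
def friedrichsGraph : Set (Lp ℝ 2 μ × Lp ℝ 2 μ) :=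
  {p | ∃ u : ℕ → M → ℝ, (∀ k, IsTestFunction n Ω ∞ (u k)) ∧
    Tendsto (fun k => eLpNorm (fun x => u k x - p.1 x) 2 μ) atTop (𝓝 0) ∧
    Tendsto (fun k : ℕ × ℕ => dirichletForm n Ω μ (u k.1 - u k.2) (u k.1 - u k.2))
      atTop (𝓝 0) ∧
    ∀ φ : M → ℝ, IsTestFunction n Ω ∞ φ →
      Tendsto (fun k => dirichletForm n Ω μ (u k) φ) atTop (𝓝 (∫ x, p.2 x * φ x ∂μ))}

/-- `T` is the operator `-Δ`: the Friedrichs extension of the form `∫ ⟨∇f, ∇g⟩ dμ` on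
`C^∞_0(Ω)`. -/
def IsFriedrichsLaplacian (T : Lp ℝ 2 μ →ₗ.[ℝ] Lp ℝ 2 μ) : Prop :=
  (T.graph : Set (Lp ℝ 2 μ × Lp ℝ 2 μ)) = friedrichsGraph n Ω μ
end Friedrichs

section Spectrum
variable {H : Type*} [NormedAddCommGroup H] [NormedSpace ℝ H]

/-- The spectrum of an unbounded operator: `c` is not in it if and only if `T - c` is a bijection
from the domain onto `H` with a bounded inverse `R`. -/
def unboundedSpectrum (T : H →ₗ.[ℝ] H) : Set ℝ :=
  {c | ¬ ∃ R : H →L[ℝ] H, (∀ v, ∃ hv : R v ∈ T.domain, T ⟨R v, hv⟩ - c • R v = v) ∧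
    ∀ u : T.domain, R (T u - c • (u : H)) = u}

/-- The eigenspace `{u ∈ D(T) | T u = c u}`. -/
def unboundedEigenspace (T : H →ₗ.[ℝ] H) (c : ℝ) : Submodule ℝ T.domain :=
  LinearMap.ker (T.toFun - c • T.domain.subtype)

/-- The spectrum is discrete: it consists of isolated eigenvalues of finite multiplicity. -/
def HasDiscreteSpectrum (T : H →ₗ.[ℝ] H) : Prop :=
  ∀ c ∈ unboundedSpectrum T,
    (∃ ε > 0, ∀ b ∈ unboundedSpectrum T, |b - c| < ε → b = c) ∧
    unboundedEigenspace T c ≠ ⊥ ∧ FiniteDimensional ℝ (unboundedEigenspace T c)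
end Spectrum

end AlmostSmooth

end

/-! Compactness. For `p > n` the exponent `q = 2p/(p-2)` satisfies `2 < q < 2n/(n-2)`. Hölder's
inequality therefore bounds the `L^q` norm by positive powers of the `L²` norm and of the critical
norm, and the Sobolev inequality controls the latter (`tendsto_eLpNorm_of_interpolation`). It
remains to treat `L²`. By Hölder and Sobolev again, a bounded set of `W^{1,2}` has uniformly small
`L²` mass off a compact `K ⊆ Ω` whose complement has small measure
(`exists_isCompact_lintegral_compl_le`). On `K` finitely many charts reduce the question to
Rellich's theorem in Euclidean balls. That theorem is used in the form: the `L²` norm is at most a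
small multiple of the gradient norm plus finitely many averages (`exists_lintegral_sq_le_add_sum`).

Weak compactness is replaced by ultrafilters. Along an ultrafilter on the unit ball every bounded
linear functional converges, so the differences of two members have integrals tending to zero
against every measure dominated by a multiple of `μ`. By the estimates above they then tend to zero
in `L²` and in `L^q`. Since `C^1_0(Ω)` is dense, only `C^1` functions have to be examined, and weak
derivatives never appear.

Injectivity is closability of the Dirichlet form. If test functions `f_k` are Cauchy in `W^{1,2}`
and tend to zero in `L²`, integration by parts in charts shows that their gradients tend to zero in
`L²` on compact subsets of `Ω`. Off the support of a fixed `f_N` the gradient of `f_k` is that of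
`f_k - f_N`, which is small (`injective_sobolevEmbedding`).

Spectrum. Let `V` be the closure of `C^∞_0(Ω)` in `W^{1,2}` and `j : V → L²` the restricted
embedding. The `W^{1,2}` product is the `L²` product plus the form, so by Riesz representation `R =
j j*` is `(1 - Δ)⁻¹` and the Friedrichs extension is `R⁻¹ - 1` (`mem_friedrichsGraph_iff`). The
operator `R` is symmetric, injective because `j` has dense range, and compact because `j` is.
Self-adjointness and discreteness of the spectrum follow for `R⁻¹ - 1` in any Hilbert space. -/

namespace AlmostSmooth

/-! ### Unbounded operators with compact resolvent -/

section ShiftedInverse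
variable {H : Type*} [NormedAddCommGroup H] [InnerProductSpace ℝ H]

/-- The graph of `R⁻¹ - 1`, for a bounded operator `R`. -/
def shiftedInverseGraph (R : H →L[ℝ] H) : Submodule ℝ (H × H) :=
  LinearMap.range ((R : H →ₗ[ℝ] H).prod (LinearMap.id - (R : H →ₗ[ℝ] H)))

/-- The entries of `(R w, w - R w)` add up to `w`, so `w` can be eliminated. The resulting relation
is the resolvent equation in which the Friedrichs graph is expressed later. -/
theorem mem_shiftedInverseGraph {R : H →L[ℝ] H} {p : H × H} :
    p ∈ shiftedInverseGraph R ↔ R (p.1 + p.2) = p.1 := by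
  constructor
  · rintro ⟨w, rfl⟩
    simp
  · intro h
    refine ⟨p.1 + p.2, ?_⟩
    ext <;> simp [h]

/-- The operator `R⁻¹ - 1`, for an injective bounded operator `R`. -/
noncomputable def shiftedInverse (R : H →L[ℝ] H) : H →ₗ.[ℝ] H :=
  (shiftedInverseGraph R).toLinearPMap

variable {R : H →L[ℝ] H}

theorem shiftedInverse_graph (hinj : Function.Injective R) :
    (shiftedInverse R).graph = shiftedInverseGraph R := by
  refine Submodule.toLinearPMap_graph_eq _ fun p hp h0 => ?_
  rw [mem_shiftedInverseGraph, h0, zero_add] at hp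
  exact hinj (by simpa using hp)

theorem shiftedInverse_apply_iff (hinj : Function.Injective R) (u : (shiftedInverse R).domain)
    (v : H) : shiftedInverse R u = v ↔ R (u + v) = u := by
  have h : ((u : H), v) ∈ (shiftedInverse R).graph ↔ shiftedInverse R u = v := by
    rw [LinearPMap.mem_graph_iff]
    constructor
    · rintro ⟨y, hy, hv⟩
      exact (congrArg _ (Subtype.ext hy)).symm.trans hv
    · exact fun h => ⟨u, rfl, h⟩
  rw [← h, shiftedInverse_graph hinj, mem_shiftedInverseGraph]

theorem shiftedInverse_eq (hinj : Function.Injective R) (u : (shiftedInverse R).domain) :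
    R (u + shiftedInverse R u) = u :=
  (shiftedInverse_apply_iff hinj u _).1 rfl

theorem apply_mem_shiftedInverse_domain (hinj : Function.Injective R) (w : H) :
    R w ∈ (shiftedInverse R).domain := by
  have : (R w, w - R w) ∈ (shiftedInverse R).graph := by
    rw [shiftedInverse_graph hinj, mem_shiftedInverseGraph]
    simp
  exact LinearPMap.mem_domain_of_mem_graph this

/-- The domain contains the range of `R`, whose orthogonal complement lies in the kernel of the
symmetric injective `R`, so it is dense. A pair `(x, y)` is in the adjoint graph exactly when `⟨w -
R w, x⟩ = ⟨R w, y⟩` for all `w`, and by symmetry this says `R (x + y) = x`. -/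
theorem isSelfAdjoint_shiftedInverse [CompleteSpace H] (hinj : Function.Injective R)
    (hR : (R : H →ₗ[ℝ] H).IsSymmetric) : IsSelfAdjoint (shiftedInverse R) := by
  have hR' : ∀ x y, inner ℝ (R x) y = inner ℝ x (R y) := hR
  have hdense : Dense ((shiftedInverse R).domain : Set H) := by
    rw [Submodule.dense_iff_topologicalClosure_eq_top, Submodule.topologicalClosure_eq_top_iff, Submodule.eq_bot_iff]
    intro x hx
    refine hinj ?_
    rw [map_zero]
    refine ext_inner_left ℝ fun w => ?_
    rw [inner_zero_right, ← hR']
    exact (Submodule.mem_orthogonal _ _).1 hx _ (apply_mem_shiftedInverse_domain hinj w)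
  rw [LinearPMap.isSelfAdjoint_def]
  refine LinearPMap.eq_of_eq_graph ?_
  rw [LinearPMap.adjoint_graph_eq_graph_adjoint hdense, shiftedInverse_graph hinj]
  ext ⟨x, y⟩
  rw [Submodule.mem_adjoint_iff, mem_shiftedInverseGraph]
  constructor
  · intro h
    refine ext_inner_left ℝ fun w => ?_
    have := h (R w) (w - R w) (by rw [mem_shiftedInverseGraph]; simp)
    simp only [inner_sub_left, hR', map_add, inner_add_right] at this ⊢
    linarith
  · intro h a b hab
    rw [mem_shiftedInverseGraph] at hab
    simp only at h hab ⊢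
    have h1 := hR' (a + b) (x + y)
    rw [h, hab] at h1
    simp only [inner_add_left, inner_add_right] at h1
    linarith

theorem mem_eigenspace_of_mem_unboundedEigenspace (hinj : Function.Injective R) {c : ℝ}
    {u : (shiftedInverse R).domain} (hu : u ∈ unboundedEigenspace (shiftedInverse R) c) :
    (1 + c) • R u = u := by
  have h1 : shiftedInverse R u = c • (u : H) := by
    have : (shiftedInverse R) u - c • (u : H) = 0 := hu
    exact sub_eq_zero.1 this
  have h2 := shiftedInverse_eq hinj u
  rw [h1] at h2
  rw [add_smul, one_smul, ← map_smul, ← map_add, h2]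

/-- With `u = R z` one has `T u - c u = (1 - (1 + c) R) z`, so `R (1 - (1 + c) R)⁻¹` inverts `T -
c`. The two factors commute, which makes this a two-sided inverse. -/
theorem notMem_unboundedSpectrum_of_bijective (hinj : Function.Injective R) {c : ℝ}
    (h : IsUnit (1 - (1 + c) • R)) : c ∉ unboundedSpectrum (shiftedInverse R) := by
  obtain ⟨S, hS1, hS2⟩ := isUnit_iff_exists.1 h
  have hcomm : S * R = R * S := by
    have h1 : R * (1 - (1 + c) • R) = (1 - (1 + c) • R) * R := by
      simp [mul_sub, sub_mul]
    calc S * R = S * (R * ((1 - (1 + c) • R) * S)) := by rw [hS1, mul_one]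
      _ = S * (1 - (1 + c) • R) * R * S := by simp only [← mul_assoc]; rw [mul_assoc S R, h1, mul_assoc S _ R]
      _ = R * S := by rw [hS2, one_mul]
  have key : ∀ v, S v - (1 + c) • R (S v) = v := fun v => by
    have := congrArg (fun A : H →L[ℝ] H => A v) hS1
    simpa using this
  simp only [unboundedSpectrum, mem_ofPred_eq, not_not]
  refine ⟨R * S, fun v => ⟨apply_mem_shiftedInverse_domain hinj _, ?_⟩, fun u => ?_⟩
  · have h2 : shiftedInverse R ⟨(R * S) v, apply_mem_shiftedInverse_domain hinj _⟩ =
        S v - R (S v) := by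
      rw [shiftedInverse_apply_iff hinj]
      simp
    rw [h2]
    conv_rhs => rw [← key v]
    simp only [mul_apply_eq_comp, add_smul, one_smul]
    abel
  · have h3 := shiftedInverse_eq hinj u
    set z := (u : H) + shiftedInverse R u with hz
    have h4 : shiftedInverse R u = z - R z := by rw [h3, hz]; abel
    have h5 : shiftedInverse R u - c • (u : H) = (1 - (1 + c) • R) z := by
      rw [h4, ← h3]
      change _ = z - (1 + c) • R z
      rw [add_smul, one_smul]
      abel
    rw [h5, ← hcomm]
    change S (R _) = _
    have h6 := congrArg (fun A : H →L[ℝ] H => A z) hS2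
    have h7 : R ((1 - (1 + c) • R) z) = (1 - (1 + c) • R) (R z) := by simp
    rw [h7]
    have h8 := congrArg (fun A : H →L[ℝ] H => A (R z)) hS2
    exact h8.trans h3

/-- By the Fredholm alternative a spectral point `c` of `R⁻¹ - 1` makes `(1 + c)⁻¹` an eigenvalue of
`R`, and the eigenspace is finite dimensional since the eigenvalue is nonzero. For isolation,
restrict `R` to the orthogonal complement of that eigenspace. There `R - (1 + c)⁻¹` is injective
with `R` compact, hence bounded below, while eigenvectors for the other spectral points lie in this
complement. -/
theorem hasDiscreteSpectrum_shiftedInverse [CompleteSpace H] (hinj : Function.Injective R)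
    (hR : (R : H →ₗ[ℝ] H).IsSymmetric) (hc : IsCompactOperator R) :
    HasDiscreteSpectrum (shiftedInverse R) := by
  have hR' : ∀ x y, inner ℝ (R x) y = inner ℝ x (R y) := hR
  have hunit : ∀ c ∈ unboundedSpectrum (shiftedInverse R), 1 + c ≠ 0 ∧
      Module.End.HasEigenvalue (R : H →ₗ[ℝ] H) (1 + c)⁻¹ := by
    intro c hcs
    -- At `c = -1` the operator `1 - (1 + c) R` is the identity.
    have h0 : 1 + c ≠ 0 := by
      intro h0
      exact notMem_unboundedSpectrum_of_bijective hinj (by simp [h0]) hcs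
    refine ⟨h0, ?_⟩
    refine (hc.hasEigenvalue_or_mem_resolventSet (inv_ne_zero h0)).resolve_right fun h => ?_
    refine notMem_unboundedSpectrum_of_bijective hinj ?_ hcs
    rw [spectrum.mem_resolventSet_iff, Algebra.algebraMap_eq_smul_one] at h
    have := h.smul (Units.mk0 (1 + c) h0)
    rw [Units.smul_mk0, smul_sub, smul_smul, mul_inv_cancel₀ h0, one_smul] at this
    exact this
  intro c hcs
  obtain ⟨h0, hev⟩ := hunit c hcs
  refine ⟨?_, ?_, ?_⟩
  · let lam := (1 + c)⁻¹
    let N : Submodule ℝ H := Module.End.eigenspace (R : H →ₗ[ℝ] H) lam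
    have hinv : ∀ v ∈ Nᗮ, (R : H →ₗ[ℝ] H) v ∈ Nᗮ := by
      intro v hv w hw
      have hw' : R w = lam • w := Module.End.mem_eigenspace_iff.1 hw
      change inner ℝ w (R v) = 0
      rw [← hR', hw', inner_smul_left, hv w hw, mul_zero]
    let R' : Nᗮ →L[ℝ] Nᗮ := ⟨(R : H →ₗ[ℝ] H).restrict hinv,
      (R.continuous.comp continuous_subtype_val).subtype_mk _⟩
    have hR'c : IsCompactOperator R' := hc.restrict' hinv
    have hnot : ¬ Module.End.HasEigenvalue (R' : Nᗮ →ₗ[ℝ] Nᗮ) lam := by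
      intro h
      obtain ⟨v, hv⟩ := h.exists_hasEigenvector
      have h1 : R v = lam • (v : H) := congrArg Subtype.val (Module.End.mem_eigenspace_iff.1 hv.1)
      have h2 : (v : H) ∈ N := Module.End.mem_eigenspace_iff.2 h1
      exact hv.2 (Subtype.ext (inner_self_eq_zero.1 (v.2 _ h2)))
    obtain ⟨K, hK⟩ := hR'c.antilipschitz_of_not_hasEigenvalue (inv_ne_zero h0) hnot
    -- An eigenvector `x` for `b ≠ c` satisfies `R x - lam x = lam (c - b) R x`, so boundedness
    -- below gives `‖x‖ ≤ K |lam| ‖R‖ |b - c| ‖x‖`. The added `1` keeps the radius defined when this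
    -- constant vanishes.
    refine ⟨(K * (|lam| * ‖R‖) + 1)⁻¹, by positivity, fun b hbs hb => ?_⟩
    by_contra hbc
    obtain ⟨hb0, hbev⟩ := hunit b hbs
    obtain ⟨x, hx⟩ := hbev.exists_hasEigenvector
    have hx1 : R x = (1 + b)⁻¹ • x := Module.End.mem_eigenspace_iff.1 hx.1
    have hne : (1 + b)⁻¹ ≠ lam := by
      intro h
      exact hbc (by linarith [inv_injective h])
    have hxN : x ∈ Nᗮ := by
      intro w hw
      have hw' : R w = lam • w := Module.End.mem_eigenspace_iff.1 hw
      have := hR' w x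
      rw [hw', hx1, inner_smul_left, inner_smul_right] at this
      have h3 : ((1 + b)⁻¹ - lam) * inner ℝ w x = 0 := by
        rw [sub_mul, ← this]; simp
      exact (mul_eq_zero.1 h3).resolve_left (sub_ne_zero.2 hne)
    have h4 := hK.le_mul_dist ⟨x, hxN⟩ 0
    rw [dist_zero_right, map_zero, dist_zero_right] at h4
    have h5 : ‖(R' - lam • 1 : Nᗮ →L[ℝ] Nᗮ) ⟨x, hxN⟩‖ = ‖R x - lam • x‖ := rfl
    have h6 : R x - lam • x = (lam * (c - b)) • R x := by
      have h7 : x = (1 + b) • R x := by rw [hx1, smul_smul, mul_inv_cancel₀ hb0, one_smul]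
      nth_rw 2 [h7]
      rw [smul_smul, ← one_smul ℝ (R x), smul_smul, smul_smul, ← sub_smul]
      congr 1
      have : lam * (1 + c) = 1 := inv_mul_cancel₀ h0
      linear_combination (-1) * this
    have hxpos : 0 < ‖x‖ := norm_pos_iff.2 hx.2
    rw [h5, h6, norm_smul, Real.norm_eq_abs, abs_mul, abs_sub_comm c b] at h4
    have h8 : ‖x‖ ≤ (K * (|lam| * ‖R‖)) * |b - c| * ‖x‖ := by
      refine h4.trans ?_
      calc (K : ℝ) * (|lam| * |b - c| * ‖R x‖) ≤ K * (|lam| * |b - c| * (‖R‖ * ‖x‖)) := by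
            gcongr; exact R.le_opNorm x
        _ = _ := by ring
    have h9 : (K * (|lam| * ‖R‖)) * |b - c| < 1 := by
      have hA : 0 ≤ (K : ℝ) * (|lam| * ‖R‖) := by positivity
      rw [← one_div, lt_div_iff₀ (by positivity)] at hb
      nlinarith [abs_nonneg (b - c)]
    nlinarith
  · obtain ⟨x, hx⟩ := hev.exists_hasEigenvector
    have hx1 : R x = (1 + c)⁻¹ • x := Module.End.mem_eigenspace_iff.1 hx.1
    have hx2 : R ((1 + c) • x) = x := by rw [map_smul, hx1, smul_smul, mul_inv_cancel₀ h0, one_smul]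
    have hmem : x ∈ (shiftedInverse R).domain := by
      rw [← hx2]; exact apply_mem_shiftedInverse_domain hinj _
    have h1 : shiftedInverse R ⟨x, hmem⟩ = c • x := by
      rw [shiftedInverse_apply_iff hinj]
      simpa [add_smul] using hx2
    intro hbot
    have h2 : (⟨x, hmem⟩ : (shiftedInverse R).domain) ∈
        unboundedEigenspace (shiftedInverse R) c := by
      change (shiftedInverse R) ⟨x, hmem⟩ - c • x = 0
      rw [h1, sub_self]
    rw [hbot, Submodule.mem_bot] at h2
    exact hx.2 (congrArg Subtype.val h2)
  · have hfd := ContinuousLinearMap.finite_dimensional_eigenspace hc _ (inv_ne_zero h0)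
    let f : unboundedEigenspace (shiftedInverse R) c →ₗ[ℝ]
        Module.End.eigenspace (R : H →ₗ[ℝ] H) (1 + c)⁻¹ :=
      ((shiftedInverse R).domain.subtype.comp (Submodule.subtype _)).codRestrict _ fun u => by
        rw [Module.End.mem_eigenspace_iff]
        have := mem_eigenspace_of_mem_unboundedEigenspace hinj u.2
        change R (u : (shiftedInverse R).domain) = (1 + c)⁻¹ • ((u : (shiftedInverse R).domain) : H)
        rw [← this, smul_smul, inv_mul_cancel₀ h0, one_smul, this]
    refine FiniteDimensional.of_injective f fun u v huv => ?_
    have h1 : ((u : (shiftedInverse R).domain) : H) = (v : (shiftedInverse R).domain) :=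
      congrArg (fun z : Module.End.eigenspace (R : H →ₗ[ℝ] H) (1 + c)⁻¹ => (z : H)) huv
    exact Subtype.ext (Subtype.ext h1)

end ShiftedInverse

/-! ### Comparison of the metric and the measure with Euclidean ones in charts -/

section ChartComparison
variable {n : ℕ} {X : Type*} [TopologicalSpace X] [ChartedSpace (EuclideanSpace ℝ (Fin n)) X]
  {e : OpenPartialHomeomorph X (EuclideanSpace ℝ (Fin n))}

theorem coordVector_eq_sum (e : OpenPartialHomeomorph X (EuclideanSpace ℝ (Fin n)))
    (z v : EuclideanSpace ℝ (Fin n)) :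
    coordVector e z v = ∑ i, v i • coordVector e z (EuclideanSpace.single i 1) := by
  have h5 : v = ∑ i, v i • EuclideanSpace.single i (1 : ℝ) := by
    have := (EuclideanSpace.basisFun (Fin n) ℝ).sum_repr v
    simpa using this.symm
  conv_lhs => rw [h5]
  let L : EuclideanSpace ℝ (Fin n) →ₗ[ℝ] TangentSpace (𝓡 n) (e.symm z) :=
    (mfderiv (𝓡 n) (𝓡 n) e.symm z).toLinearMap
  change L _ = ∑ i, v i • L _
  simp only [map_sum, map_smul]

variable [IsManifold (𝓡 n) ∞ X]

theorem coordVector_injective (he : e ∈ atlas (EuclideanSpace ℝ (Fin n)) X)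
    {y : EuclideanSpace ℝ (Fin n)} (hy : y ∈ e.target) :
    Function.Injective (coordVector e y) :=
  (mdifferentiable_of_mem_atlas (I := 𝓡 n) he).symm.mfderiv_injective hy

variable [RiemannianBundle (fun x : X => TangentSpace (𝓡 n) x)]

theorem norm_coordVector_sq (e : OpenPartialHomeomorph X (EuclideanSpace ℝ (Fin n)))
    (z v : EuclideanSpace ℝ (Fin n)) :
    ‖coordVector e z v‖ ^ 2 = ∑ i, ∑ j, v i * v j * chartGram e z i j := by
  rw [← real_inner_self_eq_norm_sq, coordVector_eq_sum, sum_inner]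
  refine Finset.sum_congr rfl fun i _ => ?_
  rw [inner_sum]
  refine Finset.sum_congr rfl fun j _ => ?_
  rw [real_inner_smul_left, real_inner_smul_right, chartGram, Matrix.of_apply]
  ring

theorem det_chartGram_pos (he : e ∈ atlas (EuclideanSpace ℝ (Fin n)) X)
    {y : EuclideanSpace ℝ (Fin n)} (hy : y ∈ e.target) : 0 < (chartGram e y).det := by
  have hli : LinearIndependent ℝ fun i : Fin n => coordVector e y (EuclideanSpace.single i 1) := by
    have h1 : LinearIndependent ℝ fun i : Fin n => EuclideanSpace.single i (1 : ℝ) := by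
      have := (EuclideanSpace.basisFun (Fin n) ℝ).toBasis.linearIndependent
      rwa [show ⇑(EuclideanSpace.basisFun (Fin n) ℝ).toBasis =
        fun i : Fin n => EuclideanSpace.single i (1 : ℝ) by ext; simp] at this
    let L : EuclideanSpace ℝ (Fin n) →ₗ[ℝ] TangentSpace (𝓡 n) (e.symm y) :=
      (mfderiv (𝓡 n) (𝓡 n) e.symm y).toLinearMap
    exact h1.map' L (LinearMap.ker_eq_bot.2 (coordVector_injective he hy))
  exact (Matrix.posDef_gram_of_linearIndependent hli).det_pos

variable [IsContMDiffRiemannianBundle (𝓡 n) ∞ (EuclideanSpace ℝ (Fin n))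
    (fun x : X => TangentSpace (𝓡 n) x)]

theorem continuousOn_chartGram (he : e ∈ atlas (EuclideanSpace ℝ (Fin n)) X) :
    ContinuousOn (chartGram e) e.target := by
  refine continuousOn_pi.2 fun i => continuousOn_pi.2 fun j => ?_
  have h : ContMDiffOn (𝓡 n) 𝓘(ℝ, ℝ) ∞ (fun y => inner ℝ
      (coordVector e y (EuclideanSpace.single i 1)) (coordVector e y (EuclideanSpace.single j 1)))
      e.target :=
    (contMDiffOn_coordVector he _).inner_bundle (contMDiffOn_coordVector he _)
  exact h.continuousOn

/-- The function `‖coordVector e z v‖` is continuous and positive on the compact product of `K` with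
the unit sphere. Its extrema there bound it for all `v` by homogeneity. -/
theorem exists_norm_coordVector_bounds (he : e ∈ atlas (EuclideanSpace ℝ (Fin n)) X)
    {K : Set (EuclideanSpace ℝ (Fin n))} (hK : IsCompact K) (hKe : K ⊆ e.target) :
    ∃ C : ℝ, 0 < C ∧ ∀ z ∈ K, ∀ v, ‖coordVector e z v‖ ≤ C * ‖v‖ ∧
      ‖v‖ ≤ C * ‖coordVector e z v‖ := by
  let E := EuclideanSpace ℝ (Fin n)
  have hcont : ContinuousOn (fun p : EuclideanSpace ℝ (Fin n) × EuclideanSpace ℝ (Fin n) => ‖coordVector e p.1 p.2‖) (K ×ˢ Metric.sphere 0 1) := by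
    have h1 : ContinuousOn (fun p : EuclideanSpace ℝ (Fin n) × EuclideanSpace ℝ (Fin n) => ∑ i, ∑ j, p.2 i * p.2 j * chartGram e p.1 i j)
        (K ×ˢ Metric.sphere 0 1) := by
      refine continuousOn_finsetSum _ fun i _ => continuousOn_finsetSum _ fun j _ => ?_
      refine ContinuousOn.mul (by fun_prop) ?_
      have h2 : ContinuousOn (fun z => chartGram e z i j) e.target :=
        continuousOn_pi.1 (continuousOn_pi.1 (continuousOn_chartGram he) i) j
      exact h2.comp continuousOn_fst fun p hp => hKe hp.1
    refine h1.sqrt.congr fun p _ => ?_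
    dsimp only
    rw [← norm_coordVector_sq, Real.sqrt_sq (norm_nonneg _)]
  have hcpt : IsCompact (K ×ˢ Metric.sphere (0 : E) 1) := hK.prod (isCompact_sphere 0 1)
  have hpos : ∀ p ∈ K ×ˢ Metric.sphere (0 : E) 1, 0 < ‖coordVector e p.1 p.2‖ := by
    rintro ⟨z, v⟩ ⟨hz, hv⟩
    refine norm_pos_iff.2 fun h0 => ?_
    have hv0 : v = 0 := by
      refine coordVector_injective he (hKe hz) (h0.trans ?_)
      exact (map_zero (mfderiv (𝓡 n) (𝓡 n) e.symm z)).symm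
    simp [hv0] at hv
  obtain ⟨c, hc0, hc⟩ := hcpt.exists_forall_le' hcont hpos
  obtain ⟨B, hB⟩ := (hcpt.image_of_continuousOn hcont).bddAbove
  refine ⟨max B 0 + c⁻¹, by positivity, fun z hz v => ?_⟩
  rcases eq_or_ne v 0 with rfl | hv
  · have : coordVector e z 0 = 0 := map_zero (mfderiv (𝓡 n) (𝓡 n) e.symm z)
    simp [this]
  have hvpos : 0 < ‖v‖ := norm_pos_iff.2 hv
  have hmem : (z, ‖v‖⁻¹ • v) ∈ K ×ˢ Metric.sphere (0 : E) 1 := by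
    refine ⟨hz, ?_⟩
    simp [norm_smul, hvpos.ne']
  have h1 := hc _ hmem
  have h2 := hB (mem_image_of_mem _ hmem)
  have h3 : ‖coordVector e z (‖v‖⁻¹ • v)‖ = ‖v‖⁻¹ * ‖coordVector e z v‖ := by
    have : coordVector e z (‖v‖⁻¹ • v) = ‖v‖⁻¹ • coordVector e z v :=
      map_smul (mfderiv (𝓡 n) (𝓡 n) e.symm z) _ _
    rw [this, norm_smul, norm_inv, norm_norm]
  dsimp only at h1 h2
  rw [h3] at h1 h2
  rw [inv_mul_eq_div, div_le_iff₀ hvpos] at h2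
  rw [inv_mul_eq_div, le_div_iff₀ hvpos] at h1
  constructor
  · refine h2.trans ?_
    gcongr
    exact (le_max_left _ _).trans (le_add_of_nonneg_right (by positivity))
  · calc ‖v‖ = c⁻¹ * (c * ‖v‖) := by field_simp
      _ ≤ c⁻¹ * ‖coordVector e z v‖ := by gcongr
      _ ≤ _ := by
        gcongr
        exact le_add_of_nonneg_left (le_max_right _ _)

variable [MeasurableSpace X]

/-- On the ball `B(y, R)` of the coordinates of `e`, the metric and the measure `ν` are
comparable to the Euclidean ones, with the constant `C`. -/
structure IsComparisonBall (ν : Measure X) (e : OpenPartialHomeomorph X (EuclideanSpace ℝ (Fin n)))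
    (y : EuclideanSpace ℝ (Fin n)) (R : ℝ) (C : ℝ≥0) : Prop where
  mem_atlas : e ∈ atlas (EuclideanSpace ℝ (Fin n)) X
  ball_subset : Metric.ball y R ⊆ e.target
  map_le : ∀ S ⊆ Metric.ball y R, MeasurableSet S →
    (volume.restrict S).map e.symm ≤ C • ν.restrict (e.symm '' S)
  le_map : ∀ S ⊆ Metric.ball y R, MeasurableSet S →
    ν.restrict (e.symm '' S) ≤ C • (volume.restrict S).map e.symm
  norm_coordVector_le : ∀ z ∈ Metric.ball y R, ∀ v, ‖coordVector e z v‖ ≤ C * ‖v‖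
  le_norm_coordVector : ∀ z ∈ Metric.ball y R, ∀ v, ‖v‖ ≤ C * ‖coordVector e z v‖

variable [BorelSpace X]

theorem aemeasurable_chart_symm {S : Set (EuclideanSpace ℝ (Fin n))} (hS : MeasurableSet S)
    (hSe : S ⊆ e.target) : AEMeasurable e.symm (volume.restrict S) :=
  (e.continuousOn_symm.mono hSe).aemeasurable hS

/-- In the chart the measure has density `ρ √(det g_ij)`, which is continuous and positive. It is
therefore bounded above and away from zero on a compact coordinate ball. -/
theorem IsRiemannianVolume.exists_isComparisonBall {V : Measure X} (hV : IsRiemannianVolume n V)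
    {ρ : X → ℝ} (hρ : Continuous ρ) (hρ0 : ∀ x, 0 < ρ x) (x : X) :
    ∃ R > 0, ∃ C : ℝ≥0, IsComparisonBall (V.withDensity fun x => ENNReal.ofReal (ρ x))
      (chartAt (EuclideanSpace ℝ (Fin n)) x) (chartAt (EuclideanSpace ℝ (Fin n)) x x) R C := by
  set e := chartAt (EuclideanSpace ℝ (Fin n)) x
  have he : e ∈ atlas (EuclideanSpace ℝ (Fin n)) X := chart_mem_atlas _ x
  have hy : e x ∈ e.target := e.map_source (mem_chart_source _ x)
  obtain ⟨R, hR, hball⟩ := Metric.nhds_basis_closedBall.mem_iff.1 (e.open_target.mem_nhds hy)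
  have hcpt : IsCompact (Metric.closedBall (e x) R) := isCompact_closedBall _ _
  obtain ⟨C₀, hC₀, hcv⟩ := exists_norm_coordVector_bounds he hcpt hball
  have hdet : ContinuousOn (fun z => √(chartGram e z).det) (Metric.closedBall (e x) R) :=
    ((continuous_id.matrix_det.comp_continuousOn (continuousOn_chartGram he)).sqrt).mono hball
  have hρe : ContinuousOn (fun z => ρ (e.symm z)) (Metric.closedBall (e x) R) :=
    hρ.comp_continuousOn (e.continuousOn_symm.mono hball)
  obtain ⟨c₁, hc₁, h₁⟩ := hcpt.exists_forall_le' hdet (a := 0) fun z hz =>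
    Real.sqrt_pos.2 (det_chartGram_pos he (hball hz))
  obtain ⟨c₂, hc₂, h₂⟩ := hcpt.exists_forall_le' hρe (a := 0) fun z _ => hρ0 _
  obtain ⟨C₁, h₁'⟩ := (hcpt.image_of_continuousOn hdet).bddAbove
  obtain ⟨C₂, h₂'⟩ := (hcpt.image_of_continuousOn hρe).bddAbove
  have hx0 : e x ∈ Metric.closedBall (e x) R := Metric.mem_closedBall_self hR.le
  have hC₁ : 0 < C₁ := hc₁.trans_le ((h₁ _ hx0).trans (h₁' (mem_image_of_mem _ hx0)))
  have hC₂ : 0 < C₂ := hc₂.trans_le ((h₂ _ hx0).trans (h₂' (mem_image_of_mem _ hx0)))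
  -- One constant dominating all three that are needed: `C₀` for vectors, `(c₁ c₂)⁻¹` for Lebesgue
  -- measure against the weighted volume, `C₁ C₂` for the converse.
  let C : ℝ := C₀ + (c₁ * c₂)⁻¹ + C₁ * C₂
  have hC : 0 < C := by positivity
  have hb : Metric.ball (e x) R ⊆ Metric.closedBall (e x) R := Metric.ball_subset_closedBall
  -- measure of a set in the chart
  have hset : ∀ S ⊆ Metric.ball (e x) R, MeasurableSet S → ∀ t, MeasurableSet t →
      MeasurableSet (e.symm '' S ∩ t) ∧ e '' (e.symm '' S ∩ t) = S ∩ e.symm ⁻¹' t ∧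
      MeasurableSet (S ∩ e.symm ⁻¹' t) ∧
      (volume.restrict S).map e.symm t = volume (S ∩ e.symm ⁻¹' t) := by
    intro S hS hSm t ht
    have hSe : S ⊆ e.target := (hS.trans hb).trans hball
    have h1 : e.symm '' S = e.source ∩ e ⁻¹' S := e.symm_image_eq_source_inter_preimage hSe
    have h2 : MeasurableSet (e.symm '' S) := by
      rw [h1]; exact measurableSet_source_inter_preimage e hSm
    have h3 : MeasurableSet (S ∩ e.symm ⁻¹' t) := by
      have : S ∩ e.symm ⁻¹' t = S ∩ (e.symm.source ∩ e.symm ⁻¹' t) := by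
        ext z
        simp only [mem_inter_iff, mem_preimage, OpenPartialHomeomorph.symm_source]
        exact ⟨fun h => ⟨h.1, hSe h.1, h.2⟩, fun h => ⟨h.1, h.2.2⟩⟩
      rw [this]
      refine hSm.inter ?_
      have h1 : Measurable (e.target.domRestrict e.symm) :=
        (continuousOn_iff_continuous_domRestrict.1 e.continuousOn_symm).measurable
      have h4 := e.open_target.measurableSet.subtype_image (h1 ht)
      convert h4 using 1
      ext y
      simp only [mem_inter_iff, mem_image, Subtype.exists]
      exact ⟨fun h => ⟨y, h.1, h.2, rfl⟩, fun ⟨a, ha, hb, hab⟩ => hab ▸ ⟨ha, hb⟩⟩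
    refine ⟨h2.inter ht, ?_, h3, ?_⟩
    · ext z
      constructor
      · rintro ⟨_, ⟨⟨w, hw, rfl⟩, ht'⟩, rfl⟩
        rw [e.right_inv (hSe hw)]
        exact ⟨hw, ht'⟩
      · rintro ⟨hz, ht'⟩
        exact ⟨e.symm z, ⟨⟨z, hz, rfl⟩, ht'⟩, e.right_inv (hSe hz)⟩
    · rw [Measure.map_apply_of_aemeasurable (aemeasurable_chart_symm hSm hSe) ht]
      rw [Measure.restrict_apply' hSm, inter_comm]
  have hVs : ∀ S ⊆ Metric.ball (e x) R, MeasurableSet S → ∀ t, MeasurableSet t →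
      V (e.symm '' S ∩ t) = ∫⁻ y in S ∩ e.symm ⁻¹' t, ENNReal.ofReal (√(chartGram e y).det) := by
    intro S hS hSm t ht
    obtain ⟨h1, h2, -, -⟩ := hset S hS hSm t ht
    rw [hV e he _ ?_ h1, h2]
    rintro _ ⟨⟨w, hw, rfl⟩, -⟩
    exact e.map_target (hball (hb (hS hw)))
  refine ⟨R, hR, C.toNNReal, he, hb.trans hball, fun S hS hSm => ?_, fun S hS hSm => ?_,
    fun z hz v => ?_, fun z hz v => ?_⟩
  · refine Measure.le_iff.2 fun t ht => ?_
    obtain ⟨h1, h2, h3, h4⟩ := hset S hS hSm t ht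
    rw [h4, Measure.smul_apply, Measure.restrict_apply ht, inter_comm t, withDensity_apply _ h1]
    have h5 : ENNReal.ofReal c₂ * V (e.symm '' S ∩ t) ≤
        ∫⁻ a in e.symm '' S ∩ t, ENNReal.ofReal (ρ a) ∂V := by
      rw [← setLIntegral_const]
      refine setLIntegral_mono' h1 ?_
      rintro _ ⟨⟨w, hw, rfl⟩, -⟩
      exact ENNReal.ofReal_le_ofReal (h₂ w (hb (hS hw)))
    have h6 : ENNReal.ofReal c₁ * volume (S ∩ e.symm ⁻¹' t) ≤ V (e.symm '' S ∩ t) := by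
      rw [hVs S hS hSm t ht, ← setLIntegral_const]
      exact setLIntegral_mono' h3 fun w hw => ENNReal.ofReal_le_ofReal (h₁ w (hb (hS hw.1)))
    calc volume (S ∩ e.symm ⁻¹' t) = ENNReal.ofReal (c₁ * c₂)⁻¹ *
          (ENNReal.ofReal c₂ * (ENNReal.ofReal c₁ * volume (S ∩ e.symm ⁻¹' t))) := by
          rw [← mul_assoc, ← mul_assoc, ← ENNReal.ofReal_mul (by positivity),
            ← ENNReal.ofReal_mul (by positivity)]
          rw [show (c₁ * c₂)⁻¹ * c₂ * c₁ = 1 by field_simp]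
          simp
      _ ≤ ENNReal.ofReal C * ∫⁻ a in e.symm '' S ∩ t, ENNReal.ofReal (ρ a) ∂V := by
          refine mul_le_mul' (ENNReal.ofReal_le_ofReal ?_) (le_trans (mul_le_mul_right h6 _) h5)
          have : 0 < C₁ * C₂ := by positivity
          simp only [C]; linarith
      _ = _ := rfl
  · refine Measure.le_iff.2 fun t ht => ?_
    obtain ⟨h1, h2, h3, h4⟩ := hset S hS hSm t ht
    rw [Measure.smul_apply, h4, Measure.restrict_apply ht, inter_comm t, withDensity_apply _ h1]
    have h5 : ∫⁻ a in e.symm '' S ∩ t, ENNReal.ofReal (ρ a) ∂V ≤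
        ENNReal.ofReal C₂ * V (e.symm '' S ∩ t) := by
      rw [← setLIntegral_const]
      refine setLIntegral_mono' h1 ?_
      rintro _ ⟨⟨w, hw, rfl⟩, -⟩
      exact ENNReal.ofReal_le_ofReal (h₂' (mem_image_of_mem _ (hb (hS hw))))
    have h6 : V (e.symm '' S ∩ t) ≤ ENNReal.ofReal C₁ * volume (S ∩ e.symm ⁻¹' t) := by
      rw [hVs S hS hSm t ht, ← setLIntegral_const]
      exact setLIntegral_mono' h3 fun w hw =>
        ENNReal.ofReal_le_ofReal (h₁' (mem_image_of_mem _ (hb (hS hw.1))))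
    calc _ ≤ ENNReal.ofReal C₂ * (ENNReal.ofReal C₁ * volume (S ∩ e.symm ⁻¹' t)) :=
          h5.trans (mul_le_mul_right h6 _)
      _ ≤ ENNReal.ofReal C * volume (S ∩ e.symm ⁻¹' t) := by
          rw [← mul_assoc, ← ENNReal.ofReal_mul hC₂.le]
          refine mul_le_mul_left (ENNReal.ofReal_le_ofReal ?_) _
          have : 0 < (c₁ * c₂)⁻¹ := by positivity
          simp only [C]; linarith
      _ = _ := rfl
  · rw [Real.coe_toNNReal _ hC.le]
    refine (hcv z (hb hz) v).1.trans ?_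
    gcongr
    have : 0 < (c₁ * c₂)⁻¹ + C₁ * C₂ := by positivity
    simp only [C]; linarith
  · rw [Real.coe_toNNReal _ hC.le]
    refine (hcv z (hb hz) v).2.trans ?_
    gcongr
    have : 0 < (c₁ * c₂)⁻¹ + C₁ * C₂ := by positivity
    simp only [C]; linarith

end ChartComparison

/-! ### Rellich's estimate in Euclidean balls -/

theorem sq_lintegral_le {α : Type*} [MeasurableSpace α] (μ : Measure α) {f : α → ℝ≥0∞}
    (hf : AEMeasurable f μ) : (∫⁻ x, f x ∂μ) ^ 2 ≤ μ univ * ∫⁻ x, f x ^ 2 ∂μ := by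
  have h := ENNReal.lintegral_mul_le_Lp_mul_Lq μ Real.HolderConjugate.two_two
    (f := fun _ => 1) (g := f) aemeasurable_const hf
  simp only [Pi.mul_apply, one_mul, ENNReal.one_rpow, lintegral_const] at h
  calc (∫⁻ x, f x ∂μ) ^ 2 ≤ (μ univ ^ (1 / 2 : ℝ) * (∫⁻ x, f x ^ (2 : ℝ) ∂μ) ^ (1 / 2 : ℝ)) ^ 2 := by
        gcongr
    _ = μ univ * ∫⁻ x, f x ^ 2 ∂μ := by
        rw [mul_pow, ← ENNReal.rpow_natCast, ← ENNReal.rpow_natCast, ← ENNReal.rpow_mul,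
          ← ENNReal.rpow_mul]
        norm_num

theorem enorm_add_sq_le (a b : ℝ) : ‖a + b‖ₑ ^ 2 ≤ 2 * ‖a‖ₑ ^ 2 + 2 * ‖b‖ₑ ^ 2 := by
  have h1 : ‖a + b‖₊ ^ 2 ≤ 2 * ‖a‖₊ ^ 2 + 2 * ‖b‖₊ ^ 2 := by
    rw [← NNReal.coe_le_coe]
    push_cast
    simp only [Real.norm_eq_abs, sq_abs]
    nlinarith [sq_nonneg (a - b)]
  simp only [enorm_eq_nnnorm]
  exact_mod_cast h1

section Euclidean
variable {E : Type*} [NormedAddCommGroup E] [NormedSpace ℝ E]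

/-- Fundamental theorem of calculus on the segment, followed by Cauchy–Schwarz on the unit interval.
-/
theorem enorm_sub_sq_le_lintegral_fderiv {F : E → ℝ} {y : E} {R : ℝ}
    (hF : ContDiffOn ℝ 1 F (Metric.ball y R)) {x h : E} (hx : x ∈ Metric.ball y R)
    (hxh : x + h ∈ Metric.ball y R) :
    ‖F (x + h) - F x‖ₑ ^ 2 ≤
      ‖h‖ₑ ^ 2 * ∫⁻ t in Icc (0 : ℝ) 1, ‖fderiv ℝ F (x + t • h)‖ₑ ^ 2 := by
  have hmem : ∀ t ∈ Icc (0 : ℝ) 1, x + t • h ∈ Metric.ball y R := by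
    intro t ht
    have := (convex_ball y R).add_smul_sub_mem hx hxh ht
    simpa using this
  have hdc : ContinuousOn (fderiv ℝ F) (Metric.ball y R) :=
    hF.continuousOn_fderiv_of_isOpen Metric.isOpen_ball le_rfl
  have hc : ContinuousOn (fun t : ℝ => fderiv ℝ F (x + t • h)) (Icc 0 1) :=
    hdc.comp (by fun_prop) hmem
  have hderiv : ∀ t ∈ uIcc (0 : ℝ) 1,
      HasDerivAt (fun t : ℝ => F (x + t • h)) (fderiv ℝ F (x + t • h) h) t := by
    intro t ht
    rw [uIcc_of_le zero_le_one] at ht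
    have h1 : HasFDerivAt F (fderiv ℝ F (x + t • h)) (x + t • h) :=
      ((hF.differentiableOn one_ne_zero).differentiableAt
        (Metric.isOpen_ball.mem_nhds (hmem t ht))).hasFDerivAt
    have h2 : HasDerivAt (fun t : ℝ => x + t • h) h t := by
      simpa using ((hasDerivAt_id t).smul_const h).const_add x
    exact h1.comp_hasDerivAt t h2
  have hint : IntervalIntegrable (fun t : ℝ => fderiv ℝ F (x + t • h) h) volume 0 1 := by
    refine ContinuousOn.intervalIntegrable ?_
    rw [uIcc_of_le zero_le_one]
    exact hc.clm_apply continuousOn_const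
  have heq := intervalIntegral.integral_eq_sub_of_hasDerivAt hderiv hint
  simp only [one_smul, zero_smul, add_zero] at heq
  rw [← heq, intervalIntegral.integral_of_le zero_le_one, ← integral_Icc_eq_integral_Ioc]
  have hm : AEMeasurable (fun t : ℝ => ‖fderiv ℝ F (x + t • h)‖ₑ) (volume.restrict (Icc 0 1)) :=
    (hc.enorm).aemeasurable measurableSet_Icc
  calc ‖∫ t in Icc (0 : ℝ) 1, fderiv ℝ F (x + t • h) h‖ₑ ^ 2
      ≤ (∫⁻ t in Icc (0 : ℝ) 1, ‖fderiv ℝ F (x + t • h) h‖ₑ) ^ 2 := by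
        gcongr
        exact enorm_integral_le_lintegral_enorm _
    _ ≤ (∫⁻ t in Icc (0 : ℝ) 1, ‖h‖ₑ * ‖fderiv ℝ F (x + t • h)‖ₑ) ^ 2 := by
        gcongr with t
        rw [mul_comm]
        exact ContinuousLinearMap.le_opENorm _ _
    _ = ‖h‖ₑ ^ 2 * (∫⁻ t in Icc (0 : ℝ) 1, ‖fderiv ℝ F (x + t • h)‖ₑ) ^ 2 := by
        rw [lintegral_const_mul'' _ hm, mul_pow]
    _ ≤ _ := by
        gcongr
        refine (sq_lintegral_le _ hm).trans ?_
        simp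

variable [MeasurableSpace E] [BorelSpace E] [FiniteDimensional ℝ E] (μ : Measure E)
  [μ.IsAddHaarMeasure]

/-- Integrate the segment bound in `x` and exchange the integrals. For each `t` the translate by `t
h` of the small ball lies in the large one, and `μ` is translation invariant. -/
theorem lintegral_translate_sub_sq_le {F : E → ℝ} {y : E} {r R : ℝ}
    (hF : ContDiffOn ℝ 1 F (Metric.ball y R)) {h : E} (hr : r + ‖h‖ ≤ R) :
    ∫⁻ x in Metric.ball y r, ‖F (x + h) - F x‖ₑ ^ 2 ∂μ ≤
      ‖h‖ₑ ^ 2 * ∫⁻ x in Metric.ball y R, ‖fderiv ℝ F x‖ₑ ^ 2 ∂μ := by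
  have hadd : ∀ x ∈ Metric.ball y r, ∀ t ∈ Icc (0 : ℝ) 1, x + t • h ∈ Metric.ball y R := by
    intro x hx t ht
    rw [Metric.mem_ball, dist_eq_norm] at hx ⊢
    calc ‖x + t • h - y‖ = ‖(x - y) + t • h‖ := by congr 1; abel
      _ ≤ ‖x - y‖ + ‖t • h‖ := norm_add_le _ _
      _ ≤ ‖x - y‖ + ‖h‖ := by
        gcongr
        rw [norm_smul, Real.norm_eq_abs, abs_of_nonneg ht.1]
        exact mul_le_of_le_one_left (norm_nonneg _) ht.2
      _ < R := by linarith
  have hmeas : Measurable fun x => ‖fderiv ℝ F x‖ₑ ^ 2 := (measurable_fderiv ℝ F).enorm.pow_const 2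
  calc ∫⁻ x in Metric.ball y r, ‖F (x + h) - F x‖ₑ ^ 2 ∂μ
      ≤ ∫⁻ x in Metric.ball y r,
          (‖h‖ₑ ^ 2 * ∫⁻ t in Icc (0 : ℝ) 1, ‖fderiv ℝ F (x + t • h)‖ₑ ^ 2) ∂μ := by
        refine setLIntegral_mono' measurableSet_ball fun x hx => ?_
        refine enorm_sub_sq_le_lintegral_fderiv hF ?_ ?_
        · simpa using hadd x hx 0 (by simp)
        · simpa using hadd x hx 1 (by simp)
    _ = ‖h‖ₑ ^ 2 * ∫⁻ t in Icc (0 : ℝ) 1, ∫⁻ x in Metric.ball y r,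
          ‖fderiv ℝ F (x + t • h)‖ₑ ^ 2 ∂μ := by
        rw [lintegral_const_mul' _ _ (by simp), lintegral_lintegral_swap]
        exact (hmeas.comp (by fun_prop : Measurable fun p : E × ℝ => p.1 + p.2 • h)).aemeasurable
    _ ≤ ‖h‖ₑ ^ 2 * ∫⁻ t in Icc (0 : ℝ) 1, ∫⁻ x in Metric.ball y R, ‖fderiv ℝ F x‖ₑ ^ 2 ∂μ := by
        gcongr 1
        refine setLIntegral_mono' measurableSet_Icc fun t ht => ?_
        rw [← lintegral_indicator measurableSet_ball, ← lintegral_indicator measurableSet_ball,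
          ← lintegral_add_right_eq_self ((Metric.ball y R).indicator _) (t • h)]
        refine lintegral_mono fun x => ?_
        by_cases hx : x ∈ Metric.ball y r
        · rw [indicator_of_mem hx, indicator_of_mem (hadd x hx t ht)]
        · rw [indicator_of_notMem hx]
          exact zero_le
    _ = _ := by simp

/-- Write `μ(A) F(x) = ∫_A (F(x) - F(z)) dz + ∫_A F` with `A = B(c, δ)`. Every `z` in `A` is `x + h`
with `‖h‖ < 2δ`, so Cauchy–Schwarz bounds the first term by translation differences. -/
theorem sq_measure_mul_enorm_sq_le {F : E → ℝ} {c x : E} {δ : ℝ} (hF : Measurable F)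
    (hint : IntegrableOn F (Metric.ball c δ) μ) (hx : x ∈ Metric.ball c δ) :
    μ (Metric.ball c δ) ^ 2 * ‖F x‖ₑ ^ 2 ≤
      2 * μ (Metric.ball c δ) * ∫⁻ h in Metric.ball 0 (2 * δ), ‖F (x + h) - F x‖ₑ ^ 2 ∂μ +
        2 * ‖∫ z in Metric.ball c δ, F z ∂μ‖ₑ ^ 2 := by
  set A := Metric.ball c δ
  have hA : μ A ≠ ⊤ := measure_ball_lt_top.ne
  have : IsFiniteMeasure (μ.restrict A) := ⟨by simpa using hA.lt_top⟩
  have h1 : (μ A).toReal * F x = ∫ z in A, (F x - F z) ∂μ + ∫ z in A, F z ∂μ := by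
    rw [integral_sub (integrable_const _) hint]
    simp [Measure.real]
  have h2 : μ A ^ 2 * ‖F x‖ₑ ^ 2 = ‖(μ A).toReal * F x‖ₑ ^ 2 := by
    rw [enorm_mul, mul_pow, Real.enorm_eq_ofReal ENNReal.toReal_nonneg, ENNReal.ofReal_toReal hA]
  rw [h2, h1]
  refine (enorm_add_sq_le _ _).trans ?_
  rw [mul_assoc]
  gcongr
  calc ‖∫ z in A, (F x - F z) ∂μ‖ₑ ^ 2 ≤ (∫⁻ z in A, ‖F x - F z‖ₑ ∂μ) ^ 2 := by
        gcongr; exact enorm_integral_le_lintegral_enorm _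
    _ ≤ μ A * ∫⁻ z in A, ‖F x - F z‖ₑ ^ 2 ∂μ := by
        have := sq_lintegral_le (μ.restrict A) (f := fun z => ‖F x - F z‖ₑ)
          (measurable_const.sub hF).enorm.aemeasurable
        simpa using this
    _ ≤ _ := by
        gcongr 1
        rw [← lintegral_indicator measurableSet_ball, ← lintegral_indicator measurableSet_ball,
          ← lintegral_add_left_eq_self _ x]
        refine lintegral_mono fun h => ?_
        by_cases hh : x + h ∈ A
        · rw [indicator_of_mem hh, indicator_of_mem, enorm_sub_rev]
          rw [mem_ball_zero_iff]
          rw [Metric.mem_ball, dist_eq_norm] at hh hx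
          calc ‖h‖ = ‖(x + h - c) - (x - c)‖ := by congr 1; abel
            _ ≤ ‖x + h - c‖ + ‖x - c‖ := norm_sub_le _ _
            _ < 2 * δ := by linarith
        · rw [indicator_of_notMem hh]
          exact zero_le

/-- This carries the compactness: for functions with bounded gradient norm, smallness in `L²` is
decided up to `ε` by finitely many averages, chosen independently of `F`. Cover the small ball by
balls of radius `δ`; in each, replace `F` by its average at a cost of order `δ²` times the squared
gradient norm. -/
theorem exists_lintegral_sq_le_add_sum {r R : ℝ} (hrR : r < R) (y : E) {ε : ℝ≥0∞} (hε : 0 < ε) :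
    ∃ (t : Finset E) (δ : ℝ) (K : ℝ≥0∞), K ≠ ⊤ ∧ (∀ c ∈ t, Metric.ball c δ ⊆ Metric.ball y R) ∧
      ∀ F : E → ℝ, ContDiffOn ℝ 1 F (Metric.ball y R) →
        ∫⁻ x in Metric.ball y r, ‖F x‖ₑ ^ 2 ∂μ ≤
          ε * ∫⁻ x in Metric.ball y R, ‖fderiv ℝ F x‖ₑ ^ 2 ∂μ +
            K * ∑ c ∈ t, ‖∫ x in Metric.ball c δ, F x ∂μ‖ₑ ^ 2 := by
  set d := Module.finrank ℝ E
  -- In the final constant, `2` comes from squaring a sum, `2 ^ d` is the volume ratio of the balls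
  -- of radii `2δ` and `δ`, and `(2δ)²` bounds `‖h‖²`.
  obtain ⟨δ, hδ, hδR, hδε⟩ : ∃ δ : ℝ, 0 < δ ∧ r + 2 * δ < R ∧
      ENNReal.ofReal (2 * 2 ^ d * (2 * δ) ^ 2) ≤ ε := by
    have h1 : ∀ᶠ δ : ℝ in 𝓝[>] 0, r + 2 * δ < R := by
      refine nhdsWithin_le_nhds (Tendsto.eventually_lt_const (u := R) (v := r) hrR ?_)
      have : Continuous fun δ : ℝ => r + 2 * δ := by fun_prop
      simpa using this.tendsto 0
    have h2 : ∀ᶠ δ : ℝ in 𝓝[>] 0, ENNReal.ofReal (2 * 2 ^ d * (2 * δ) ^ 2) < ε := by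
      refine nhdsWithin_le_nhds (Tendsto.eventually_lt_const (v := 0) hε ?_)
      have : Continuous fun δ : ℝ => ENNReal.ofReal (2 * 2 ^ d * (2 * δ) ^ 2) :=
        ENNReal.continuous_ofReal.comp (by fun_prop)
      simpa using this.tendsto 0
    obtain ⟨δ, ha, hb, hc⟩ := (h1.and (h2.and self_mem_nhdsWithin)).exists
    exact ⟨δ, hc, ha, hb.le⟩
  obtain ⟨t, ht, htc⟩ := (isCompact_closedBall y r).elim_nhds_subcover
    (fun c => Metric.ball c δ) fun c _ => Metric.ball_mem_nhds c hδ
  let b := μ (Metric.ball (0 : E) δ)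
  have hb : ∀ c, μ (Metric.ball c δ) = b := fun c => Measure.addHaar_ball_center μ c δ
  have hb0 : b ≠ 0 := (Metric.measure_ball_pos μ 0 hδ).ne'
  have hbt : b ≠ ⊤ := measure_ball_lt_top.ne
  have hsub : ∀ c ∈ t, Metric.closedBall c δ ⊆ Metric.ball y R := by
    intro c hc
    refine Metric.closedBall_subset_ball' ?_
    have := Metric.mem_closedBall.1 (ht c hc)
    linarith
  have hb2 : b ^ 2 ≠ 0 := pow_ne_zero _ hb0
  have hb2t : b ^ 2 ≠ ⊤ := ENNReal.pow_ne_top hbt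
  refine ⟨t, δ, (b ^ 2)⁻¹ * (2 * μ (Metric.ball y r)), ?_,
    fun c hc => Metric.ball_subset_closedBall.trans (hsub c hc), fun F hF => ?_⟩
  · exact ENNReal.mul_ne_top (ENNReal.inv_ne_top.2 hb2)
      (ENNReal.mul_ne_top (by simp) measure_ball_lt_top.ne)
  -- Nothing is known about `F` outside the ball. Cutting it off makes it measurable everywhere, as
  -- exchanging the integrals requires.
  let G := (Metric.ball y R).indicator F
  have hG : Measurable G := by
    classical
    have := hF.continuousOn.measurable_piecewise (g := fun _ => 0) (s := Metric.ball y R)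
      continuousOn_const measurableSet_ball
    convert this using 1
    ext x
    by_cases hx : x ∈ Metric.ball y R
    · simp [G, hx]
    · simp [G, hx]
  have hGF : ∀ x ∈ Metric.ball y R, G x = F x := fun x hx => indicator_of_mem hx F
  set D := ∫⁻ x in Metric.ball y R, ‖fderiv ℝ F x‖ₑ ^ 2 ∂μ with hD
  set S := ∑ c ∈ t, ‖∫ x in Metric.ball c δ, F x ∂μ‖ₑ ^ 2 with hS
  have hpt : ∀ x ∈ Metric.ball y r, b ^ 2 * ‖F x‖ₑ ^ 2 ≤
      2 * b * ∫⁻ h in Metric.ball 0 (2 * δ), ‖G (x + h) - G x‖ₑ ^ 2 ∂μ + 2 * S := by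
    intro x hx
    obtain ⟨c, hc, hxc⟩ := mem_iUnion₂.1 (htc (Metric.ball_subset_closedBall hx))
    have hint : IntegrableOn G (Metric.ball c δ) μ := by
      have h1 : IntegrableOn F (Metric.closedBall c δ) μ :=
        (hF.continuousOn.mono (hsub c hc)).integrableOn_compact (isCompact_closedBall _ _)
      refine (h1.mono_set Metric.ball_subset_closedBall).congr_fun (fun z hz => ?_)
        measurableSet_ball
      exact (hGF z (hsub c hc (Metric.ball_subset_closedBall hz))).symm
    have h2 := sq_measure_mul_enorm_sq_le μ hG hint hxc
    rw [hb, hGF x (Metric.ball_subset_ball hrR.le hx)] at h2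
    refine h2.trans ?_
    rw [hGF x (Metric.ball_subset_ball hrR.le hx)]
    gcongr
    have h3 : ∫ z in Metric.ball c δ, G z ∂μ = ∫ z in Metric.ball c δ, F z ∂μ :=
      setIntegral_congr_fun measurableSet_ball fun z hz =>
        hGF z (hsub c hc (Metric.ball_subset_closedBall hz))
    rw [h3]
    exact Finset.single_le_sum (f := fun c => ‖∫ x in Metric.ball c δ, F x ∂μ‖ₑ ^ 2)
      (fun _ _ => zero_le) hc
  have hswap : ∫⁻ x in Metric.ball y r, ∫⁻ h in Metric.ball 0 (2 * δ),
      ‖G (x + h) - G x‖ₑ ^ 2 ∂μ ∂μ ≤ ENNReal.ofReal (2 ^ d) * b * (ENNReal.ofReal ((2 * δ) ^ 2) * D) := by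
    rw [lintegral_lintegral_swap]
    swap
    · refine Measurable.aemeasurable ?_
      refine Measurable.pow_const (Measurable.enorm ?_) 2
      exact (hG.comp (measurable_fst.add measurable_snd)).sub (hG.comp measurable_fst)
    have hvol : μ (Metric.ball (0 : E) (2 * δ)) = ENNReal.ofReal (2 ^ d) * b :=
      Measure.addHaar_ball_mul_of_pos μ 0 two_pos δ
    rw [← hvol, mul_comm (μ _), ← setLIntegral_const]
    refine setLIntegral_mono' measurableSet_ball fun h hh => ?_
    rw [mem_ball_zero_iff] at hh
    have h4 : ∫⁻ x in Metric.ball y r, ‖G (x + h) - G x‖ₑ ^ 2 ∂μ =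
        ∫⁻ x in Metric.ball y r, ‖F (x + h) - F x‖ₑ ^ 2 ∂μ := by
      refine setLIntegral_congr_fun measurableSet_ball fun x hx => ?_
      have h5 : x + h ∈ Metric.ball y R := by
        rw [Metric.mem_ball, dist_eq_norm] at hx ⊢
        calc ‖x + h - y‖ = ‖(x - y) + h‖ := by congr 1; abel
          _ ≤ ‖x - y‖ + ‖h‖ := norm_add_le _ _
          _ < R := by linarith
      rw [hGF _ h5, hGF x (Metric.ball_subset_ball hrR.le hx)]
    rw [h4]
    refine (lintegral_translate_sub_sq_le μ hF (by linarith)).trans ?_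
    gcongr
    rw [← ofReal_norm, ← ENNReal.ofReal_pow (norm_nonneg _)]
    gcongr
  have hmain : b ^ 2 * ∫⁻ x in Metric.ball y r, ‖F x‖ₑ ^ 2 ∂μ ≤
      b ^ 2 * (ε * D + (b ^ 2)⁻¹ * (2 * μ (Metric.ball y r)) * S) := by
    calc b ^ 2 * ∫⁻ x in Metric.ball y r, ‖F x‖ₑ ^ 2 ∂μ
        = ∫⁻ x in Metric.ball y r, b ^ 2 * ‖F x‖ₑ ^ 2 ∂μ := (lintegral_const_mul' _ _ hb2t).symm
      _ ≤ ∫⁻ x in Metric.ball y r, (2 * b * ∫⁻ h in Metric.ball 0 (2 * δ),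
            ‖G (x + h) - G x‖ₑ ^ 2 ∂μ + 2 * S) ∂μ := setLIntegral_mono' measurableSet_ball hpt
      _ = 2 * b * ∫⁻ x in Metric.ball y r, ∫⁻ h in Metric.ball 0 (2 * δ),
            ‖G (x + h) - G x‖ₑ ^ 2 ∂μ ∂μ + 2 * S * μ (Metric.ball y r) := by
          rw [lintegral_add_right _ measurable_const,
            lintegral_const_mul' _ _ (ENNReal.mul_ne_top (by simp) hbt)]
          simp
      _ ≤ 2 * b * (ENNReal.ofReal (2 ^ d) * b * (ENNReal.ofReal ((2 * δ) ^ 2) * D)) +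
            2 * S * μ (Metric.ball y r) := by gcongr
      _ = b ^ 2 * (ENNReal.ofReal (2 * 2 ^ d * (2 * δ) ^ 2) * D) +
            1 * (2 * μ (Metric.ball y r) * S) := by
          rw [ENNReal.ofReal_mul (by positivity), ENNReal.ofReal_mul (by positivity)]
          simp only [ENNReal.ofReal_ofNat]
          ring
      _ ≤ _ := by
          rw [mul_add, ← mul_assoc (b ^ 2) ((b ^ 2)⁻¹ * _), ← mul_assoc (b ^ 2) (b ^ 2)⁻¹,
            ENNReal.mul_inv_cancel hb2 hb2t, one_mul, one_mul]
          gcongr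
  exact (ENNReal.mul_le_mul_iff_right hb2 hb2t).1 hmain

end Euclidean

/-! ### Closability of the gradient on Euclidean open sets -/

theorem tendsto_integral_smul_of_tendsto_eLpNorm {α V : Type*} [MeasurableSpace α]
    [NormedAddCommGroup V] [NormedSpace ℝ V] {μ : Measure α} [IsFiniteMeasure μ]
    {g : ℕ → α → V} {G : α → V} (hg : ∀ k, MemLp (g k) 2 μ) (hG : MemLp G 2 μ)
    (h : Tendsto (fun k => eLpNorm (g k - G) 2 μ) atTop (𝓝 0))
    {ψ : α → ℝ} (hψ : AEStronglyMeasurable ψ μ) {B : ℝ} (hB : ∀ x, ‖ψ x‖ ≤ B) :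
    Tendsto (fun k => ∫ x, ψ x • g k x ∂μ) atTop (𝓝 (∫ x, ψ x • G x ∂μ)) := by
  have hint : ∀ f : α → V, MemLp f 2 μ → Integrable (fun x => ψ x • f x) μ := fun f hf =>
    (hf.integrable one_le_two).bdd_smul B hψ (Eventually.of_forall hB)
  refine tendsto_integral_of_L1' _ (hint G hG).1 (Eventually.of_forall fun k => hint _ (hg k)) ?_
  have h1 : Tendsto (fun k => ENNReal.ofReal B * (eLpNorm (g k - G) 2 μ *
      μ univ ^ (1 / (1 : ℝ≥0∞).toReal - 1 / (2 : ℝ≥0∞).toReal))) atTop (𝓝 0) := by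
    have h2 := ENNReal.Tendsto.mul_const (b := μ univ ^ (1 / (1 : ℝ≥0∞).toReal -
      1 / (2 : ℝ≥0∞).toReal)) h (Or.inr (ENNReal.rpow_ne_top_of_nonneg (by norm_num)
        (measure_ne_top μ univ)))
    have h3 := ENNReal.Tendsto.const_mul (a := ENNReal.ofReal B) h2 (Or.inr ENNReal.ofReal_ne_top)
    simpa using h3
  refine tendsto_of_tendsto_of_tendsto_of_le_of_le tendsto_const_nhds h1
    (fun _ => zero_le) fun k => ?_
  refine (eLpNorm_le_mul_eLpNorm_of_ae_le_mul (g := g k - G) (c := B) (Eventually.of_forall fun x => ?_)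
    1).trans ?_
  · simp only [Pi.sub_apply, ← smul_sub, norm_smul]
    gcongr
    exact hB x
  · gcongr
    exact eLpNorm_le_eLpNorm_mul_rpow_measure_univ one_le_two ((hg k).sub hG).1

/-- By completeness the derivatives converge in `L²` to some `G`. Tested against a smooth compactly
supported `ψ`, integration by parts moves the derivative onto `ψ`, and the result tends to zero
because `F k` does. Hence `G = 0`. -/
theorem tendsto_eLpNorm_fderiv_zero {E : Type*} [NormedAddCommGroup E] [NormedSpace ℝ E]
    [FiniteDimensional ℝ E] [MeasurableSpace E] [BorelSpace E] (μ : Measure E)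
    [μ.IsAddHaarMeasure] {U : Set E} (hU : IsOpen U) (hUμ : μ U ≠ ⊤) {F : ℕ → E → ℝ}
    (hF : ∀ k, ContDiffOn ℝ 1 (F k) U) (hF2 : ∀ k, MemLp (F k) 2 (μ.restrict U))
    (hF' : ∀ k, MemLp (fderiv ℝ (F k)) 2 (μ.restrict U))
    (h0 : Tendsto (fun k => eLpNorm (F k) 2 (μ.restrict U)) atTop (𝓝 0))
    (hcau : Tendsto (fun p : ℕ × ℕ =>
      eLpNorm (fderiv ℝ (F p.1) - fderiv ℝ (F p.2)) 2 (μ.restrict U)) atTop (𝓝 0)) :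
    Tendsto (fun k => eLpNorm (fderiv ℝ (F k)) 2 (μ.restrict U)) atTop (𝓝 0) := by
  have : IsFiniteMeasure (μ.restrict U) := ⟨by simpa using hUμ.lt_top⟩
  let g : ℕ → Lp (E →L[ℝ] ℝ) 2 (μ.restrict U) := fun k => (hF' k).toLp
  have hgc : CauchySeq g := by
    rw [EMetric.cauchySeq_iff]
    intro ε hε
    have h1 := hcau.eventually_lt_const hε
    obtain ⟨N, hN⟩ := eventually_atTop_prod_self'.1 h1
    refine ⟨N, fun m hm k hk => ?_⟩
    rw [Lp.edist_toLp_toLp]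
    exact hN m hm k hk
  obtain ⟨G, hG⟩ := cauchySeq_tendsto_of_complete hgc
  have hGt : Tendsto (fun k => eLpNorm (fderiv ℝ (F k) - (G : E → E →L[ℝ] ℝ)) 2 (μ.restrict U)) atTop (𝓝 0) := by
    have h1 := (Lp.tendsto_Lp_iff_tendsto_eLpNorm' _ G).1 hG
    refine h1.congr fun k => eLpNorm_congr_ae ?_
    filter_upwards [(hF' k).coeFn_toLp] with x hx
    simp [g, hx]
  have hzero : ∀ᵐ x ∂μ, x ∈ U → G x = 0 := by
    refine hU.ae_eq_zero_of_integral_contDiff_smul_eq_zero ?_ fun ψ hψ hψc hψU => ?_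
    · exact IntegrableOn.locallyIntegrableOn ((Lp.memLp G).integrable one_le_two)
    have hψz : ∀ x ∉ U, ψ x = 0 := fun x hx => image_eq_zero_of_notMem_tsupport fun h => hx (hψU h)
    rw [← setIntegral_eq_integral_of_forall_compl_eq_zero (s := U) (fun x hx => by simp [hψz x hx])]
    obtain ⟨B, hB⟩ := hψ.continuous.bounded_above_of_compact_support hψc
    have hlim := tendsto_integral_smul_of_tendsto_eLpNorm hF' (Lp.memLp G) hGt
      hψ.continuous.aestronglyMeasurable hB
    have hψint : Integrable (fun x => ψ x • (G : E → E →L[ℝ] ℝ) x) (μ.restrict U) :=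
      ((Lp.memLp G).integrable one_le_two).bdd_smul B hψ.continuous.aestronglyMeasurable
        (Eventually.of_forall hB)
    ext v
    rw [ContinuousLinearMap.integral_apply hψint]
    simp only [zero_apply]
    have hlimv : Tendsto (fun k => (∫ x in U, ψ x • fderiv ℝ (F k) x ∂μ) v) atTop
        (𝓝 ((∫ x in U, ψ x • (G : E → E →L[ℝ] ℝ) x ∂μ) v)) :=
      ((ContinuousLinearMap.apply ℝ ℝ v).continuous.tendsto _).comp hlim
    rw [ContinuousLinearMap.integral_apply hψint] at hlimv
    have hψ' : Continuous fun x => fderiv ℝ ψ x v :=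
      (hψ.continuous_fderiv (by simp)).clm_apply continuous_const
    have hψ'c : HasCompactSupport fun x => fderiv ℝ ψ x v := hψc.fderiv_apply ℝ v
    have hψ'z : ∀ x ∉ U, fderiv ℝ ψ x v = 0 := fun x hx => by
      refine image_eq_zero_of_notMem_tsupport (f := fun x => fderiv ℝ ψ x v) fun h => hx (hψU ?_)
      exact tsupport_fderiv_apply_subset ℝ v h
    obtain ⟨B', hB'⟩ := hψ'.bounded_above_of_compact_support hψ'c
    have hlim2 := tendsto_integral_smul_of_tendsto_eLpNorm hF2 (G := 0) MemLp.zero (by simpa using h0)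
      hψ'.aestronglyMeasurable hB'
    have hibp : ∀ k, (∫ x in U, ψ x • fderiv ℝ (F k) x ∂μ) v =
        - ∫ x in U, fderiv ℝ ψ x v • F k x ∂μ := by
      intro k
      have hi1 : Integrable (fun x => ψ x • fderiv ℝ (F k) x) (μ.restrict U) :=
        ((hF' k).integrable one_le_two).bdd_smul B hψ.continuous.aestronglyMeasurable
          (Eventually.of_forall hB)
      have hi2 : Integrable (fun x => fderiv ℝ ψ x v * F k x) (μ.restrict U) :=
        ((hF2 k).integrable one_le_two).bdd_smul B' hψ'.aestronglyMeasurable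
          (Eventually.of_forall hB')
      have hi3 : Integrable (fun x => ψ x * F k x) (μ.restrict U) :=
        ((hF2 k).integrable one_le_two).bdd_smul B hψ.continuous.aestronglyMeasurable
          (Eventually.of_forall hB)
      rw [ContinuousLinearMap.integral_apply hi1]
      simp only [smul_eq_mul, FunLike.coe_smul, Pi.smul_apply]
      rw [setIntegral_eq_integral_of_forall_compl_eq_zero (fun x hx => by simp [hψz x hx]),
        setIntegral_eq_integral_of_forall_compl_eq_zero (fun x hx => by simp [hψ'z x hx])]
      refine integral_mul_fderiv_eq_neg_fderiv_mul_of_integrable ?_ ?_ ?_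
        (fun x _ => (hψ.differentiable (by simp)).differentiableAt) fun x hx =>
          ((hF k).differentiableOn one_ne_zero).differentiableAt (hU.mem_nhds (hψU hx))
      · exact IntegrableOn.integrable_of_forall_notMem_eq_zero (s := U) hi2
          fun x hx => by simp [hψ'z x hx]
      · exact IntegrableOn.integrable_of_forall_notMem_eq_zero (s := U)
          (hi1.apply_continuousLinearMap v) fun x hx => by simp [hψz x hx]
      · exact IntegrableOn.integrable_of_forall_notMem_eq_zero (s := U) hi3
          fun x hx => by simp [hψz x hx]
    simp only [hibp] at hlimv
    have := tendsto_nhds_unique hlimv (hlim2.neg)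
    simpa using this
  have hG0 : (G : E → E →L[ℝ] ℝ) =ᵐ[μ.restrict U] 0 := (ae_restrict_iff' hU.measurableSet).2 hzero
  refine hGt.congr fun k => eLpNorm_congr_ae ?_
  filter_upwards [hG0] with x hx
  simp [hx]

theorem eLpNorm_two_sq {α V : Type*} [MeasurableSpace α] [NormedAddCommGroup V] (f : α → V)
    (μ : Measure α) : eLpNorm f 2 μ ^ 2 = ∫⁻ x, ‖f x‖ₑ ^ 2 ∂μ := by
  rw [eLpNorm_eq_lintegral_rpow_enorm_toReal two_ne_zero ENNReal.ofNat_ne_top,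
    ← ENNReal.rpow_natCast, ← ENNReal.rpow_mul]
  simp

theorem tendsto_sq_zero_iff {ι : Type*} {l : Filter ι} {u : ι → ℝ≥0∞} :
    Tendsto (fun i => u i ^ 2) l (𝓝 0) ↔ Tendsto u l (𝓝 0) := by
  constructor
  · intro h
    have h1 := h.ennrpow_const (1 / 2 : ℝ)
    rw [ENNReal.zero_rpow_of_pos (by norm_num)] at h1
    refine h1.congr fun i => ?_
    rw [← ENNReal.rpow_natCast, ← ENNReal.rpow_mul]
    norm_num
  · intro h
    simpa using ENNReal.Tendsto.pow (n := 2) h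

/-! ### Rellich compactness and closability transferred to the manifold -/

section LocalEstimates
variable {n : ℕ} {X : Type*} [TopologicalSpace X] [ChartedSpace (EuclideanSpace ℝ (Fin n)) X]
  [IsManifold (𝓡 n) ∞ X] [RiemannianBundle (fun x : X => TangentSpace (𝓡 n) x)]
  [MeasurableSpace X] {ν : Measure X}
  {e : OpenPartialHomeomorph X (EuclideanSpace ℝ (Fin n))} {y : EuclideanSpace ℝ (Fin n)}
  {R : ℝ} {C : ℝ≥0}

theorem contDiffOn_comp_chart_symm (he : e ∈ atlas (EuclideanSpace ℝ (Fin n)) X) {f : X → ℝ}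
    (hf : ContMDiff (𝓡 n) 𝓘(ℝ, ℝ) 1 f) : ContDiffOn ℝ 1 (f ∘ e.symm) e.target := by
  have h1 : ContMDiffOn (𝓡 n) (𝓡 n) 1 e.symm e.target :=
    contMDiffOn_symm_of_mem_maximalAtlas (IsManifold.subset_maximalAtlas he)
  exact contMDiffOn_iff_contDiffOn.1 (hf.comp_contMDiffOn h1)

variable [IsContMDiffRiemannianBundle (𝓡 n) ∞ (EuclideanSpace ℝ (Fin n))
    (fun x : X => TangentSpace (𝓡 n) x)]

namespace IsComparisonBall
variable (hb : IsComparisonBall ν e y R C)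
include hb

theorem enorm_fderiv_le (f : X → ℝ) {z : EuclideanSpace ℝ (Fin n)} (hz : z ∈ Metric.ball y R) :
    ‖fderiv ℝ (f ∘ e.symm) z‖ₑ ≤ C * ‖grad n f (e.symm z)‖ₑ := by
  have h : ‖fderiv ℝ (f ∘ e.symm) z‖ ≤ C * ‖grad n f (e.symm z)‖ := by
    refine ContinuousLinearMap.opNorm_le_bound _ (by positivity) fun v => ?_
    have h1 := (grad_norm_le_iff hb.mem_atlas f (hb.ball_subset hz) (norm_nonneg _)).1 le_rfl v
    rw [Real.norm_eq_abs]
    refine h1.trans ?_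
    rw [mul_comm (C : ℝ), mul_assoc]
    gcongr
    exact hb.norm_coordVector_le z hz v
  rw [← ofReal_norm, ← ofReal_norm, ← ENNReal.ofReal_coe_nnreal, ← ENNReal.ofReal_mul C.coe_nonneg]
  exact ENNReal.ofReal_le_ofReal h

theorem enorm_grad_le (f : X → ℝ) {z : EuclideanSpace ℝ (Fin n)} (hz : z ∈ Metric.ball y R) :
    ‖grad n f (e.symm z)‖ₑ ≤ C * ‖fderiv ℝ (f ∘ e.symm) z‖ₑ := by
  have h : ‖grad n f (e.symm z)‖ ≤ C * ‖fderiv ℝ (f ∘ e.symm) z‖ := by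
    refine (grad_norm_le_iff hb.mem_atlas f (hb.ball_subset hz) (by positivity)).2 fun v => ?_
    rw [← Real.norm_eq_abs, mul_comm (C : ℝ), mul_assoc]
    refine (ContinuousLinearMap.le_opNorm _ v).trans ?_
    gcongr
    exact hb.le_norm_coordVector z hz v
  rw [← ofReal_norm, ← ofReal_norm, ← ENNReal.ofReal_coe_nnreal, ← ENNReal.ofReal_mul C.coe_nonneg]
  exact ENNReal.ofReal_le_ofReal h

variable [BorelSpace X]

theorem aemeasurable_symm {S : Set (EuclideanSpace ℝ (Fin n))} (hS : S ⊆ Metric.ball y R)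
    (hSm : MeasurableSet S) : AEMeasurable e.symm (volume.restrict S) :=
  aemeasurable_chart_symm hSm (hS.trans hb.ball_subset)

theorem lintegral_comp_symm_le {S : Set (EuclideanSpace ℝ (Fin n))} (hS : S ⊆ Metric.ball y R)
    (hSm : MeasurableSet S) {g : X → ℝ≥0∞} (hg : Measurable g) :
    ∫⁻ z in S, g (e.symm z) ≤ C * ∫⁻ x in e.symm '' S, g x ∂ν := by
  rw [← lintegral_map' hg.aemeasurable (hb.aemeasurable_symm hS hSm)]
  refine (lintegral_mono' (hb.map_le S hS hSm) le_rfl).trans_eq ?_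
  rw [lintegral_smul_measure]
  rfl

theorem lintegral_image_le {S : Set (EuclideanSpace ℝ (Fin n))} (hS : S ⊆ Metric.ball y R)
    (hSm : MeasurableSet S) {g : X → ℝ≥0∞} (hg : Measurable g) :
    ∫⁻ x in e.symm '' S, g x ∂ν ≤ C * ∫⁻ z in S, g (e.symm z) := by
  rw [← lintegral_map' hg.aemeasurable (hb.aemeasurable_symm hS hSm)]
  refine (lintegral_mono' (hb.le_map S hS hSm) le_rfl).trans_eq ?_
  rw [lintegral_smul_measure]
  rfl

variable [SecondCountableTopology X]

/-- Of the three factors `C`, two come from comparing squared norms and one from comparing measures.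
-/
theorem lintegral_fderiv_sq_le (f : X → ℝ) :
    ∫⁻ z in Metric.ball y R, ‖fderiv ℝ (f ∘ e.symm) z‖ₑ ^ 2 ≤
      (C : ℝ≥0∞) ^ 3 * ∫⁻ x in e.symm '' Metric.ball y R, ‖grad n f x‖ₑ ^ 2 ∂ν := by
  have hm : Measurable fun x => ‖grad n f x‖ₑ ^ 2 := by
    have := (measurable_norm_grad (n := n) f).ennreal_ofReal.pow_const 2
    simpa only [ofReal_norm] using this
  calc ∫⁻ z in Metric.ball y R, ‖fderiv ℝ (f ∘ e.symm) z‖ₑ ^ 2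
      ≤ ∫⁻ z in Metric.ball y R, (C : ℝ≥0∞) ^ 2 * ‖grad n f (e.symm z)‖ₑ ^ 2 := by
        refine setLIntegral_mono' measurableSet_ball fun z hz => ?_
        rw [← mul_pow]
        gcongr
        exact hb.enorm_fderiv_le f hz
    _ = (C : ℝ≥0∞) ^ 2 * ∫⁻ z in Metric.ball y R, ‖grad n f (e.symm z)‖ₑ ^ 2 :=
        lintegral_const_mul' _ _ (by simp)
    _ ≤ (C : ℝ≥0∞) ^ 2 * (C * ∫⁻ x in e.symm '' Metric.ball y R, ‖grad n f x‖ₑ ^ 2 ∂ν) := by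
        gcongr
        exact hb.lintegral_comp_symm_le Subset.rfl measurableSet_ball hm
    _ = _ := by ring

theorem lintegral_grad_sq_le (f : X → ℝ) :
    ∫⁻ x in e.symm '' Metric.ball y R, ‖grad n f x‖ₑ ^ 2 ∂ν ≤
      (C : ℝ≥0∞) ^ 3 * ∫⁻ z in Metric.ball y R, ‖fderiv ℝ (f ∘ e.symm) z‖ₑ ^ 2 := by
  have hm : Measurable fun x => ‖grad n f x‖ₑ ^ 2 := by
    have := (measurable_norm_grad (n := n) f).ennreal_ofReal.pow_const 2
    simpa only [ofReal_norm] using this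
  calc ∫⁻ x in e.symm '' Metric.ball y R, ‖grad n f x‖ₑ ^ 2 ∂ν
      ≤ C * ∫⁻ z in Metric.ball y R, ‖grad n f (e.symm z)‖ₑ ^ 2 :=
        hb.lintegral_image_le Subset.rfl measurableSet_ball hm
    _ ≤ C * ∫⁻ z in Metric.ball y R, (C : ℝ≥0∞) ^ 2 * ‖fderiv ℝ (f ∘ e.symm) z‖ₑ ^ 2 := by
        gcongr 1
        refine setLIntegral_mono' measurableSet_ball fun z hz => ?_
        rw [← mul_pow]
        gcongr
        exact hb.enorm_grad_le f hz
    _ = C * ((C : ℝ≥0∞) ^ 2 * ∫⁻ z in Metric.ball y R, ‖fderiv ℝ (f ∘ e.symm) z‖ₑ ^ 2) := by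
        rw [lintegral_const_mul' _ _ (by simp)]
    _ = _ := by ring

/-- Local Rellich compactness, for filters of functions which are weakly null. -/
theorem tendsto_lintegral_sq {r : ℝ} (hr : r < R) {l : Filter (X → ℝ)} {B : ℝ≥0∞} (hB : B ≠ ⊤)
    (hsm : ∀ᶠ f in l, ContMDiff (𝓡 n) 𝓘(ℝ, ℝ) 1 f)
    (hgrad : ∀ᶠ f in l, ∫⁻ x, ‖grad n f x‖ₑ ^ 2 ∂ν ≤ B)
    (hweak : ∀ (m : Measure X) (K : ℝ≥0), m ≤ K • ν →
      Tendsto (fun f : X → ℝ => ∫ x, f x ∂m) l (𝓝 0)) :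
    Tendsto (fun f : X → ℝ => ∫⁻ x in e.symm '' Metric.ball y r, ‖f x‖ₑ ^ 2 ∂ν) l (𝓝 0) := by
  rw [ENNReal.tendsto_nhds_zero]
  intro ε hε
  have hε2 : 0 < ε / 2 := ENNReal.half_pos hε.ne'
  -- The weight `η` of the gradient term absorbs the outer `C` from the change of measure and the `C
  -- ^ 3` from the change of gradient.
  obtain ⟨η, hη, hηε⟩ : ∃ η : ℝ≥0∞, 0 < η ∧ C * (η * ((C : ℝ≥0∞) ^ 3 * B)) ≤ ε / 2 := by
    have h1 : Tendsto (fun η : ℝ≥0∞ => C * (η * ((C : ℝ≥0∞) ^ 3 * B))) (𝓝[>] 0) (𝓝 0) := by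
      have h2 : Tendsto (fun η : ℝ≥0∞ => η) (𝓝[>] 0) (𝓝 0) := tendsto_nhdsWithin_of_tendsto_nhds tendsto_id
      have h3 := ENNReal.Tendsto.const_mul (a := C) (ENNReal.Tendsto.mul_const
        (b := (C : ℝ≥0∞) ^ 3 * B) h2 (Or.inr (ENNReal.mul_ne_top (by simp) hB)))
        (Or.inr ENNReal.coe_ne_top)
      simpa using h3
    obtain ⟨η, h3, h4⟩ := ((h1.eventually_le_const hε2).and self_mem_nhdsWithin).exists
    exact ⟨η, h4, h3⟩
  obtain ⟨t, δ, K, hK, htR, ht⟩ := exists_lintegral_sq_le_add_sum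
    (volume : Measure (EuclideanSpace ℝ (Fin n))) hr y hη
  have hlim : Tendsto (fun f : X → ℝ => C * (K * ∑ c ∈ t,
      ‖∫ x in Metric.ball c δ, (f ∘ e.symm) x‖ₑ ^ 2)) l (𝓝 0) := by
    have h1 : ∀ c ∈ t, Tendsto (fun f : X → ℝ => ‖∫ x in Metric.ball c δ, (f ∘ e.symm) x‖ₑ ^ 2)
        l (𝓝 0) := by
      intro c hc
      -- The average over a coordinate ball is an integral against a push-forward of Lebesgue
      -- measure. That measure is at most `C • ν`, so weak nullity applies to it.
      have h2 := hweak ((volume.restrict (Metric.ball c δ)).map e.symm) C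
        ((hb.map_le _ (htR c hc) measurableSet_ball).trans (by
          gcongr; exact Measure.restrict_le_self))
      rw [tendsto_sq_zero_iff, ← tendsto_zero_iff_enorm_tendsto_zero]
      refine h2.congr' ?_
      filter_upwards [hsm] with f hf
      exact integral_map (hb.aemeasurable_symm (htR c hc) measurableSet_ball)
        hf.continuous.measurable.aestronglyMeasurable
    have h3 := tendsto_finsetSum t h1
    have h4 := ENNReal.Tendsto.const_mul (a := C) (ENNReal.Tendsto.const_mul (a := K) h3
      (Or.inr hK)) (Or.inr ENNReal.coe_ne_top)
    simpa using h4
  filter_upwards [hsm, hgrad, hlim.eventually_le_const hε2] with f hf hfB hfl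
  have hF : ContDiffOn ℝ 1 (f ∘ e.symm) (Metric.ball y R) :=
    (contDiffOn_comp_chart_symm hb.mem_atlas hf).mono hb.ball_subset
  have hm : Measurable fun x => ‖f x‖ₑ ^ 2 := hf.continuous.measurable.enorm.pow_const 2
  calc ∫⁻ x in e.symm '' Metric.ball y r, ‖f x‖ₑ ^ 2 ∂ν
      ≤ C * ∫⁻ z in Metric.ball y r, ‖(f ∘ e.symm) z‖ₑ ^ 2 :=
        hb.lintegral_image_le (Metric.ball_subset_ball hr.le) measurableSet_ball hm
    _ ≤ C * (η * (∫⁻ z in Metric.ball y R, ‖fderiv ℝ (f ∘ e.symm) z‖ₑ ^ 2) +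
          K * ∑ c ∈ t, ‖∫ x in Metric.ball c δ, (f ∘ e.symm) x‖ₑ ^ 2) := by
        gcongr
        exact ht _ hF
    _ ≤ C * (η * ((C : ℝ≥0∞) ^ 3 * B) +
          K * ∑ c ∈ t, ‖∫ x in Metric.ball c δ, (f ∘ e.symm) x‖ₑ ^ 2) := by
        gcongr
        refine (hb.lintegral_fderiv_sq_le f).trans ?_
        gcongr
        exact (setLIntegral_le_lintegral _ _).trans hfB
    _ ≤ ε / 2 + ε / 2 := by
        rw [mul_add]
        exact add_le_add hηε hfl
    _ = ε := ENNReal.add_halves ε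

/-- Local closability of the Dirichlet form. -/
theorem tendsto_lintegral_grad_sq {f : ℕ → X → ℝ}
    (hsm : ∀ k, ContMDiff (𝓡 n) 𝓘(ℝ, ℝ) 1 (f k)) (hf2 : ∀ k, ∫⁻ x, ‖f k x‖ₑ ^ 2 ∂ν ≠ ⊤)
    (hgrad : ∀ k, ∫⁻ x, ‖grad n (f k) x‖ₑ ^ 2 ∂ν ≠ ⊤)
    (h0 : Tendsto (fun k => ∫⁻ x, ‖f k x‖ₑ ^ 2 ∂ν) atTop (𝓝 0))
    (hcau : Tendsto (fun p : ℕ × ℕ => ∫⁻ x, ‖grad n (f p.1 - f p.2) x‖ₑ ^ 2 ∂ν) atTop (𝓝 0)) :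
    Tendsto (fun k => ∫⁻ x in e.symm '' Metric.ball y R, ‖grad n (f k) x‖ₑ ^ 2 ∂ν) atTop
      (𝓝 0) := by
  set B := Metric.ball y R
  have hF : ∀ k, ContDiffOn ℝ 1 (f k ∘ e.symm) B := fun k =>
    (contDiffOn_comp_chart_symm hb.mem_atlas (hsm k)).mono hb.ball_subset
  have hle : ∀ k, ∫⁻ z in B, ‖(f k ∘ e.symm) z‖ₑ ^ 2 ≤ C * ∫⁻ x, ‖f k x‖ₑ ^ 2 ∂ν := fun k => by
    refine (hb.lintegral_comp_symm_le Subset.rfl measurableSet_ball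
      ((hsm k).continuous.measurable.enorm.pow_const 2)).trans ?_
    gcongr
    exact Measure.restrict_le_self
  have hle' : ∀ g : X → ℝ, ∫⁻ z in B, ‖fderiv ℝ (g ∘ e.symm) z‖ₑ ^ 2 ≤
      (C : ℝ≥0∞) ^ 3 * ∫⁻ x, ‖grad n g x‖ₑ ^ 2 ∂ν := fun g => by
    refine (hb.lintegral_fderiv_sq_le g).trans ?_
    gcongr
    exact Measure.restrict_le_self
  have hmul : ∀ {ι : Type} {l : Filter ι} {u v : ι → ℝ≥0∞} {K : ℝ≥0∞}, K ≠ ⊤ →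
      Tendsto v l (𝓝 0) → (∀ i, u i ≤ K * v i) → Tendsto u l (𝓝 0) := by
    intro ι l u v K hK hv huv
    have h1 := ENNReal.Tendsto.const_mul (a := K) hv (Or.inr hK)
    rw [mul_zero] at h1
    exact tendsto_of_tendsto_of_tendsto_of_le_of_le tendsto_const_nhds h1 (fun _ => zero_le) huv
  have hmem : ∀ {V : Type} [NormedAddCommGroup V] {g : EuclideanSpace ℝ (Fin n) → V},
      AEStronglyMeasurable g (volume.restrict B) → ∫⁻ z in B, ‖g z‖ₑ ^ 2 < ⊤ →
      MemLp g 2 (volume.restrict B) := by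
    intro V _ g hg hlt
    refine ⟨hg, ?_⟩
    rw [← eLpNorm_two_sq] at hlt
    exact (ENNReal.pow_lt_top_iff.1 hlt).resolve_right two_ne_zero
  have key := tendsto_eLpNorm_fderiv_zero (volume : Measure (EuclideanSpace ℝ (Fin n)))
    (U := B) Metric.isOpen_ball measure_ball_lt_top.ne hF
    (fun k => hmem ((hF k).continuousOn.aestronglyMeasurable measurableSet_ball)
      ((hle k).trans_lt (ENNReal.mul_lt_top ENNReal.coe_lt_top (hf2 k).lt_top)))
    (fun k => hmem (measurable_fderiv ℝ _).aestronglyMeasurable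
      ((hle' _).trans_lt (ENNReal.mul_lt_top (by simp) (hgrad k).lt_top))) ?_ ?_
  · rw [← tendsto_sq_zero_iff] at key
    simp only [eLpNorm_two_sq] at key
    exact hmul (by simp) key fun k => hb.lintegral_grad_sq_le (f k)
  · rw [← tendsto_sq_zero_iff]
    simp only [eLpNorm_two_sq]
    exact hmul ENNReal.coe_ne_top h0 hle
  · rw [← tendsto_sq_zero_iff]
    simp only [eLpNorm_two_sq]
    refine hmul (K := (C : ℝ≥0∞) ^ 3) (by simp) hcau fun p => ?_
    refine le_trans (le_of_eq ?_) (hle' _)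
    refine setLIntegral_congr_fun measurableSet_ball fun z hz => ?_
    have hd : ∀ k, DifferentiableAt ℝ (f k ∘ e.symm) z := fun k =>
      ((hF k).differentiableOn one_ne_zero).differentiableAt (Metric.isOpen_ball.mem_nhds hz)
    have : (f p.1 - f p.2) ∘ e.symm = f p.1 ∘ e.symm - f p.2 ∘ e.symm := rfl
    simp only [this, fderiv_sub (hd _) (hd _), Pi.sub_apply]

end IsComparisonBall

theorem IsComparisonBall.image_mem_nhds {x : X} {r : ℝ}
    (hb : IsComparisonBall ν (chartAt (EuclideanSpace ℝ (Fin n)) x)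
      (chartAt (EuclideanSpace ℝ (Fin n)) x x) R C) (hr : 0 < r) (hrR : r ≤ R) :
    (chartAt (EuclideanSpace ℝ (Fin n)) x).symm ''
      Metric.ball (chartAt (EuclideanSpace ℝ (Fin n)) x x) r ∈ 𝓝 x := by
  set e := chartAt (EuclideanSpace ℝ (Fin n)) x
  have h1 : IsOpen (e.symm '' Metric.ball (e x) r) :=
    e.symm.isOpen_image_of_subset_source Metric.isOpen_ball
      ((Metric.ball_subset_ball hrR).trans hb.ball_subset)
  exact h1.mem_nhds ⟨e x, Metric.mem_ball_self hr, e.left_inv (mem_chart_source _ x)⟩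

/-- Subadditivity over a finite subcover; this turns local limits into limits on compact sets. -/
theorem tendsto_lintegral_of_isCompact {ι : Type*} {l : Filter ι} {u : ι → X → ℝ≥0∞}
    {K : Set X} (hK : IsCompact K)
    (h : ∀ x ∈ K, ∃ U ∈ 𝓝 x, Tendsto (fun i => ∫⁻ x in U, u i x ∂ν) l (𝓝 0)) :
    Tendsto (fun i => ∫⁻ x in K, u i x ∂ν) l (𝓝 0) := by
  refine hK.induction_on (p := fun s => Tendsto (fun i => ∫⁻ x in s, u i x ∂ν) l (𝓝 0))
    (by simp [tendsto_const_nhds]) (fun s t hst ht => ?_) (fun s t hs ht => ?_) fun x hx => ?_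
  · exact tendsto_of_tendsto_of_tendsto_of_le_of_le tendsto_const_nhds ht (fun _ => zero_le)
      fun i => lintegral_mono_set hst
  · have := hs.add ht
    rw [add_zero] at this
    exact tendsto_of_tendsto_of_tendsto_of_le_of_le tendsto_const_nhds this (fun _ => zero_le)
      fun i => lintegral_union_le _ _ _
  · obtain ⟨U, hU, hUt⟩ := h x hx
    exact ⟨U, mem_nhdsWithin_of_mem_nhds hU, hUt⟩

end LocalEstimates

/-! ### Passage between `Ω` and `M` -/

section RegularPart
variable {n : ℕ} {M : Type*} [MetricSpace M] [MeasurableSpace M]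
  {Ω : Opens M} [ChartedSpace (EuclideanSpace ℝ (Fin n)) Ω]
  [RiemannianBundle (fun x : Ω => TangentSpace (𝓡 n) x)] {μ : Measure M}
  [BorelSpace M] [CompactSpace M] [IsManifold (𝓡 n) ∞ Ω]
  [IsContMDiffRiemannianBundle (𝓡 n) ∞ (EuclideanSpace ℝ (Fin n))
    (fun x : Ω => TangentSpace (𝓡 n) x)] [IsRiemannianManifold (𝓡 n) Ω]
  [IsFiniteMeasure μ] [IsWeightedRiemannianMeasure n Ω μ]

theorem measurableEmbedding_val : MeasurableEmbedding (Subtype.val : Ω → M) :=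
  MeasurableEmbedding.subtype_coe Ω.isOpen.measurableSet

instance isFiniteMeasure_comap_val : IsFiniteMeasure (μ.comap (Subtype.val : Ω → M)) :=
  ⟨by rw [measurableEmbedding_val.comap_apply]; exact measure_lt_top _ _⟩

/-- As a push-forward from `Ω`, the measure `μ` charges only `Ω`. Hence integrals over `M` may be
computed on `Ω`. -/
theorem map_comap_val (hμ : IsWeightedRiemannianMeasure n Ω μ) : (μ.comap (Subtype.val : Ω → M)).map Subtype.val = μ := by
  obtain ⟨V, h, -, -, -, -, hμ⟩ :=
    IsWeightedRiemannianMeasure.exists_density (n := n) (Ω := Ω) (μ := μ)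
  rw [hμ, measurableEmbedding_val.comap_map]

theorem lintegral_comap_val (hμ : IsWeightedRiemannianMeasure n Ω μ) (g : M → ℝ≥0∞) :
    ∫⁻ x : Ω, g x ∂(μ.comap Subtype.val) = ∫⁻ x, g x ∂μ := by
  conv_rhs => rw [← map_comap_val hμ]
  rw [measurableEmbedding_val.lintegral_map]

theorem eLpNorm_comap_val (hμ : IsWeightedRiemannianMeasure n Ω μ) (g : M → ℝ) (q : ℝ≥0∞) :
    eLpNorm (fun x : Ω => g x) q (μ.comap Subtype.val) = eLpNorm g q μ := by
  conv_rhs => rw [← map_comap_val hμ]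
  rw [measurableEmbedding_val.eLpNorm_map_measure]
  rfl

theorem exists_isComparisonBall (x : Ω) : ∃ R > 0, ∃ C : ℝ≥0,
    IsComparisonBall (μ.comap (Subtype.val : Ω → M)) (chartAt (EuclideanSpace ℝ (Fin n)) x)
      (chartAt (EuclideanSpace ℝ (Fin n)) x x) R C := by
  obtain ⟨V, h, hV, hc, hpos, -, hμ⟩ :=
    IsWeightedRiemannianMeasure.exists_density (n := n) (Ω := Ω) (μ := μ)
  rw [hμ, measurableEmbedding_val.comap_map]
  exact hV.exists_isComparisonBall (ρ := fun x : Ω => h x ^ 2)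
    ((hc.comp continuous_subtype_val).pow 2) (fun x => pow_pos (hpos x) 2) x

end RegularPart

/-! ### The Sobolev norm as an extended nonnegative integral -/

section SobolevNorm
variable {n : ℕ} {M : Type*} [MetricSpace M] [MeasurableSpace M]
  {Ω : Opens M} [ChartedSpace (EuclideanSpace ℝ (Fin n)) Ω]
  [RiemannianBundle (fun x : Ω => TangentSpace (𝓡 n) x)] {μ : Measure M}
  [BorelSpace M] [CompactSpace M] [IsManifold (𝓡 n) ∞ Ω]
  [IsContMDiffRiemannianBundle (𝓡 n) ∞ (EuclideanSpace ℝ (Fin n))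
    (fun x : Ω => TangentSpace (𝓡 n) x)] [IsRiemannianManifold (𝓡 n) Ω]
  [IsFiniteMeasure μ] [IsWeightedRiemannianMeasure n Ω μ]

theorem LipschitzSobolev.continuous (f : LipschitzSobolev n Ω μ) : Continuous (f : M → ℝ) := by
  obtain ⟨K, hK⟩ := f.2
  exact hK.continuous

theorem LipschitzSobolev.inner_def (f g : LipschitzSobolev n Ω μ) :
    inner ℝ f g = ∫ x, f x * g x ∂μ + dirichletForm n Ω μ f g := rfl

theorem LipschitzSobolev.norm_sq (f : LipschitzSobolev n Ω μ) :
    ‖f‖ ^ 2 = ∫ x, f x * f x ∂μ + dirichletForm n Ω μ f f := by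
  rw [← real_inner_self_eq_norm_sq, LipschitzSobolev.inner_def]

theorem LipschitzSobolev.memLp (f : LipschitzSobolev n Ω μ) (q : ℝ≥0∞) : MemLp f q μ := by
  obtain ⟨B, hB⟩ := isCompact_univ.exists_bound_of_continuousOn f.continuous.continuousOn
  exact MemLp.of_bound f.continuous.aestronglyMeasurable B
    (Eventually.of_forall fun x => hB x (mem_univ x))

theorem ofReal_dirichletForm {f : M → ℝ} (hf : f ∈ lipschitzFunctions M) :
    ENNReal.ofReal (dirichletForm n Ω μ f f) =
      ∫⁻ x : Ω, ‖regGrad n Ω f x‖ₑ ^ 2 ∂(μ.comap Subtype.val) := by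
  rw [dirichletForm, ofReal_integral_eq_lintegral_ofReal (integrable_inner_regGrad hf hf)
    (Eventually.of_forall fun x => real_inner_self_nonneg)]
  refine lintegral_congr fun x => ?_
  rw [real_inner_self_eq_norm_sq, ENNReal.ofReal_pow (norm_nonneg _), ofReal_norm]

theorem dirichletForm_self_nonneg (f : M → ℝ) : 0 ≤ dirichletForm n Ω μ f f :=
  integral_nonneg fun _ => real_inner_self_nonneg

theorem LipschitzSobolev.ofReal_integral_sq (f : LipschitzSobolev n Ω μ) :
    ENNReal.ofReal (∫ x, f x * f x ∂μ) = ∫⁻ x, ‖f x‖ₑ ^ 2 ∂μ := by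
  rw [ofReal_integral_eq_lintegral_ofReal (integrable_mul f.2 f.2)
    (Eventually.of_forall fun x => mul_self_nonneg _)]
  refine lintegral_congr fun x => ?_
  rw [← abs_mul_abs_self, ← pow_two, ENNReal.ofReal_pow (abs_nonneg _), ← Real.norm_eq_abs,
    ofReal_norm]

theorem LipschitzSobolev.enorm_sq (f : LipschitzSobolev n Ω μ) :
    ‖f‖ₑ ^ 2 = ∫⁻ x, ‖f x‖ₑ ^ 2 ∂μ +
      ∫⁻ x : Ω, ‖regGrad n Ω f x‖ₑ ^ 2 ∂(μ.comap Subtype.val) := by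
  rw [← LipschitzSobolev.ofReal_integral_sq, ← ofReal_dirichletForm f.2,
    ← ENNReal.ofReal_add (integral_nonneg fun x => mul_self_nonneg _)
      (dirichletForm_self_nonneg _), ← LipschitzSobolev.norm_sq,
    ENNReal.ofReal_pow (norm_nonneg _), ofReal_norm]

theorem LipschitzSobolev.eLpNorm_two_le (f : LipschitzSobolev n Ω μ) :
    eLpNorm f 2 μ ≤ ‖f‖ₑ := by
  have h : eLpNorm f 2 μ ^ 2 ≤ ‖f‖ₑ ^ 2 := by
    rw [eLpNorm_two_sq, f.enorm_sq]
    exact le_self_add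
  exact (ENNReal.pow_le_pow_left_iff two_ne_zero).1 h

theorem LipschitzSobolev.lintegral_regGrad_sq_le (f : LipschitzSobolev n Ω μ) :
    ∫⁻ x : Ω, ‖regGrad n Ω f x‖ₑ ^ 2 ∂(μ.comap Subtype.val) ≤ ‖f‖ₑ ^ 2 := by
  rw [f.enorm_sq]
  exact le_add_self

theorem SobolevInequality.exists_eLpNorm_le (hS : SobolevInequality n Ω μ) :
    ∃ S : ℝ≥0, ∀ f : LipschitzSobolev n Ω μ,
      eLpNorm f (ENNReal.ofReal (2 * n / (n - 2))) μ ≤ S * ‖f‖ₑ := by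
  obtain ⟨A, B, hA, hB, h⟩ := hS
  -- If `a` and `b` are the Dirichlet and `L²` parts of `‖f‖²`, then `A a + B b ≤ (A + B)(a + b)`.
  refine ⟨(√(A + B)).toNNReal, fun f => ?_⟩
  have h1 : eLpNorm f (ENNReal.ofReal (2 * n / (n - 2))) μ ^ 2 ≤
      ((√(A + B)).toNNReal * ‖f‖ₑ) ^ 2 := by
    refine (h f).trans ?_
    have h2 : (0 : ℝ) ≤ ∫ x, f x * f x ∂μ := integral_nonneg fun x => mul_self_nonneg _
    have h3 := dirichletForm_self_nonneg (n := n) (Ω := Ω) (μ := μ) f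
    have h4 : ((√(A + B)).toNNReal : ℝ≥0∞) = ENNReal.ofReal √(A + B) := rfl
    rw [mul_pow, h4, ← ofReal_norm, ← ENNReal.ofReal_pow (by positivity),
      ← ENNReal.ofReal_pow (by positivity), ← ENNReal.ofReal_mul (by positivity),
      Real.sq_sqrt (by positivity), f.norm_sq]
    refine ENNReal.ofReal_le_ofReal ?_
    simp only [pow_two] at h2 ⊢
    nlinarith [mul_nonneg hA.le h2, mul_nonneg hB.le h3]
  exact (ENNReal.pow_le_pow_left_iff two_ne_zero).1 h1

end SobolevNorm

/-! ### Interpolation between Lebesgue norms -/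

section Interpolation
variable {α : Type*} [MeasurableSpace α] {μ : Measure α}

/-- Hölder with weights `s = (p - q)/(p - 2)` and `t = (q - 2)/(p - 2)`, determined by `s + t = 1`
and `2 s + p t = q`. -/
theorem eLpNorm_le_rpow_mul_rpow {f : α → ℝ} (hf : AEStronglyMeasurable f μ) {p q : ℝ}
    (hq : 2 < q) (hqp : q < p) :
    eLpNorm f (ENNReal.ofReal q) μ ≤
      eLpNorm f 2 μ ^ (2 * ((p - q) / (p - 2)) / q) *
        eLpNorm f (ENNReal.ofReal p) μ ^ (p * ((q - 2) / (p - 2)) / q) := by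
  have hp2 : 0 < p - 2 := by linarith
  have hq0 : 0 < q := by linarith
  have hp0 : 0 < p := by linarith
  have hnorm : ∀ s : ℝ, 0 < s → eLpNorm f (ENNReal.ofReal s) μ =
      (∫⁻ x, ‖f x‖ₑ ^ s ∂μ) ^ (1 / s) := by
    intro s hs
    rw [eLpNorm_eq_lintegral_rpow_enorm_toReal (by simpa using hs) ENNReal.ofReal_ne_top,
      ENNReal.toReal_ofReal hs.le]
  have h2 : eLpNorm f 2 μ = (∫⁻ x, ‖f x‖ₑ ^ (2 : ℝ) ∂μ) ^ (1 / (2 : ℝ)) := by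
    rw [← hnorm 2 two_pos]; simp
  rw [h2, hnorm q hq0, hnorm p hp0, ← ENNReal.rpow_mul, ← ENNReal.rpow_mul]
  have hs : 0 ≤ (p - q) / (p - 2) := div_nonneg (by linarith) hp2.le
  have ht : 0 ≤ (q - 2) / (p - 2) := div_nonneg (by linarith) hp2.le
  have key := ENNReal.lintegral_mul_norm_pow_le (μ := μ) (f := fun x => ‖f x‖ₑ ^ (2 : ℝ))
    (g := fun x => ‖f x‖ₑ ^ p) (hf.enorm.pow_const _) (hf.enorm.pow_const _) hs ht
    (by field_simp; ring)
  have h3 : ∀ x, (‖f x‖ₑ ^ (2 : ℝ)) ^ ((p - q) / (p - 2)) * (‖f x‖ₑ ^ p) ^ ((q - 2) / (p - 2)) =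
      ‖f x‖ₑ ^ q := by
    intro x
    rw [← ENNReal.rpow_mul, ← ENNReal.rpow_mul, ← ENNReal.rpow_add_of_nonneg _ _
      (by positivity) (by positivity)]
    congr 1
    field_simp
    ring
  simp only [h3] at key
  refine (ENNReal.rpow_le_rpow key (by positivity : 0 ≤ 1 / q)).trans_eq ?_
  rw [ENNReal.mul_rpow_of_nonneg _ _ (by positivity), ← ENNReal.rpow_mul, ← ENNReal.rpow_mul]
  congr 2 <;> field_simp

theorem tendsto_eLpNorm_of_interpolation {ι : Type*} {l : Filter ι} {f : ι → α → ℝ}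
    (hf : ∀ i, AEStronglyMeasurable (f i) μ) {p q : ℝ} (hq : 2 ≤ q) (hqp : q < p) {B : ℝ≥0∞}
    (hB : B ≠ ⊤) (hfB : ∀ᶠ i in l, eLpNorm (f i) (ENNReal.ofReal p) μ ≤ B)
    (h : Tendsto (fun i => eLpNorm (f i) 2 μ) l (𝓝 0)) :
    Tendsto (fun i => eLpNorm (f i) (ENNReal.ofReal q) μ) l (𝓝 0) := by
  rcases hq.eq_or_lt with rfl | hq
  · simpa using h
  have ha : 0 < 2 * ((p - q) / (p - 2)) / q := by
    have h1 : 0 < p - q := by linarith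
    have h2 : 0 < p - 2 := by linarith
    have h3 : 0 < q := by linarith
    positivity
  have hb : 0 ≤ p * ((q - 2) / (p - 2)) / q := by
    have h1 : 0 < q - 2 := by linarith
    have h2 : 0 < p - 2 := by linarith
    have h3 : 0 < p := by linarith
    positivity
  have h1 := ENNReal.Tendsto.mul_const
    (b := B ^ (p * ((q - 2) / (p - 2)) / q)) (h.ennrpow_const (2 * ((p - q) / (p - 2)) / q))
    (Or.inr (ENNReal.rpow_ne_top_of_nonneg hb hB))
  rw [ENNReal.zero_rpow_of_pos ha, zero_mul] at h1
  refine tendsto_of_tendsto_of_tendsto_of_le_of_le' tendsto_const_nhds h1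
    (Eventually.of_forall fun _ => zero_le) ?_
  filter_upwards [hfB] with i hi
  refine (eLpNorm_le_rpow_mul_rpow (hf i) hq hqp).trans ?_
  gcongr

end Interpolation

/-- Total boundedness means that every ultrafilter on the image is Cauchy, and each of these is the
image of an ultrafilter containing `s`. Working upstairs gives access to the functions themselves
rather than to their classes in `L^q`. -/
theorem totallyBounded_image_of_forall_ultrafilter {α β : Type*} [PseudoMetricSpace β] {φ : α → β}
    {s : Set α} (h : ∀ 𝒱 : Ultrafilter α, s ∈ 𝒱 →
      Tendsto (fun p : α × α => dist (φ p.1) (φ p.2)) (𝒱 ×ˢ 𝒱 : Filter (α × α)) (𝓝 0)) :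
    TotallyBounded (φ '' s) := by
  rw [totallyBounded_iff_ultrafilter]
  intro 𝒰 h𝒰
  have hs : φ '' s ∈ 𝒰 := h𝒰 (mem_principal_self _)
  rw [← Ultrafilter.ofComapInfPrincipal_eq_of_map hs, Ultrafilter.coe_map, cauchy_map_iff]
  exact ⟨inferInstance, tendsto_uniformity_iff_dist_tendsto_zero.2
    (h _ (Ultrafilter.ofComapInfPrincipal_mem hs))⟩

/-! ### Compactness and injectivity of the Sobolev embedding -/

section Embedding
variable {n : ℕ} {M : Type*} [MetricSpace M] [MeasurableSpace M]
  {Ω : Opens M} [ChartedSpace (EuclideanSpace ℝ (Fin n)) Ω]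
  [RiemannianBundle (fun x : Ω => TangentSpace (𝓡 n) x)] {μ : Measure M}
  [BorelSpace M] [CompactSpace M] [IsManifold (𝓡 n) ∞ Ω]
  [IsContMDiffRiemannianBundle (𝓡 n) ∞ (EuclideanSpace ℝ (Fin n))
    (fun x : Ω => TangentSpace (𝓡 n) x)] [IsRiemannianManifold (𝓡 n) Ω]
  [IsFiniteMeasure μ] [IsWeightedRiemannianMeasure n Ω μ]

theorem IsTestFunction.sub {k : WithTop ℕ∞} {f g : M → ℝ} (hf : IsTestFunction n Ω k f)
    (hg : IsTestFunction n Ω k g) : IsTestFunction n Ω k (f - g) :=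
  ⟨hf.1.sub hg.1, (tsupport_sub f g).trans (union_subset hf.2 hg.2)⟩

theorem exists_sobolevEmbedding {q : ℝ≥0∞} [Fact (1 ≤ q)] {S : ℝ≥0}
    (hS : ∀ f : LipschitzSobolev n Ω μ, eLpNorm f q μ ≤ S * ‖f‖ₑ) :
    ∃ ι : SobolevSpace n Ω μ →L[ℝ] Lp ℝ q μ, ∀ f : LipschitzSobolev n Ω μ,
      (ι (f : SobolevSpace n Ω μ) : M → ℝ) =ᵐ[μ] f := by
  let L : LipschitzSobolev n Ω μ →ₗ[ℝ] Lp ℝ q μ :=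
    { toFun := fun f => (f.memLp q).toLp
      map_add' := fun f g => MemLp.toLp_add (f.memLp q) (g.memLp q)
      map_smul' := fun c f => MemLp.toLp_const_smul c (f.memLp q) }
  let e : LipschitzSobolev n Ω μ →ₗ[ℝ] SobolevSpace n Ω μ :=
    (UniformSpace.Completion.toComplL (𝕜 := ℝ) (E := LipschitzSobolev n Ω μ)).toLinearMap
  have hbd : ∀ f, ‖L f‖ ≤ S * ‖e f‖ := by
    intro f
    have h1 : ‖e f‖ = ‖f‖ := UniformSpace.Completion.norm_coe f
    rw [h1, ← ENNReal.ofReal_le_ofReal_iff (by positivity), ENNReal.ofReal_mul S.coe_nonneg,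
      ofReal_norm, ofReal_norm, ENNReal.ofReal_coe_nnreal]
    change ‖(f.memLp q).toLp‖ₑ ≤ _
    rw [Lp.enorm_toLp]
    exact hS f
  refine ⟨L.extendOfNorm e, fun f => ?_⟩
  have h2 : L.extendOfNorm e (e f) = L f :=
    LinearMap.extendOfNorm_eq UniformSpace.Completion.denseRange_coe ⟨S, hbd⟩ f
  change (L.extendOfNorm e (e f) : M → ℝ) =ᵐ[μ] f
  rw [h2]
  exact (f.memLp q).coeFn_toLp

theorem two_lt_sobolevExponent (hn : 3 ≤ n) : (2 : ℝ) < 2 * n / (n - 2) := by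
  have h3 : (3 : ℝ) ≤ n := by exact_mod_cast hn
  rw [lt_div_iff₀ (by linarith)]
  linarith

/-- The part of the `L²` norm away from a large compact subset of `Ω` is uniformly small. -/
theorem exists_isCompact_lintegral_compl_le (hn : 3 ≤ n) {S : ℝ≥0}
    (hS : ∀ f : LipschitzSobolev n Ω μ,
      eLpNorm f (ENNReal.ofReal (2 * n / (n - 2))) μ ≤ S * ‖f‖ₑ) (B : ℝ≥0) {ε : ℝ≥0∞}
    (hε : 0 < ε) : ∃ K : Set Ω, IsCompact K ∧ ∀ f : LipschitzSobolev n Ω μ, ‖f‖ₑ ≤ B →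
      ∫⁻ x in Kᶜ, ‖f x‖ₑ ^ 2 ∂(μ.comap (Subtype.val : Ω → M)) ≤ ε := by
  set ν := μ.comap (Subtype.val : Ω → M)
  set p := ENNReal.ofReal (2 * n / (n - 2))
  have hp2 := two_lt_sobolevExponent hn
  have h2p : 2 ≤ p := by
    rw [← ENNReal.ofReal_ofNat 2]
    exact ENNReal.ofReal_le_ofReal hp2.le
  -- Hölder on the complement of `K` gives `‖f‖_{L²} ≤ ‖f‖_{L^p} ν(Kᶜ)^θ ≤ S B ν(Kᶜ)^θ`. The gain
  -- comes from `θ > 0`, because the critical exponent exceeds `2`.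
  set θ := 1 / (2 : ℝ≥0∞).toReal - 1 / p.toReal
  have hθ : 0 < θ := by
    have : p.toReal = 2 * n / (n - 2) := ENNReal.toReal_ofReal (by linarith)
    simp only [θ, this, ENNReal.toReal_ofNat, sub_pos]
    exact one_div_lt_one_div_of_lt two_pos hp2
  obtain ⟨δ, hδ, hδε⟩ : ∃ δ : ℝ≥0∞, 0 < δ ∧ ∀ t < δ, (S * B * t ^ θ) ^ 2 ≤ ε := by
    have h1 : Tendsto (fun t : ℝ≥0∞ => (S * B * t ^ θ) ^ 2) (𝓝 0) (𝓝 0) := by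
      rw [tendsto_sq_zero_iff]
      have h2 : Tendsto (fun t : ℝ≥0∞ => t ^ θ) (𝓝 0) (𝓝 0) := by
        have := (tendsto_id (α := ℝ≥0∞) (x := 𝓝 0)).ennrpow_const θ
        rwa [ENNReal.zero_rpow_of_pos hθ] at this
      have h3 := ENNReal.Tendsto.const_mul (a := (S : ℝ≥0∞) * B) h2
        (Or.inr (ENNReal.mul_ne_top (by simp) (by simp)))
      rwa [mul_zero] at h3
    have h4 := h1.eventually_le_const hε
    obtain ⟨δ, hδ, h5⟩ := ENNReal.nhds_zero_basis.mem_iff.1 h4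
    exact ⟨δ, hδ, fun t ht => h5 ht⟩
  have : LocallyCompactSpace Ω := Ω.isOpen.locallyCompactSpace
  -- Inner regularity of the finite measure `ν` on the locally compact space `Ω`.
  obtain ⟨K, -, hK, hKδ⟩ := MeasurableSet.univ.exists_isCompact_sdiff_lt (μ := ν)
    (measure_ne_top ν univ) hδ.ne'
  refine ⟨K, hK, fun f hf => ?_⟩
  rw [← eLpNorm_two_sq (fun x : Ω => f x)]
  refine le_trans ?_ (hδε (ν Kᶜ) (by rwa [compl_eq_univ_sdiff]))
  gcongr
  have hm : AEStronglyMeasurable (fun x : Ω => f x) (ν.restrict Kᶜ) :=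
    (f.continuous.comp continuous_subtype_val).aestronglyMeasurable
  refine (eLpNorm_le_eLpNorm_mul_rpow_measure_univ h2p hm).trans ?_
  rw [Measure.restrict_apply_univ]
  gcongr
  refine (eLpNorm_mono_measure _ Measure.restrict_le_self).trans ?_
  rw [eLpNorm_comap_val ‹IsWeightedRiemannianMeasure n Ω μ›]
  refine (hS f).trans ?_
  gcongr

/-- Split at a compact `K ⊆ Ω`: local Rellich compactness controls `K`, and the uniform tail
estimate controls the complement. -/
theorem tendsto_eLpNorm_two_of_weaklyNull (hn : 3 ≤ n) {S : ℝ≥0}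
    (hS : ∀ f : LipschitzSobolev n Ω μ,
      eLpNorm f (ENNReal.ofReal (2 * n / (n - 2))) μ ≤ S * ‖f‖ₑ) {B : ℝ≥0}
    {l : Filter (LipschitzSobolev n Ω μ)} (htest : ∀ᶠ f : LipschitzSobolev n Ω μ in l, IsTestFunction n Ω 1 f)
    (hB : ∀ᶠ f in l, ‖f‖ₑ ≤ B)
    (hweak : ∀ (m : Measure M) (K : ℝ≥0), m ≤ K • μ →
      Tendsto (fun f : LipschitzSobolev n Ω μ => ∫ x, f x ∂m) l (𝓝 0)) :
    Tendsto (fun f : LipschitzSobolev n Ω μ => eLpNorm f 2 μ) l (𝓝 0) := by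
  rw [← tendsto_sq_zero_iff, ENNReal.tendsto_nhds_zero]
  intro ε hε
  have hε2 : 0 < ε / 2 := ENNReal.half_pos hε.ne'
  set ν := μ.comap (Subtype.val : Ω → M)
  obtain ⟨K, hK, hKε⟩ := exists_isCompact_lintegral_compl_le hn hS B hε2
  have hKlim : Tendsto (fun f : LipschitzSobolev n Ω μ => ∫⁻ x in K, ‖f x‖ₑ ^ 2 ∂ν) l (𝓝 0) := by
    refine tendsto_lintegral_of_isCompact (u := fun (f : LipschitzSobolev n Ω μ) (x : Ω) =>
      ‖f x‖ₑ ^ 2) hK fun x _ => ?_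
    obtain ⟨R, hR, C, hb⟩ := exists_isComparisonBall (n := n) (μ := μ) x
    refine ⟨_, hb.image_mem_nhds (half_pos hR) (half_le_self hR.le), ?_⟩
    let res : LipschitzSobolev n Ω μ → Ω → ℝ := fun f x => f x
    have := hb.tendsto_lintegral_sq (half_lt_self hR) (l := l.map res) (B := (B : ℝ≥0∞) ^ 2) (by simp)
      (eventually_map.2 (htest.mono fun f hf => hf.1))
      (eventually_map.2 (hB.mono fun f hf => ?_)) fun m K hm => ?_
    · exact tendsto_map'_iff.1 this
    · refine (f.lintegral_regGrad_sq_le).trans ?_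
      gcongr
    · rw [tendsto_map'_iff]
      have h1 : m.map Subtype.val ≤ K • μ := by
        refine (Measure.map_mono hm measurable_subtype_coe).trans_eq ?_
        rw [Measure.map_smul, map_comap_val ‹IsWeightedRiemannianMeasure n Ω μ›]
      refine (hweak _ K h1).congr fun f => ?_
      rw [measurableEmbedding_val.integral_map]
      rfl
  filter_upwards [hB, hKlim.eventually_le_const hε2] with f hf hfK
  rw [eLpNorm_two_sq, ← lintegral_comap_val ‹IsWeightedRiemannianMeasure n Ω μ›,
    ← lintegral_add_compl (fun x : Ω => ‖f x‖ₑ ^ 2) hK.measurableSet, ← ENNReal.add_halves ε]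
  exact add_le_add hfK (hKε f hf)

theorem exists_bound_integral (m : Measure M) {K : ℝ≥0} (hm : m ≤ K • μ) :
    ∃ D : ℝ, ∀ f : LipschitzSobolev n Ω μ, ‖∫ x, f x ∂m‖ ≤ D * ‖f‖ := by
  let D : ℝ≥0∞ := K * μ univ ^ (1 / (1 : ℝ≥0∞).toReal - 1 / (2 : ℝ≥0∞).toReal)
  have hD : D ≠ ⊤ := ENNReal.mul_ne_top ENNReal.coe_ne_top
    (ENNReal.rpow_ne_top_of_nonneg (by norm_num) (measure_ne_top μ univ))
  refine ⟨D.toReal, fun f => ?_⟩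
  have h1 : ‖∫ x, f x ∂m‖ₑ ≤ D * ‖f‖ₑ := by
    calc ‖∫ x, f x ∂m‖ₑ ≤ ∫⁻ x, ‖f x‖ₑ ∂m := enorm_integral_le_lintegral_enorm _
      _ ≤ ∫⁻ x, ‖f x‖ₑ ∂(K • μ) := lintegral_mono' hm le_rfl
      _ = K * eLpNorm f 1 μ := by
        rw [lintegral_smul_measure, eLpNorm_one_eq_lintegral_enorm]; rfl
      _ ≤ K * (eLpNorm f 2 μ * μ univ ^ (1 / (1 : ℝ≥0∞).toReal - 1 / (2 : ℝ≥0∞).toReal)) := by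
        gcongr
        exact eLpNorm_le_eLpNorm_mul_rpow_measure_univ one_le_two (f.memLp 2).1
      _ ≤ K * (‖f‖ₑ * μ univ ^ (1 / (1 : ℝ≥0∞).toReal - 1 / (2 : ℝ≥0∞).toReal)) := by
        gcongr
        exact f.eLpNorm_two_le
      _ = D * ‖f‖ₑ := by ring
  have h2 := ENNReal.toReal_mono (ENNReal.mul_ne_top hD enorm_ne_top) h1
  simpa using h2

/-- The functional `f ↦ ∫ f dm` maps the unit ball into a compact interval, so it has a limit along
`𝒱`. Differences along `𝒱 ×ˢ 𝒱` therefore tend to zero. -/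
theorem tendsto_integral_sub_ultrafilter {𝒱 : Ultrafilter (LipschitzSobolev n Ω μ)}
    (h𝒱 : {f : LipschitzSobolev n Ω μ | ‖f‖ₑ ≤ 1} ∈ 𝒱) (m : Measure M) {K : ℝ≥0}
    (hm : m ≤ K • μ) :
    Tendsto (fun p : LipschitzSobolev n Ω μ × LipschitzSobolev n Ω μ =>
      ∫ x, (p.1 - p.2 : LipschitzSobolev n Ω μ) x ∂m) (𝒱 ×ˢ 𝒱 : Filter _) (𝓝 0) := by
  obtain ⟨D, hD⟩ := exists_bound_integral (n := n) (Ω := Ω) m hm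
  have : IsFiniteMeasure m := ⟨(hm univ).trans_lt (by
    rw [Measure.smul_apply]; exact ENNReal.mul_lt_top (by simp) (measure_lt_top _ _))⟩
  have hint : ∀ f : LipschitzSobolev n Ω μ, Integrable f m := fun f =>
    f.continuous.integrable_of_hasCompactSupport (HasCompactSupport.of_compactSpace _)
  let I : LipschitzSobolev n Ω μ → ℝ := fun f => ∫ x, f x ∂m
  have hI : ∀ f g : LipschitzSobolev n Ω μ, I (f - g) = I f - I g := fun f g =>
    integral_sub (hint f) (hint g)
  obtain ⟨a, -, ha⟩ := (isCompact_closedBall (0 : ℝ) |D|).ultrafilter_le_nhds (𝒱.map I) (by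
    rw [le_principal_iff]
    refine mem_map.2 (mem_of_superset h𝒱 fun f hf => ?_)
    have hf1 : ‖f‖ ≤ 1 := by
      have := ENNReal.toReal_mono ENNReal.one_ne_top hf
      simpa using this
    rw [mem_preimage, mem_closedBall_zero_iff]
    refine (hD f).trans ?_
    calc D * ‖f‖ ≤ |D| * ‖f‖ := by gcongr; exact le_abs_self D
      _ ≤ |D| := mul_le_of_le_one_right (abs_nonneg D) hf1)
  have ha' : Tendsto I 𝒱 (𝓝 a) := ha
  have h1 : Tendsto (fun p : LipschitzSobolev n Ω μ × LipschitzSobolev n Ω μ => I p.1)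
      (𝒱 ×ˢ 𝒱 : Filter _) (𝓝 a) := ha'.comp tendsto_fst
  have h2 : Tendsto (fun p : LipschitzSobolev n Ω μ × LipschitzSobolev n Ω μ => I p.2)
      (𝒱 ×ˢ 𝒱 : Filter _) (𝓝 a) := ha'.comp tendsto_snd
  have h3 := h1.sub h2
  rw [sub_self] at h3
  exact h3.congr fun p => (hI p.1 p.2).symm

/-- Differences of unit-ball test functions are test functions of norm at most `2` and are weakly
null along `𝒱 ×ˢ 𝒱`. This gives the `L²` limit, which interpolation with the Sobolev bound raises to
exponent `q`. -/
theorem tendsto_eLpNorm_sub_ultrafilter (hn : 3 ≤ n) {S : ℝ≥0}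
    (hS : ∀ f : LipschitzSobolev n Ω μ,
      eLpNorm f (ENNReal.ofReal (2 * n / (n - 2))) μ ≤ S * ‖f‖ₑ)
    {q : ℝ} (hq : 2 ≤ q) (hq' : q < 2 * n / (n - 2))
    {𝒱 : Ultrafilter (LipschitzSobolev n Ω μ)}
    (h𝒱 : {f : LipschitzSobolev n Ω μ | IsTestFunction n Ω 1 f ∧ ‖f‖ₑ ≤ 1} ∈ 𝒱) :
    Tendsto (fun p : LipschitzSobolev n Ω μ × LipschitzSobolev n Ω μ =>
      eLpNorm (p.1 - p.2 : LipschitzSobolev n Ω μ) (ENNReal.ofReal q) μ)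
      (𝒱 ×ˢ 𝒱 : Filter _) (𝓝 0) := by
  let l : Filter (LipschitzSobolev n Ω μ) :=
    (𝒱 ×ˢ 𝒱 : Filter (LipschitzSobolev n Ω μ × LipschitzSobolev n Ω μ)).map fun p => p.1 - p.2
  have h1 : ∀ᶠ p in (𝒱 ×ˢ 𝒱 : Filter (LipschitzSobolev n Ω μ × LipschitzSobolev n Ω μ)),
      (IsTestFunction n Ω 1 p.1 ∧ ‖p.1‖ₑ ≤ 1) ∧ (IsTestFunction n Ω 1 p.2 ∧ ‖p.2‖ₑ ≤ 1) :=
    prod_mem_prod h𝒱 h𝒱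
  have htest : ∀ᶠ f : LipschitzSobolev n Ω μ in l, IsTestFunction n Ω 1 f :=
    eventually_map.2 (h1.mono fun p hp => hp.1.1.sub hp.2.1)
  have hB : ∀ᶠ f in l, ‖f‖ₑ ≤ (2 : ℝ≥0) := by
    refine eventually_map.2 (h1.mono fun p hp => ?_)
    refine (enorm_sub_le).trans ((add_le_add hp.1.2 hp.2.2).trans_eq ?_)
    norm_num
  have hlim : Tendsto (fun f : LipschitzSobolev n Ω μ => eLpNorm f 2 μ) l (𝓝 0) := by
    refine tendsto_eLpNorm_two_of_weaklyNull hn hS htest hB fun m K hm => ?_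
    exact tendsto_map'_iff.2
      (tendsto_integral_sub_ultrafilter (mem_of_superset h𝒱 fun f hf => hf.2) m hm)
  have hlim' : Tendsto (fun f : LipschitzSobolev n Ω μ => eLpNorm f (ENNReal.ofReal q) μ) l
      (𝓝 0) := by
    refine tendsto_eLpNorm_of_interpolation (fun f => (f.memLp 2).1) hq hq'
      (B := S * (2 : ℝ≥0)) (ENNReal.mul_ne_top (by simp) (by simp)) ?_ hlim
    filter_upwards [hB] with f hf
    refine (hS f).trans ?_
    gcongr
  exact tendsto_map'_iff.1 hlim'

/-- Test functions are dense in the open unit ball, so by continuity its image lies in the closure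
of their image, which is totally bounded and hence compact in the complete space `L^q`. -/
theorem isCompactOperator_sobolevEmbedding (hn : 3 ≤ n) (hM : IsAlmostSmooth n Ω μ) {S : ℝ≥0}
    (hS : ∀ f : LipschitzSobolev n Ω μ,
      eLpNorm f (ENNReal.ofReal (2 * n / (n - 2))) μ ≤ S * ‖f‖ₑ)
    {q : ℝ≥0∞} [Fact (1 ≤ q)] {q' : ℝ} (hqq' : q = ENNReal.ofReal q') (hq : 2 ≤ q')
    (hq' : q' < 2 * n / (n - 2)) {ι : SobolevSpace n Ω μ →L[ℝ] Lp ℝ q μ}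
    (hι : ∀ f : LipschitzSobolev n Ω μ, (ι (f : SobolevSpace n Ω μ) : M → ℝ) =ᵐ[μ] f) :
    IsCompactOperator ι := by
  let D : Set (SobolevSpace n Ω μ) := {w |
    ∃ f : LipschitzSobolev n Ω μ, IsTestFunction n Ω 1 f ∧ w = (f : SobolevSpace n Ω μ)}
  let s : Set (LipschitzSobolev n Ω μ) := {f | IsTestFunction n Ω 1 f ∧ ‖f‖ₑ ≤ 1}
  let φ : LipschitzSobolev n Ω μ → Lp ℝ q μ := fun f => ι (f : SobolevSpace n Ω μ)
  have hφ : ∀ f g : LipschitzSobolev n Ω μ,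
      (eLpNorm (f - g : LipschitzSobolev n Ω μ) q μ).toReal = dist (φ f) (φ g) := by
    intro f g
    have h4 : φ f - φ g = φ (f - g) := by
      simp only [φ, UniformSpace.Completion.coe_sub, map_sub]
    rw [dist_eq_norm, h4, Lp.norm_def, eLpNorm_congr_ae (hι (f - g))]
  have htb : TotallyBounded (φ '' s) := by
    refine totallyBounded_image_of_forall_ultrafilter fun 𝒱 h𝒱 => ?_
    have h3 := (ENNReal.tendsto_toReal ENNReal.zero_ne_top).comp
      (tendsto_eLpNorm_sub_ultrafilter hn hS hq hq' h𝒱)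
    rw [← hqq'] at h3
    exact h3.congr fun p => hφ p.1 p.2
  have hcpt : IsCompact (closure (φ '' s)) :=
    isCompact_iff_totallyBounded_isComplete.2 ⟨htb.closure, isClosed_closure.isComplete⟩
  refine (isCompactOperator_iff_isCompact_closure_image_ball
    (ι : SobolevSpace n Ω μ →ₗ[ℝ] Lp ℝ q μ) one_pos).2 ?_
  refine hcpt.of_isClosed_subset isClosed_closure (closure_minimal ?_ isClosed_closure)
  calc ι '' Metric.ball 0 1 ⊆ ι '' closure (Metric.ball 0 1 ∩ D) :=
        image_mono (hM.dense_test.open_subset_closure_inter Metric.isOpen_ball)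
    _ ⊆ closure (ι '' (Metric.ball 0 1 ∩ D)) := image_closure_subset_closure_image ι.continuous
    _ ⊆ closure (φ '' s) := by
        refine closure_mono ?_
        rintro _ ⟨_, ⟨hw, f, hf, rfl⟩, rfl⟩
        refine ⟨f, ⟨hf, ?_⟩, rfl⟩
        rw [mem_ball_zero_iff, UniformSpace.Completion.norm_coe] at hw
        rw [← ofReal_norm, ← ENNReal.ofReal_one]
        exact ENNReal.ofReal_le_ofReal hw.le

theorem regGrad_congr {f g : M → ℝ} {x : Ω} (h : f =ᶠ[𝓝 (x : M)] g) :
    regGrad n Ω f x = regGrad n Ω g x := by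
  have h1 : (fun y : Ω => f y) =ᶠ[𝓝 x] fun y : Ω => g y :=
    (continuous_subtype_val.tendsto x).eventually h
  have h2 : mvfderiv (𝓡 n) (fun y : Ω => f y) x = mvfderiv (𝓡 n) (fun y : Ω => g y) x := by
    ext v
    exact DFunLike.congr_fun (h1.mfderiv_eq (I := 𝓡 n) (I' := 𝓘(ℝ, ℝ))) v
  rw [regGrad, grad, h2]
  rfl

/-- An element of the kernel is a limit of test functions `f k` tending to zero in `L²`. Local
closability in charts kills the gradients on compact sets, and compact supports make this global, so
`f k` tends to zero in the Sobolev norm. -/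
theorem injective_sobolevEmbedding (hM : IsAlmostSmooth n Ω μ) {q : ℝ≥0∞} [Fact (1 ≤ q)]
    (hq : 2 ≤ q) {ι : SobolevSpace n Ω μ →L[ℝ] Lp ℝ q μ}
    (hι : ∀ f : LipschitzSobolev n Ω μ, (ι (f : SobolevSpace n Ω μ) : M → ℝ) =ᵐ[μ] f) :
    Function.Injective ι := by
  rw [injective_iff_map_eq_zero]
  intro w hw
  set ν := μ.comap (Subtype.val : Ω → M) with hν
  obtain ⟨u, hu, hulim⟩ := mem_closure_iff_seq_limit.1 (hM.dense_test w)
  choose f hf hfu using hu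
  obtain rfl : u = fun k => (f k : SobolevSpace n Ω μ) := funext hfu
  -- the functions tend to zero in `L²`
  have hL2 : Tendsto (fun k => eLpNorm (f k) 2 μ) atTop (𝓝 0) := by
    have h1 : Tendsto (fun k => ‖ι (f k : SobolevSpace n Ω μ)‖ₑ) atTop (𝓝 0) := by
      rw [← tendsto_zero_iff_enorm_tendsto_zero, ← hw]
      exact (ι.continuous.tendsto w).comp hulim
    have h2 := ENNReal.Tendsto.mul_const (b := μ univ ^ (1 / (2 : ℝ≥0∞).toReal - 1 / q.toReal)) h1
      (Or.inr (ENNReal.rpow_ne_top_of_nonneg (by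
        rcases eq_or_ne q ⊤ with rfl | hqt
        · simp
        · rw [sub_nonneg]
          exact one_div_le_one_div_of_le (by simp) (ENNReal.toReal_mono hqt hq))
        (measure_ne_top μ univ)))
    rw [zero_mul] at h2
    refine tendsto_of_tendsto_of_tendsto_of_le_of_le tendsto_const_nhds h2 (fun _ => zero_le)
      fun k => ?_
    refine (eLpNorm_le_eLpNorm_mul_rpow_measure_univ hq ((f k).memLp 2).1).trans_eq ?_
    rw [Lp.enorm_def, eLpNorm_congr_ae (hι (f k))]
  have hcau : Tendsto (fun p : ℕ × ℕ => ‖f p.1 - f p.2‖ₑ) atTop (𝓝 0) := by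
    have h1 : Tendsto (fun p : ℕ × ℕ => (f p.1 : SobolevSpace n Ω μ) - f p.2) atTop (𝓝 0) := by
      rw [← prod_atTop_atTop_eq, ← sub_self w]
      exact (hulim.comp tendsto_fst).sub (hulim.comp tendsto_snd)
    rw [tendsto_zero_iff_enorm_tendsto_zero] at h1
    refine h1.congr fun p => ?_
    rw [← UniformSpace.Completion.coe_sub, UniformSpace.Completion.enorm_coe]
  have hcau2 : Tendsto (fun p : ℕ × ℕ => ∫⁻ x : Ω, ‖regGrad n Ω (f p.1 - f p.2) x‖ₑ ^ 2 ∂ν)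
      atTop (𝓝 0) :=
    tendsto_of_tendsto_of_tendsto_of_le_of_le tendsto_const_nhds (tendsto_sq_zero_iff.2 hcau)
      (fun _ => zero_le) fun p => (f p.1 - f p.2).lintegral_regGrad_sq_le
  have hlocal : ∀ K : Set Ω, IsCompact K →
      Tendsto (fun k => ∫⁻ x in K, ‖regGrad n Ω (f k) x‖ₑ ^ 2 ∂ν) atTop (𝓝 0) := by
    intro K hK
    refine tendsto_lintegral_of_isCompact (u := fun k (x : Ω) => ‖regGrad n Ω (f k) x‖ₑ ^ 2)
      hK fun x _ => ?_
    obtain ⟨R, hR, C, hb⟩ := exists_isComparisonBall (n := n) (μ := μ) x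
    refine ⟨_, hb.image_mem_nhds hR le_rfl, ?_⟩
    have hsq : ∀ k, ∫⁻ x : Ω, ‖f k x‖ₑ ^ 2 ∂ν = eLpNorm (f k) 2 μ ^ 2 := fun k => by
      rw [eLpNorm_two_sq, hν, lintegral_comap_val ‹IsWeightedRiemannianMeasure n Ω μ› fun x => ‖f k x‖ₑ ^ 2]
    refine hb.tendsto_lintegral_grad_sq (f := fun k (x : Ω) => f k x) (fun k => (hf k).1)
      (fun k => ?_) (fun k => ?_) ?_ hcau2
    · rw [hsq]
      exact ENNReal.pow_ne_top ((f k).memLp 2).2.ne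
    · exact ((f k).lintegral_regGrad_sq_le.trans_lt (ENNReal.pow_lt_top enorm_lt_top)).ne
    · exact (tendsto_sq_zero_iff.2 hL2).congr fun k => (hsq k).symm
  have hgrad : Tendsto (fun k => ∫⁻ x : Ω, ‖regGrad n Ω (f k) x‖ₑ ^ 2 ∂ν) atTop (𝓝 0) := by
    rw [ENNReal.tendsto_nhds_zero]
    intro ε hε
    have hε2 : 0 < ε / 2 := ENNReal.half_pos hε.ne'
    obtain ⟨N, hN⟩ := eventually_atTop_prod_self'.1 (hcau2.eventually_le_const hε2)
    -- Off the support of `f N` the gradients of `f k` and `f k - f N` agree, and the latter is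
    -- small by the Cauchy property. On the compact support the local limit applies.
    let K : Set Ω := Subtype.val ⁻¹' tsupport (f N)
    have hK : IsCompact K :=
      Topology.IsInducing.subtypeVal.isCompact_preimage' (isClosed_tsupport _).isCompact
        (by simpa using (hf N).2)
    filter_upwards [(hlocal K hK).eventually_le_const hε2, eventually_ge_atTop N] with k hk hkN
    rw [← lintegral_add_compl _ hK.measurableSet, ← ENNReal.add_halves ε]
    refine add_le_add hk ?_
    refine le_trans ?_ (hN k hkN N le_rfl)
    refine le_trans (le_of_eq ?_) (setLIntegral_le_lintegral Kᶜ _)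
    refine setLIntegral_congr_fun hK.measurableSet.compl fun x hx => ?_
    have hx' : (x : M) ∉ tsupport (f N) := hx
    have h1 : (f k : M → ℝ) =ᶠ[𝓝 (x : M)] (f k - f N : M → ℝ) := by
      filter_upwards [(isClosed_tsupport (f N).1).isOpen_compl.mem_nhds hx'] with z hz
      rw [Pi.sub_apply, image_eq_zero_of_notMem_tsupport hz, sub_zero]
    have h3 : regGrad n Ω (f k) x = regGrad n Ω (f k - f N) x := regGrad_congr h1
    dsimp only
    rw [h3]
  have hnorm : Tendsto (fun k => ‖(f k : SobolevSpace n Ω μ)‖ₑ) atTop (𝓝 0) := by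
    rw [← tendsto_sq_zero_iff]
    have h1 := (tendsto_sq_zero_iff.2 hL2).add hgrad
    rw [add_zero] at h1
    refine h1.congr fun k => ?_
    rw [UniformSpace.Completion.enorm_coe, (f k).enorm_sq, eLpNorm_two_sq]
  exact tendsto_nhds_unique hulim (tendsto_zero_iff_enorm_tendsto_zero.2 hnorm)

end Embedding

/-! ### The compact embeddings below the critical exponent -/

section CompactEmbedding
variable {n : ℕ} {M : Type*} [MetricSpace M] [MeasurableSpace M]
  {Ω : Opens M} [ChartedSpace (EuclideanSpace ℝ (Fin n)) Ω]
  [RiemannianBundle (fun x : Ω => TangentSpace (𝓡 n) x)] {μ : Measure M}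
  [BorelSpace M] [CompactSpace M] [IsManifold (𝓡 n) ∞ Ω]
  [IsContMDiffRiemannianBundle (𝓡 n) ∞ (EuclideanSpace ℝ (Fin n))
    (fun x : Ω => TangentSpace (𝓡 n) x)] [IsRiemannianManifold (𝓡 n) Ω]
  [IsFiniteMeasure μ] [IsWeightedRiemannianMeasure n Ω μ]

theorem SobolevInequality.exists_eLpNorm_le_of_le (hS : SobolevInequality n Ω μ) {q : ℝ≥0∞}
    (hq : q ≤ ENNReal.ofReal (2 * n / (n - 2))) (hq0 : q ≠ 0) :
    ∃ S : ℝ≥0, ∀ f : LipschitzSobolev n Ω μ, eLpNorm f q μ ≤ S * ‖f‖ₑ := by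
  obtain ⟨S, hS⟩ := hS.exists_eLpNorm_le
  set p := ENNReal.ofReal (2 * n / (n - 2))
  have hp0 : 0 < q.toReal := ENNReal.toReal_pos hq0 (hq.trans_lt ENNReal.ofReal_lt_top).ne
  have hexp : 0 ≤ 1 / q.toReal - 1 / p.toReal :=
    sub_nonneg.2 (one_div_le_one_div_of_le hp0 (ENNReal.toReal_mono ENNReal.ofReal_ne_top hq))
  have htop : μ univ ^ (1 / q.toReal - 1 / p.toReal) ≠ ⊤ :=
    ENNReal.rpow_ne_top_of_nonneg hexp (measure_ne_top μ univ)
  refine ⟨S * (μ univ ^ (1 / q.toReal - 1 / p.toReal)).toNNReal, fun f => ?_⟩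
  rw [ENNReal.coe_mul, ENNReal.coe_toNNReal htop, mul_right_comm]
  refine (eLpNorm_le_eLpNorm_mul_rpow_measure_univ hq f.continuous.aestronglyMeasurable).trans ?_
  gcongr
  exact hS f

theorem compactlyEmbeds (hn : 3 ≤ n) (hM : IsAlmostSmooth n Ω μ)
    (hS : SobolevInequality n Ω μ) {q : ℝ} (hq : 2 ≤ q) (hq' : q < 2 * n / (n - 2)) :
    CompactlyEmbeds n Ω μ (ENNReal.ofReal q) := by
  have h2q : 2 ≤ ENNReal.ofReal q := by
    rw [← ENNReal.ofReal_ofNat 2]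
    exact ENNReal.ofReal_le_ofReal hq
  have : Fact (1 ≤ ENNReal.ofReal q) := ⟨one_le_two.trans h2q⟩
  obtain ⟨S, hSp⟩ := hS.exists_eLpNorm_le
  obtain ⟨S', hSq⟩ := hS.exists_eLpNorm_le_of_le (ENNReal.ofReal_le_ofReal hq'.le)
    (two_pos.trans_le h2q).ne'
  obtain ⟨ι, hι⟩ := exists_sobolevEmbedding hSq
  exact ⟨this, ι, hι, injective_sobolevEmbedding hM h2q hι,
    isCompactOperator_sobolevEmbedding hn hM hSp rfl hq hq' hι⟩

theorem compactlyEmbeds_of_lt (hn : 3 ≤ n) (hM : IsAlmostSmooth n Ω μ)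
    (hS : SobolevInequality n Ω μ) {p : ℝ} (hp : n < p) :
    CompactlyEmbeds n Ω μ (ENNReal.ofReal (2 * p / (p - 2))) := by
  have h3 : (3 : ℝ) ≤ n := by exact_mod_cast hn
  have hp2 : 0 < p - 2 := by linarith
  -- The map `p ↦ 2p/(p-2)` decreases on `p > 2`, with values above `2`.
  refine compactlyEmbeds hn hM hS ?_ ?_
  · rw [le_div_iff₀ hp2]
    linarith
  · rw [div_lt_div_iff₀ hp2 (by linarith)]
    nlinarith

end CompactEmbedding

/-! ### A bounded gradient implies the Lipschitz property -/

section GradientBound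
variable {n : ℕ} {X : Type*} [PseudoMetricSpace X] [ChartedSpace (EuclideanSpace ℝ (Fin n)) X]
  [RiemannianBundle (fun x : X => TangentSpace (𝓡 n) x)] [IsRiemannianManifold (𝓡 n) X]

theorem enorm_mvfderiv_le (f : X → ℝ) (x : X) (v : TangentSpace (𝓡 n) x) :
    ‖mvfderiv (𝓡 n) f x v‖ₑ ≤ ‖grad n f x‖ₑ * ‖v‖ₑ := by
  have h1 : ‖grad n f x‖ = ‖mvfderiv (𝓡 n) f x‖ := by rw [grad, LinearIsometryEquiv.norm_map]
  have h2 : ‖mvfderiv (𝓡 n) f x v‖ ≤ ‖grad n f x‖ * ‖v‖ := by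
    rw [h1]
    exact ContinuousLinearMap.le_opNorm _ v
  rw [← ofReal_norm, ← ofReal_norm, ← ofReal_norm, ← ENNReal.ofReal_mul (norm_nonneg _)]
  exact ENNReal.ofReal_le_ofReal h2

/-- Integrate the derivative of `f` along curves whose length approaches the Riemannian distance,
which is the infimum of such lengths. -/
theorem lipschitzWith_of_enorm_grad_le {f : X → ℝ} (hf : ContMDiff (𝓡 n) 𝓘(ℝ, ℝ) 1 f) {C : ℝ≥0}
    (hC : ∀ x, ‖grad n f x‖ₑ ≤ C) : LipschitzWith C f := by
  intro x y
  have key : ∀ r > edist x y, edist (f x) (f y) ≤ C * r := by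
    intro r hr
    rw [IsRiemannianManifold.out (I := 𝓡 n) x y] at hr
    obtain ⟨γ, rfl, rfl, hγ, hlen⟩ := Manifold.exists_lt_of_riemannianEDist_lt hr
    rw [Manifold.pathELength_eq_lintegral_mfderiv_Ioo] at hlen
    have hfγ : ContDiffOn ℝ 1 (f ∘ γ) (Icc 0 1) :=
      contMDiffOn_iff_contDiffOn.1 (hf.comp_contMDiffOn hγ)
    rw [edist_comm, edist_eq_enorm_sub]
    refine (enorm_sub_le_lintegral_deriv_of_contDiffOn_Icc hfγ zero_le_one).trans ?_
    rw [← restrict_Ioo_eq_restrict_Icc]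
    refine le_trans ?_ (mul_le_mul_right hlen.le C)
    rw [← lintegral_const_mul' _ _ ENNReal.coe_ne_top]
    refine setLIntegral_mono' measurableSet_Ioo fun t ht => ?_
    have h1 : MDifferentiableAt 𝓘(ℝ, ℝ) (𝓡 n) γ t :=
      (hγ.contMDiffAt (Icc_mem_nhds ht.1 ht.2)).mdifferentiableAt one_ne_zero
    have h2 : deriv (f ∘ γ) t = mvfderiv (𝓡 n) f (γ t) (mfderiv 𝓘(ℝ, ℝ) (𝓡 n) γ t 1) := by
      rw [← mvfderiv_comp_apply t (hf.mdifferentiableAt one_ne_zero) h1, ← fderiv_apply_one_eq_deriv,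
        ← mfderiv_eq_fderiv]
      rfl
    rw [h2]
    refine (enorm_mvfderiv_le f _ _).trans ?_
    gcongr
    exact hC _
  have hlim : Tendsto (fun r : ℝ≥0∞ => C * r) (𝓝[>] (edist x y)) (𝓝 (C * edist x y)) :=
    (ENNReal.Tendsto.const_mul tendsto_id (Or.inr ENNReal.coe_ne_top)).mono_left nhdsWithin_le_nhds
  -- The distance is finite, so it can be approached from above.
  have : (𝓝[>] (edist x y)).NeBot := nhdsGT_neBot_of_exists_gt ⟨⊤, edist_lt_top x y⟩
  exact ge_of_tendsto hlim (eventually_mem_nhdsWithin.mono key)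

end GradientBound
-- Test functions are Lipschitz on `M`
section TestFunctions
variable {n : ℕ} {M : Type*} [MetricSpace M] [MeasurableSpace M]
  {Ω : Opens M} [ChartedSpace (EuclideanSpace ℝ (Fin n)) Ω]
  [RiemannianBundle (fun x : Ω => TangentSpace (𝓡 n) x)] {μ : Measure M}
  [BorelSpace M] [CompactSpace M] [IsManifold (𝓡 n) ∞ Ω]
  [IsContMDiffRiemannianBundle (𝓡 n) ∞ (EuclideanSpace ℝ (Fin n))
    (fun x : Ω => TangentSpace (𝓡 n) x)] [IsRiemannianManifold (𝓡 n) Ω]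
  [IsFiniteMeasure μ] [IsWeightedRiemannianMeasure n Ω μ]

/-- Off its compact support the gradient vanishes. Near each point of the support, continuity of the
chart derivative and the chart comparison bound it, and compactness makes the bound uniform. -/
theorem IsTestFunction.exists_enorm_regGrad_le {f : M → ℝ} (hf : IsTestFunction n Ω 1 f)
    (hμ : IsWeightedRiemannianMeasure n Ω μ) :
    ∃ C : ℝ≥0, ∀ x : Ω, ‖regGrad n Ω f x‖ₑ ≤ C := by
  let K : Set Ω := Subtype.val ⁻¹' tsupport f
  have hK : IsCompact K :=
    Topology.IsInducing.subtypeVal.isCompact_preimage' (isClosed_tsupport _).isCompact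
      (by simpa using hf.2)
  obtain ⟨C, hC⟩ : ∃ C : ℝ≥0, ∀ x ∈ K, ‖regGrad n Ω f x‖ₑ ≤ C := by
    refine hK.induction_on (p := fun s => ∃ C : ℝ≥0, ∀ x ∈ s, ‖regGrad n Ω f x‖ₑ ≤ C)
      ⟨0, by simp⟩ (fun s t hst ⟨C, h⟩ => ⟨C, fun x hx => h x (hst hx)⟩)
      (fun s t ⟨C, hs⟩ ⟨D, ht⟩ => ⟨max C D, fun x hx => ?_⟩) fun x _ => ?_
    · rcases hx with hx | hx
      · exact (hs x hx).trans (by exact_mod_cast le_max_left C D)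
      · exact (ht x hx).trans (by exact_mod_cast le_max_right C D)
    · obtain ⟨R, hR, C, hb⟩ := exists_isComparisonBall (n := n) (μ := μ) x
      set e := chartAt (EuclideanSpace ℝ (Fin n)) x
      have hd : ContinuousOn (fderiv ℝ ((fun y : Ω => f y) ∘ e.symm)) e.target :=
        (contDiffOn_comp_chart_symm hb.mem_atlas hf.1).continuousOn_fderiv_of_isOpen e.open_target
          le_rfl
      have hx : e x ∈ e.target := e.map_source (mem_chart_source _ x)
      have h1 := (hd.continuousAt (e.open_target.mem_nhds hx)).norm.eventually_lt_const
        (lt_add_one _)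
      obtain ⟨r, hr, hball⟩ := Metric.eventually_nhds_iff_ball.1 h1
      refine ⟨_, mem_nhdsWithin_of_mem_nhds
        (hb.image_mem_nhds (lt_min hR hr) (min_le_left R r)),
        C * (‖fderiv ℝ ((fun y : Ω => f y) ∘ e.symm) (e x)‖₊ + 1), ?_⟩
      rintro _ ⟨z, hz, rfl⟩
      refine (hb.enorm_grad_le _ (Metric.ball_subset_ball (min_le_left R r) hz)).trans ?_
      rw [ENNReal.coe_mul]
      gcongr
      have := (hball z (Metric.ball_subset_ball (min_le_right R r) hz)).le
      rw [enorm_eq_nnnorm]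
      exact_mod_cast this
  refine ⟨C, fun x => ?_⟩
  by_cases hx : x ∈ K
  · exact hC x hx
  · have h1 : f =ᶠ[𝓝 (x : M)] fun _ => 0 := notMem_tsupport_iff_eventuallyEq.1 hx
    rw [regGrad_congr h1, regGrad, grad, mvfderiv_const]
    simp

theorem IsTestFunction.continuous {k : WithTop ℕ∞} {f : M → ℝ} (hf : IsTestFunction n Ω k f) :
    Continuous f := by
  refine continuous_iff_continuousAt.2 fun x => ?_
  by_cases hx : x ∈ tsupport f
  · exact (Ω.isOpen.isOpenEmbedding_subtypeVal.continuousAt_iff (x := ⟨x, hf.2 hx⟩)).1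
      hf.1.continuous.continuousAt
  · exact continuousAt_const.congr (notMem_tsupport_iff_eventuallyEq.1 hx).symm

/-- The gradient bound gives a Lipschitz bound on `Ω` for the distance of `M`, and density with
continuity extends it to `M`. Thus the core of the Friedrichs form embeds in `W^{1,2}(M)`. -/
theorem IsTestFunction.mem_lipschitzFunctions {f : M → ℝ} (hf : IsTestFunction n Ω 1 f)
    (hμ : IsWeightedRiemannianMeasure n Ω μ) (hΩ : Dense (Ω : Set M)) :
    f ∈ lipschitzFunctions M := by
  obtain ⟨C, hC⟩ := hf.exists_enorm_regGrad_le hμ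
  have h1 : LipschitzWith C fun x : Ω => f x := lipschitzWith_of_enorm_grad_le hf.1 hC
  refine ⟨C, ?_⟩
  have h2 : LipschitzOnWith C f Ω := fun x hx y hy => h1 ⟨x, hx⟩ ⟨y, hy⟩
  have h3 := h2.closure hf.continuous.continuousOn
  rwa [hΩ.closure_eq, lipschitzOnWith_univ] at h3

end TestFunctions

/-! ### The operator `j j*` -/

section AdjointFactorization
open ContinuousLinearMap
variable {V H : Type*} [NormedAddCommGroup V] [InnerProductSpace ℝ V] [CompleteSpace V]
  [NormedAddCommGroup H] [InnerProductSpace ℝ H] [CompleteSpace H] {j : V →L[ℝ] H}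

/-- If `j j* x = 0` then `‖j* x‖² = ⟨x, j j* x⟩ = 0`, so `x` is orthogonal to the dense range of
`j`. -/
theorem injective_comp_adjoint (hj : DenseRange j) : Function.Injective (j ∘L adjoint j) := by
  rw [injective_iff_map_eq_zero]
  intro x hx
  have h1 : adjoint j x = 0 := by
    rw [← inner_self_eq_zero (𝕜 := ℝ), adjoint_inner_left]
    have hx' : j (adjoint j x) = 0 := hx
    rw [hx', inner_zero_right]
  refine hj.eq_zero_of_inner_left (𝕜 := ℝ) fun v => ?_
  rw [← adjoint_inner_left, h1, inner_zero_left]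

theorem isSymmetric_comp_adjoint : ((j ∘L adjoint j : H →L[ℝ] H) : H →ₗ[ℝ] H).IsSymmetric := by
  intro x y
  change inner ℝ (j (adjoint j x)) y = inner ℝ x (j (adjoint j y))
  rw [← adjoint_inner_right, adjoint_inner_left]

/-- Weak formulation: `j* x` is the Riesz representative in `V` of the functional `v ↦ ⟨x, j v⟩`. -/
theorem comp_adjoint_eq_iff {x y : H} : (j ∘L adjoint j) x = y ↔
    ∃ u : V, j u = y ∧ ∀ v, inner ℝ u v = inner ℝ x (j v) := by
  constructor
  · rintro rfl
    exact ⟨adjoint j x, rfl, fun v => adjoint_inner_left j v x⟩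
  · rintro ⟨u, rfl, h⟩
    have : u = adjoint j x := ext_inner_right ℝ fun v => by rw [h, adjoint_inner_left]
    rw [this]
    rfl

end AdjointFactorization

/-! ### The Friedrichs extension -/

section FormDomain
variable {n : ℕ} {M : Type*} [MetricSpace M] [MeasurableSpace M]
  {Ω : Opens M} [ChartedSpace (EuclideanSpace ℝ (Fin n)) Ω]
  [RiemannianBundle (fun x : Ω => TangentSpace (𝓡 n) x)] {μ : Measure M}
  [BorelSpace M] [CompactSpace M] [IsManifold (𝓡 n) ∞ Ω]
  [IsContMDiffRiemannianBundle (𝓡 n) ∞ (EuclideanSpace ℝ (Fin n))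
    (fun x : Ω => TangentSpace (𝓡 n) x)] [IsRiemannianManifold (𝓡 n) Ω]
  [IsFiniteMeasure μ] [IsWeightedRiemannianMeasure n Ω μ]

/-- The fundamental lemma of the calculus of variations on the manifold `Ω`: smooth compactly
supported functions there extend by zero to test functions on `M`, and `μ` lives on `Ω`. -/
theorem ae_eq_zero_of_integral_mul_testFunction_eq_zero (hμ : IsWeightedRiemannianMeasure n Ω μ)
    {g : M → ℝ} (hg : Integrable g μ)
    (h : ∀ φ : M → ℝ, IsTestFunction n Ω ∞ φ → ∫ x, g x * φ x ∂μ = 0) : g =ᵐ[μ] 0 := by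
  have : LocallyCompactSpace Ω := Ω.isOpen.locallyCompactSpace
  have hint : Integrable (fun x : Ω => g x) (μ.comap Subtype.val) := by
    rw [← map_comap_val hμ] at hg
    exact measurableEmbedding_val.integrable_map_iff.1 hg
  have h0 := ae_eq_zero_of_integral_contMDiff_smul_eq_zero (𝓡 n) hint.locallyIntegrable
    fun ψ hψ hψc => by
      let φ : M → ℝ := Function.extend Subtype.val ψ 0
      have hφ : ∀ x : Ω, φ x = ψ x := Subtype.val_injective.extend_apply ψ 0
      have hφt : IsTestFunction n Ω ∞ φ := by
        refine ⟨by simpa only [hφ] using hψ, ?_⟩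
        refine (hψc.tsupport_extend_zero_subset continuous_subtype_val).trans ?_
        rintro _ ⟨x, -, rfl⟩
        exact x.2
      have h1 := h φ hφt
      rw [← map_comap_val hμ, measurableEmbedding_val.integral_map] at h1
      simpa only [hφ, smul_eq_mul, mul_comm] using h1
  rw [← map_comap_val hμ]
  exact measurableEmbedding_val.ae_map_iff.2 h0

variable (n Ω μ) in
/-- `C^∞_0(Ω)` as a subspace of `W^{1,2}(M)`. -/
def testSubmodule : Submodule ℝ (SobolevSpace n Ω μ) where
  carrier := {w | ∃ f : LipschitzSobolev n Ω μ, IsTestFunction n Ω ∞ f ∧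
    w = (f : SobolevSpace n Ω μ)}
  add_mem' := by
    rintro _ _ ⟨f, hf, rfl⟩ ⟨g, hg, rfl⟩
    exact ⟨f + g, ⟨hf.1.add hg.1, (tsupport_add f.1 g.1).trans (union_subset hf.2 hg.2)⟩,
      (UniformSpace.Completion.coe_add f g).symm⟩
  zero_mem' := by
    refine ⟨0, ⟨contMDiff_const, ?_⟩, UniformSpace.Completion.coe_zero.symm⟩
    change tsupport (0 : M → ℝ) ⊆ _
    rw [tsupport_zero]
    exact empty_subset _
  smul_mem' := by
    rintro c _ ⟨f, hf, rfl⟩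
    exact ⟨c • f, ⟨(contMDiff_const (I := 𝓡 n) (I' := 𝓘(ℝ, ℝ)) (c := c)).smul hf.1, (tsupport_smul_subset_right (fun _ => c) f.1).trans hf.2⟩,
      (UniformSpace.Completion.coe_smul c f).symm⟩

variable (n Ω μ) in
/-- The domain of the closure of the Dirichlet form on `C^∞_0(Ω)`. -/
noncomputable abbrev formDomain : Submodule ℝ (SobolevSpace n Ω μ) := (testSubmodule n Ω μ).topologicalClosure

variable {ι : SobolevSpace n Ω μ →L[ℝ] Lp ℝ 2 μ}

theorem inner_sobolev_coe
    (hι : ∀ f : LipschitzSobolev n Ω μ, (ι (f : SobolevSpace n Ω μ) : M → ℝ) =ᵐ[μ] f)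
    (f g : LipschitzSobolev n Ω μ) :
    inner ℝ (f : SobolevSpace n Ω μ) (g : SobolevSpace n Ω μ) =
      inner ℝ (ι (f : SobolevSpace n Ω μ)) (ι (g : SobolevSpace n Ω μ)) +
        dirichletForm n Ω μ f g := by
  rw [UniformSpace.Completion.inner_coe, LipschitzSobolev.inner_def, L2.inner_def]
  congr 1
  refine integral_congr_ae ?_
  filter_upwards [hι f, hι g] with x hf hg
  rw [hf, hg, RCLike.inner_apply, conj_trivial, mul_comm]

theorem inner_embedding_coe
    (hι : ∀ f : LipschitzSobolev n Ω μ, (ι (f : SobolevSpace n Ω μ) : M → ℝ) =ᵐ[μ] f)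
    (v : Lp ℝ 2 μ) (f : LipschitzSobolev n Ω μ) :
    inner ℝ v (ι (f : SobolevSpace n Ω μ)) = ∫ x, v x * f x ∂μ := by
  rw [L2.inner_def]
  refine integral_congr_ae ?_
  filter_upwards [hι f] with x hf
  rw [hf, RCLike.inner_apply, conj_trivial, mul_comm]

theorem enorm_embedding_coe_sub
    (hι : ∀ f : LipschitzSobolev n Ω μ, (ι (f : SobolevSpace n Ω μ) : M → ℝ) =ᵐ[μ] f)
    (f : LipschitzSobolev n Ω μ) (v : Lp ℝ 2 μ) :
    ‖ι (f : SobolevSpace n Ω μ) - v‖ₑ = eLpNorm (fun x => f x - v x) 2 μ := by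
  rw [Lp.enorm_def]
  refine eLpNorm_congr_ae ?_
  filter_upwards [Lp.coeFn_sub (ι (f : SobolevSpace n Ω μ)) v, hι f] with x h1 h2
  rw [h1, Pi.sub_apply, h2]

theorem exists_lipschitzSobolev_of_isTestFunction (hM : IsAlmostSmooth n Ω μ) {φ : M → ℝ}
    (hφ : IsTestFunction n Ω ∞ φ) : ∃ f : LipschitzSobolev n Ω μ, (f : M → ℝ) = φ :=
  have h1 : IsTestFunction n Ω 1 φ := ⟨hφ.1.of_le (by simp), hφ.2⟩
  ⟨⟨φ, h1.mem_lipschitzFunctions ‹_› hM.dense_regular⟩, rfl⟩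

/-- The orthogonal complement of the range consists of `v` with `∫ v φ dμ = 0` for all test
functions, hence is zero. This makes `j j*` injective, and its inverse single-valued. -/
theorem denseRange_formDomain_embedding (hM : IsAlmostSmooth n Ω μ)
    (hι : ∀ f : LipschitzSobolev n Ω μ, (ι (f : SobolevSpace n Ω μ) : M → ℝ) =ᵐ[μ] f) :
    DenseRange (ι ∘L (formDomain n Ω μ).subtypeL) := by
  change Dense (((ι ∘L (formDomain n Ω μ).subtypeL).range : Submodule ℝ (Lp ℝ 2 μ)) : Set (Lp ℝ 2 μ))
  rw [Submodule.dense_iff_topologicalClosure_eq_top, Submodule.topologicalClosure_eq_top_iff,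
    Submodule.eq_bot_iff]
  intro v hv
  refine (Lp.eq_zero_iff_ae_eq_zero).2 (ae_eq_zero_of_integral_mul_testFunction_eq_zero
    ‹IsWeightedRiemannianMeasure n Ω μ› ((Lp.memLp v).integrable one_le_two) fun φ hφ => ?_)
  obtain ⟨f, rfl⟩ := exists_lipschitzSobolev_of_isTestFunction (n := n) (μ := μ) hM hφ
  rw [← inner_embedding_coe hι, real_inner_comm]
  exact hv _ ⟨⟨f, subset_closure ⟨f, hφ, rfl⟩⟩, rfl⟩

/-- The Sobolev product is the `L²` product plus the form. Adding `⟨p.1, φ⟩` to both sides therefore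
turns the weak equation `-Δ p.1 = p.2` into a Riesz representation problem in the form domain, which
explains the right-hand side `p.1 + p.2`. -/
theorem mem_friedrichsGraph_iff (hM : IsAlmostSmooth n Ω μ)
    (hι : ∀ f : LipschitzSobolev n Ω μ, (ι (f : SobolevSpace n Ω μ) : M → ℝ) =ᵐ[μ] f)
    {p : Lp ℝ 2 μ × Lp ℝ 2 μ} :
    p ∈ friedrichsGraph n Ω μ ↔ ∃ u : formDomain n Ω μ, ι u = p.1 ∧
      ∀ v : formDomain n Ω μ, inner ℝ u v = inner ℝ (p.1 + p.2) (ι v) := by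
  constructor
  · rintro ⟨u, hu, hlim, hcau, hφ⟩
    choose f hf using fun k => exists_lipschitzSobolev_of_isTestFunction (n := n) (μ := μ) hM (hu k)
    obtain rfl : u = fun k => (f k : M → ℝ) := funext fun k => (hf k).symm
    have hι1 : Tendsto (fun k => ι (f k : SobolevSpace n Ω μ)) atTop (𝓝 p.1) := by
      rw [tendsto_iff_edist_tendsto_0]
      refine hlim.congr fun k => ?_
      rw [edist_eq_enorm_sub, enorm_embedding_coe_sub hι]
    -- Convergence in `L²` and the Cauchy property of the form together give the Cauchy property in
    -- the Sobolev norm.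
    have hcauchy : CauchySeq fun k => (f k : SobolevSpace n Ω μ) := by
      have h1 : Tendsto (fun k : ℕ × ℕ => ‖(f k.1 : SobolevSpace n Ω μ) - f k.2‖ ^ 2) atTop
          (𝓝 0) := by
        have h2 : Tendsto (fun k : ℕ × ℕ => ι (f k.1 : SobolevSpace n Ω μ) -
            ι (f k.2 : SobolevSpace n Ω μ)) atTop (𝓝 0) := by
          rw [← prod_atTop_atTop_eq, ← sub_self p.1]
          exact (hι1.comp tendsto_fst).sub (hι1.comp tendsto_snd)
        have h3 := (h2.inner h2 (𝕜 := ℝ)).add hcau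
        rw [inner_zero_left, add_zero] at h3
        refine h3.congr fun k => ?_
        rw [← UniformSpace.Completion.coe_sub, ← real_inner_self_eq_norm_sq,
          inner_sobolev_coe hι, UniformSpace.Completion.coe_sub, map_sub]
        rfl
      rw [cauchySeq_iff_tendsto_dist_atTop_0]
      have h4 := h1.sqrt
      rw [Real.sqrt_zero] at h4
      exact h4.congr fun k => by rw [Real.sqrt_sq (norm_nonneg _), dist_eq_norm]
    obtain ⟨U, hU⟩ := cauchySeq_tendsto_of_complete hcauchy
    have hUV : U ∈ formDomain n Ω μ := mem_closure_of_tendsto hU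
      (Eventually.of_forall fun k => ⟨f k, hu k, rfl⟩)
    have hUι : ι U = p.1 := tendsto_nhds_unique ((ι.continuous.tendsto U).comp hU) hι1
    refine ⟨⟨U, hUV⟩, hUι, ?_⟩
    -- Both sides are continuous in `v`, so the identity need only be checked on the core.
    have hcl : IsClosed {v : SobolevSpace n Ω μ | inner ℝ U v = inner ℝ (p.1 + p.2) (ι v)} :=
      isClosed_eq (by fun_prop) (by fun_prop)
    suffices h : (testSubmodule n Ω μ : Set (SobolevSpace n Ω μ)) ⊆
        {v : SobolevSpace n Ω μ | inner ℝ U v = inner ℝ (p.1 + p.2) (ι v)} from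
      fun v => closure_minimal h hcl v.2
    rintro _ ⟨g, hg, rfl⟩
    have h1 : Tendsto (fun k => inner ℝ (f k : SobolevSpace n Ω μ) (g : SobolevSpace n Ω μ)) atTop
        (𝓝 (inner ℝ U (g : SobolevSpace n Ω μ))) := hU.inner tendsto_const_nhds
    refine tendsto_nhds_unique h1 ?_
    rw [inner_add_left, inner_embedding_coe hι p.2]
    refine ((hι1.inner tendsto_const_nhds).add (hφ g hg)).congr fun k => ?_
    rw [inner_sobolev_coe hι]
  · rintro ⟨⟨U, hUV⟩, hUι, hU⟩
    obtain ⟨w, hw, hlim⟩ := mem_closure_iff_seq_limit.1 hUV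
    choose f hf hfw using hw
    obtain rfl : w = fun k => (f k : SobolevSpace n Ω μ) := funext hfw
    have hι1 : Tendsto (fun k => ι (f k : SobolevSpace n Ω μ)) atTop (𝓝 p.1) := by
      rw [← hUι]
      exact (ι.continuous.tendsto U).comp hlim
    refine ⟨fun k => f k, hf, ?_, ?_, fun φ hφ => ?_⟩
    · rw [tendsto_iff_edist_tendsto_0] at hι1
      refine hι1.congr fun k => ?_
      rw [edist_eq_enorm_sub, enorm_embedding_coe_sub hι]
    · have h1 : Tendsto (fun k : ℕ × ℕ => (f k.1 : SobolevSpace n Ω μ) - f k.2) atTop (𝓝 0) := by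
        rw [← prod_atTop_atTop_eq, ← sub_self U]
        exact (hlim.comp tendsto_fst).sub (hlim.comp tendsto_snd)
      have h2 : Tendsto (fun k : ℕ × ℕ => ι ((f k.1 : SobolevSpace n Ω μ) - f k.2)) atTop (𝓝 0) := by
        have := (ι.continuous.tendsto 0).comp h1
        rwa [map_zero] at this
      have h3 := (h1.inner h1 (𝕜 := ℝ)).sub (h2.inner h2 (𝕜 := ℝ))
      rw [inner_zero_left, inner_zero_left, sub_zero] at h3
      refine h3.congr fun k => ?_
      rw [← UniformSpace.Completion.coe_sub, inner_sobolev_coe hι, add_sub_cancel_left]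
      rfl
    · obtain ⟨g, rfl⟩ := exists_lipschitzSobolev_of_isTestFunction (n := n) (μ := μ) hM hφ
      have h1 : inner ℝ U (g : SobolevSpace n Ω μ) = inner ℝ (p.1 + p.2) (ι (g : SobolevSpace n Ω μ)) :=
        hU ⟨g, subset_closure ⟨g, hφ, rfl⟩⟩
      rw [inner_add_left, ← sub_eq_iff_eq_add'] at h1
      rw [← inner_embedding_coe hι, ← h1]
      refine ((hlim.inner tendsto_const_nhds).sub (hι1.inner tendsto_const_nhds)).congr fun k => ?_
      rw [inner_sobolev_coe hι, add_sub_cancel_left]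

/-- Both the Friedrichs graph and the graph of `(j j*)⁻¹ - 1` are described by the same weak
equation, so the abstract results on shifted inverses apply. -/
theorem exists_isFriedrichsLaplacian (hM : IsAlmostSmooth n Ω μ)
    (hι : ∀ f : LipschitzSobolev n Ω μ, (ι (f : SobolevSpace n Ω μ) : M → ℝ) =ᵐ[μ] f)
    (hc : IsCompactOperator ι) :
    ∃ T : Lp ℝ 2 μ →ₗ.[ℝ] Lp ℝ 2 μ, IsFriedrichsLaplacian n Ω μ T ∧
      IsSelfAdjoint T ∧ HasDiscreteSpectrum T := by
  have : CompleteSpace (formDomain n Ω μ) :=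
    (testSubmodule n Ω μ).isClosed_topologicalClosure.completeSpace_coe
  let j : formDomain n Ω μ →L[ℝ] Lp ℝ 2 μ := ι ∘L (formDomain n Ω μ).subtypeL
  have hj : IsCompactOperator j := hc.comp_clm (formDomain n Ω μ).subtypeL
  have hinj := injective_comp_adjoint (denseRange_formDomain_embedding hM hι)
  refine ⟨shiftedInverse (j ∘L ContinuousLinearMap.adjoint j), ?_,
    isSelfAdjoint_shiftedInverse hinj isSymmetric_comp_adjoint,
    hasDiscreteSpectrum_shiftedInverse hinj isSymmetric_comp_adjoint
      (hj.comp_clm (ContinuousLinearMap.adjoint j))⟩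
  rw [IsFriedrichsLaplacian, shiftedInverse_graph hinj]
  ext p
  rw [mem_friedrichsGraph_iff hM hι, SetLike.mem_coe, mem_shiftedInverseGraph, comp_adjoint_eq_iff]
  rfl

theorem exists_isCompactOperator_embedding_two (hn : 3 ≤ n) (hM : IsAlmostSmooth n Ω μ)
    (hS : SobolevInequality n Ω μ) : ∃ ι : SobolevSpace n Ω μ →L[ℝ] Lp ℝ 2 μ,
      (∀ f : LipschitzSobolev n Ω μ, (ι (f : SobolevSpace n Ω μ) : M → ℝ) =ᵐ[μ] f) ∧
        IsCompactOperator ι := by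
  obtain ⟨S, hSp⟩ := hS.exists_eLpNorm_le
  -- The Sobolev norm dominates the `L²` norm, so the constant is `1`.
  obtain ⟨ι, hι⟩ := exists_sobolevEmbedding (n := n) (Ω := Ω) (μ := μ) (q := 2) (S := 1)
    fun f => by rw [ENNReal.coe_one, one_mul]; exact f.eLpNorm_two_le
  exact ⟨ι, hι, isCompactOperator_sobolevEmbedding hn hM hSp (ENNReal.ofReal_ofNat 2).symm le_rfl
    (two_lt_sobolevExponent hn) hι⟩

end FormDomain
end AlmostSmooth

/-! ### The main theorem -/

theorem mainTheorem10 {n : ℕ} (hn : 3 ≤ n)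
    {M : Type*} [MetricSpace M] [CompactSpace M] [MeasurableSpace M] [BorelSpace M]
    (Ω : Opens M) [ChartedSpace (EuclideanSpace ℝ (Fin n)) Ω] [IsManifold (𝓡 n) ∞ Ω]
    [RiemannianBundle (fun x : Ω => TangentSpace (𝓡 n) x)]
    [IsContMDiffRiemannianBundle (𝓡 n) ∞ (EuclideanSpace ℝ (Fin n))
      (fun x : Ω => TangentSpace (𝓡 n) x)]
    [IsRiemannianManifold (𝓡 n) Ω]
    (μ : Measure M) [IsFiniteMeasure μ] [AlmostSmooth.IsWeightedRiemannianMeasure n Ω μ]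
    (hM : AlmostSmooth.IsAlmostSmooth n Ω μ)
    (hS : AlmostSmooth.SobolevInequality n Ω μ) :
    (∀ p : ℝ, (n : ℝ) < p →
      AlmostSmooth.CompactlyEmbeds n Ω μ (ENNReal.ofReal (2 * p / (p - 2)))) ∧
    ∃ T : Lp ℝ 2 μ →ₗ.[ℝ] Lp ℝ 2 μ, AlmostSmooth.IsFriedrichsLaplacian n Ω μ T ∧
      IsSelfAdjoint T ∧ AlmostSmooth.HasDiscreteSpectrum T := by
  obtain ⟨ι, hι, hc⟩ := AlmostSmooth.exists_isCompactOperator_embedding_two hn hM hS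
  exact ⟨fun p hp => AlmostSmooth.compactlyEmbeds_of_lt hn hM hS hp,
    AlmostSmooth.exists_isFriedrichsLaplacian hM hι hc⟩
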